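/- Let $0<p<1$, $q=1-p$, $\kappa=1/q$. Define $\mu_0=0$, $\mu_1=1$ and $$\mu_n=\mu_{n-1}+\sum_{0\le k<n}\binom{n-1}{k}p^{n-1-k}q^k\mu_k\qquad(n\ge2),$$ and let $\tilde f(x)=e^{-x}\sum_{n\ge0}\mu_n x^n/n!$ be the Poisson generating function of $\mu_n$. Let $$F(s)=\sum_{j\in\mathbb Z}\frac{q^{j(j+1)/2}}{1+q^js}\,s^{j+1}\quad(s>0),\qquad G(u)=q^{(\{u\}^2+\{u\})/2}\,F\bigl(q^{-\{u\}}\bigr),$$ where $\{u\}$ is the fractional part of $u$. Then: (i) $\tilde f(0)=0$ and $\tilde f'(x)=\tilde f(qx)+e^{-x}$ for all real $x$. (ii) For every $x>0$ there is exactly one $r=r(x)>0$ with $\frac1r\log\frac1r=x\log\kappa$. (iii) There are bounded, $1$-periodic functions $\phi_j$ ($j\ge1$) on $\mathbb R$ such that, with this $r=r(x)$, as $x\to\infty$, $$\tilde f(x)\sim\frac{e^{(\log(1/r))^2/(2\log\kappa)}\,G(\log_\kappa(1/r))}{r^{1/\log\kappa+1/2}\sqrt{2\pi\log_\kappa(1/r)}}\Bigl(1+\sum_{j\ge1}\phi_j(\log_\kappa(1/r))\,(\log_\kappa(1/r))^{-j}\Bigr)$$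 as an asymptotic expansion, i.e. for every $J\ge0$, truncating the sum at $j=J$ leaves an error equal to the prefactor times $O\bigl((\log_\kappa(1/r))^{-J-1}\bigr)$. Each $\phi_j(u)$ is a polynomial (with real coefficients not depending on $u$) in $\{u\}$ and in the quantities $Q^kF^{(k)}(Q)/F(Q)$, $1\le k\le 2j$, where $Q=q^{-\{u\}}$. In particular, $$\phi_1(u)=-\left(\frac1{12}-\frac{\{u\}(1-\{u\})}2+\frac{(1-\{u\})\,q^{-\{u\}}F'(q^{-\{u\}})}{F(q^{-\{u\}})}+\frac{q^{-2\{u\}}F''(q^{-\{u\}})}{2F(q^{-\{u\}})}\right).$$ (iv) As $x\to\infty$, $$\tilde f(x)=\frac{G\left(\log_\kappa\frac{x}{\log_\kappa x}\right)}{\sqrt{2\pi}}\cdot\frac{x^{1/\log\kappa+1/2}}{\log_\kappa x}\exp\left(\frac{\left(\log\frac{x}{\log_\kappa x}\right)^2}{2\log\kappa}\right)\left(1+O\left(\frac{(\log\log x)^2}{\log x}\right)\right).$$ The implied constants may depend on $p$ (and on $J$). -/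

import Mathlib

open Filter Asymptotics

/-- The mean values `μ_n` for edge probability `p`: `μ_0 = 0`, `μ_1 = 1` and, for `n ≥ 2`,
`μ_n = μ_{n-1} + ∑_{0 ≤ k < n} C(n-1, k) p^(n-1-k) (1-p)^k μ_k`. -/
noncomputable def mu (p : ℝ) : ℕ → ℝ
  | 0 => 0
  | 1 => 1
  | n + 2 => mu p (n + 1) +
      ∑ k : Fin (n + 2), ((n + 1).choose k : ℝ) * p ^ (n + 1 - (k : ℕ)) * (1 - p) ^ (k : ℕ) * mu p k

/-- The Poisson generating function `e^{-x} ∑_{n ≥ 0} μ_n x^n / n!` of the sequence `μ_n`. -/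
noncomputable def poissonGF (p x : ℝ) : ℝ :=
  Real.exp (-x) * ∑' n : ℕ, mu p n * x ^ n / (n.factorial : ℝ)

/-- The bilateral series `F(s) = ∑_{j ∈ ℤ} q^{j(j+1)/2} s^{j+1} / (1 + q^j s)`
(the integer division in the exponent is exact). -/
noncomputable def thetaF (q s : ℝ) : ℝ :=
  ∑' j : ℤ, q ^ (j * (j + 1) / 2) / (1 + q ^ j * s) * s ^ (j + 1)

/-- The `1`-periodic function `G(u) = q^{({u}² + {u})/2} F(q^{-{u}})`. -/
noncomputable def periodicG (q u : ℝ) : ℝ :=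
  q ^ ((Int.fract u ^ 2 + Int.fract u) / 2) * thetaF q (q ^ (-Int.fract u))

/-- `r > 0` solves the saddle-point equation `(1/r) log (1/r) = x log κ`. -/
def IsSaddle (κ x r : ℝ) : Prop :=
  0 < r ∧ 1 / r * Real.log (1 / r) = x * Real.log κ

/-- The prefactor
`e^{(log (1/r))² / (2 log κ)} G(log_κ (1/r)) / (r^{1/log κ + 1/2} √(2π log_κ (1/r)))`,
where `q = 1/κ`. -/
noncomputable def saddleMain (q κ r : ℝ) : ℝ :=
  Real.exp (Real.log (1 / r) ^ 2 / (2 * Real.log κ)) * periodicG q (Real.logb κ (1 / r)) /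
    (r ^ (1 / Real.log κ + 1 / 2) * Real.sqrt (2 * Real.pi * Real.logb κ (1 / r)))

/-- The leading term in terms of `x`:
`G(log_κ (x / log_κ x)) / √(2π) · x^{1/log κ + 1/2} / log_κ x
  · exp ((log (x / log_κ x))² / (2 log κ))`, where `q = 1/κ`. -/
noncomputable def logMain (q κ x : ℝ) : ℝ :=
  periodicG q (Real.logb κ (x / Real.logb κ x)) / Real.sqrt (2 * Real.pi) *
    (x ^ (1 / Real.log κ + 1 / 2) / Real.logb κ x) *
    Real.exp (Real.log (x / Real.logb κ x) ^ 2 / (2 * Real.log κ))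

/-! The differential equation is solved by iteration: the generating function equals Σ_j
q^{j(j+1)/2} E_j(x), where E_j is the convolution of s^j/j! with e^{-q^j s} (`hasSum_gfTerm`). The
saddle-point equation reads x = u/r with u = log_κ(1/r). Put N = ⌊u⌋, f = {u}, Q = q^{-f}, so that
1/r = Q q^{-N}. Rescaling to the argument u and writing j = N + i turns the series into an explicit
prefactor times a sum over i carrying the Gaussian weights q^{i(i+1)/2} Q^{i+1} of F
(`hasSum_shiftedTerm`).

Each rescaled convolution is recovered by Fourier inversion on the line Re w = 1, where its
transform is w^{-N-1} (1+v)^{i+1} / (1 + c(1+v)) with v = 1/w - 1 and c = q^i Q. The factor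
depending on v is expanded at v = 0. Multiplication by 1/w raises the index of the Poisson weight
e^{-u} u^N / N! by one, so w^{-N-1} v^l inverts to an l-th forward difference of Poisson weights,
while the remainder after K terms is O(N^{-(K+1)/2}). Summing the Taylor coefficients over i
produces Q^l F^{(l)}(Q) / l!. Thus the generating function is, up to the prefactor, a combination of
these quantities with Poisson differences (`exists_abs_poissonGF_sub_le`), and no contour is
deformed.

Stirling's series gives the Poisson differences, multiplied by √(2πu), expansions in 1/u whose
coefficients are polynomials in f, uniformly in f (`exists_diffNorm_expansion`). The Fourier bound
shows that the l-th normalized difference is O(u^{-l/2}), so only l ≤ 2j contribute to u^{-j}; hence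
φ_j involves derivatives of F of order at most 2j.

For (iv), log x = u log κ + log u makes the ratio of the two leading terms explicit. It is 1 +
O((log u)²/u), because G is Lipschitz and bounded below; smoothness of G comes from the functional
equation F(s) = s F(qs). -/

/-! ### Growth of the mean values and the differential equation -/

theorem mu_succ (p : ℝ) (n : ℕ) :
    mu p (n + 1) = mu p n + ∑ k ∈ Finset.range (n + 1),
      (n.choose k : ℝ) * p ^ (n - k) * (1 - p) ^ k * mu p k + if n = 0 then 1 else 0 := by
  cases n with
  | zero => simp [mu]
  | succ n =>
    rw [mu, Finset.sum_range]
    simp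

/-- The binomial weights sum to one, so the recurrence at most doubles the bound. Geometric growth
makes the exponential generating function entire. -/
theorem mu_bounds {p : ℝ} (hp0 : 0 ≤ p) (hp1 : p ≤ 1) (n : ℕ) : 0 ≤ mu p n ∧ mu p n ≤ 2 ^ n := by
  induction n using Nat.strong_induction_on with
  | _ n ih =>
    match n, ih with
    | 0, _ => simp [mu]
    | 1, _ => simp [mu]
    | n + 2, ih =>
      have hq : 0 ≤ 1 - p := by linarith
      rw [mu_succ]
      simp only [Nat.add_eq_zero_iff, one_ne_zero, and_false, if_false, add_zero]
      have h1 := ih (n + 1) (by omega)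
      have hw : ∀ k, 0 ≤ ((n + 1).choose k : ℝ) * p ^ (n + 1 - k) * (1 - p) ^ k := fun k => by
        positivity
      have hs : ∑ k ∈ Finset.range (n + 1 + 1),
          ((n + 1).choose k : ℝ) * p ^ (n + 1 - k) * (1 - p) ^ k * mu p k ≤ 2 ^ (n + 1) := by
        calc _ ≤ ∑ k ∈ Finset.range (n + 1 + 1),
              ((n + 1).choose k : ℝ) * p ^ (n + 1 - k) * (1 - p) ^ k * 2 ^ (n + 1) := by
              refine Finset.sum_le_sum fun k hk => mul_le_mul_of_nonneg_left ?_ (hw k)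
              rw [Finset.mem_range] at hk
              exact (ih k (by omega)).2.trans (pow_le_pow_right₀ (by norm_num) (by omega))
          _ = ((1 - p) + p) ^ (n + 1) * 2 ^ (n + 1) := by
              rw [add_pow, Finset.sum_mul]
              exact Finset.sum_congr rfl fun k _ => by ring
          _ = _ := by simp
      have hs0 : 0 ≤ ∑ k ∈ Finset.range (n + 1 + 1),
          ((n + 1).choose k : ℝ) * p ^ (n + 1 - k) * (1 - p) ^ k * mu p k :=
        Finset.sum_nonneg fun k hk =>
          mul_nonneg (hw k) (ih k (by rw [Finset.mem_range] at hk; omega)).1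
      constructor
      · linarith [h1.1]
      · rw [pow_succ]; linarith [h1.2]

theorem summable_egf {a : ℕ → ℝ} {A : ℝ} (ha : ∀ n, |a n| ≤ A ^ n) (x : ℝ) :
    Summable fun n : ℕ => ‖a n * x ^ n / (n.factorial : ℝ)‖ := by
  refine Summable.of_nonneg_of_le (fun _ => norm_nonneg _) (fun n => ?_)
    (Real.summable_pow_div_factorial (A * |x|))
  rw [norm_div, norm_mul, norm_pow, Real.norm_eq_abs, Real.norm_eq_abs, RCLike.norm_natCast,
    mul_pow]
  gcongr
  exact ha n

theorem hasDerivAt_egf {a : ℕ → ℝ} {A : ℝ} (ha : ∀ n, |a n| ≤ A ^ n) (x : ℝ) :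
    HasDerivAt (fun x : ℝ => ∑' n : ℕ, a n * x ^ n / (n.factorial : ℝ))
      (∑' n : ℕ, a (n + 1) * x ^ n / (n.factorial : ℝ)) x := by
  have hA : 0 ≤ A := by simpa using (abs_nonneg _).trans (ha 1)
  set R := |x| + 1
  have hx : x ∈ Metric.ball (0 : ℝ) R := by simp [R]
  have hR : 0 ≤ R := by positivity
  -- At n = 0 truncated subtraction makes the majorant equal to A, which is harmless because the
  -- differentiated term is zero there.
  have hs : Summable fun n : ℕ => A * ((A * R) ^ (n - 1) / ((n - 1).factorial : ℝ)) := by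
    refine ((summable_nat_add_iff 1).mp ?_)
    simpa using (Real.summable_pow_div_factorial (A * R)).mul_left A
  have key := hasDerivAt_tsum_of_isPreconnected (𝕜 := ℝ)
    (g := fun (n : ℕ) (x : ℝ) => a n * x ^ n / (n.factorial : ℝ))
    (g' := fun (n : ℕ) (x : ℝ) => a n * (n * x ^ (n - 1)) / (n.factorial : ℝ))
    (t := Metric.ball (0 : ℝ) R) (y₀ := 0) (y := x)
    (u := fun n => A * ((A * R) ^ (n - 1) / ((n - 1).factorial : ℝ)))
    hs Metric.isOpen_ball (convex_ball _ _).isPreconnected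
    (fun n y _ => ((hasDerivAt_pow n y).const_mul _).div_const _) ?_ (by simp [R]; positivity)
    (summable_egf ha 0).of_norm hx
  · refine key.congr_deriv ?_
    rw [Summable.tsum_eq_zero_add (f := fun n : ℕ => a n * (n * x ^ (n - 1)) / (n.factorial : ℝ))]
    · simp only [Nat.cast_zero, zero_mul, mul_zero, zero_div, zero_add, Nat.add_sub_cancel]
      refine tsum_congr fun n => ?_
      rw [Nat.factorial_succ]
      push_cast
      field_simp
    · refine (summable_nat_add_iff 1).mp ?_
      have := summable_egf (a := fun n => a (n + 1) * A⁻¹) (A := A) (fun n => ?_) x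
      -- The shifted sequence is divided by A to keep the bound A^n; when A = 0 all its entries
      -- vanish.
      · rcases eq_or_lt_of_le hA with h0 | h0
        · have : ∀ n, a (n + 1) = 0 := fun n => by
            have := ha (n + 1)
            rw [← h0, zero_pow (by omega)] at this
            exact abs_nonpos_iff.mp this
          simp [this, summable_zero]
        · refine (this.of_norm.mul_left A).congr fun n => ?_
          rw [Nat.factorial_succ, Nat.add_sub_cancel]
          push_cast
          field_simp
      · rcases eq_or_lt_of_le hA with h0 | h0
        · rw [← h0]; simp
        · rw [abs_mul, abs_inv, abs_of_pos h0, ← div_eq_mul_inv, div_le_iff₀ h0, ← pow_succ]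
          exact ha _
  · intro n y hy
    rw [mem_ball_zero_iff, Real.norm_eq_abs] at hy
    cases n with
    | zero => simp; positivity
    | succ n =>
      simp only [Nat.add_sub_cancel]
      rw [Nat.factorial_succ, norm_div, norm_mul, norm_mul, norm_pow, Real.norm_eq_abs,
        RCLike.norm_natCast, RCLike.norm_natCast, Real.norm_eq_abs]
      push_cast
      rw [show |a (n + 1)| * ((n + 1) * |y| ^ n) / ((n + 1) * (n.factorial : ℝ))
        = |a (n + 1)| * |y| ^ n / (n.factorial : ℝ) by field_simp, ← mul_div_assoc, mul_pow,
        ← mul_assoc, ← pow_succ']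
      gcongr
      exact ha _

theorem poissonGF_zero (p : ℝ) : poissonGF p 0 = 0 := by
  unfold poissonGF
  rw [tsum_eq_single 0 fun n hn => by simp [hn]]
  simp [mu]

theorem hasDerivAt_poissonGF {p : ℝ} (hp0 : 0 ≤ p) (hp1 : p ≤ 1) (x : ℝ) :
    HasDerivAt (poissonGF p) (poissonGF p ((1 - p) * x) + Real.exp (-x)) x := by
  have hmu : ∀ n, |mu p n| ≤ 2 ^ n := fun n => by
    rw [abs_of_nonneg (mu_bounds hp0 hp1 n).1]; exact (mu_bounds hp0 hp1 n).2
  have h1 := (Real.hasDerivAt_exp (-x)).comp x (hasDerivAt_neg x)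
  have h2 := h1.mul (hasDerivAt_egf hmu x)
  -- The binomial sum is the Cauchy product of the series at qx with that of e^{px}; the factor
  -- e^{-x} then leaves e^{-qx}.
  have hcauchy : ∑' n : ℕ, (∑ k ∈ Finset.range (n + 1),
        (n.choose k : ℝ) * p ^ (n - k) * (1 - p) ^ k * mu p k) * x ^ n / (n.factorial : ℝ) =
      (∑' n : ℕ, mu p n * ((1 - p) * x) ^ n / (n.factorial : ℝ)) * Real.exp (p * x) := by
    rw [Real.exp_eq_exp_ℝ, NormedSpace.exp_eq_tsum_div]
    dsimp only
    rw [tsum_mul_tsum_eq_tsum_sum_range_of_summable_norm (summable_egf hmu _)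
      (Real.summable_pow_div_factorial (p * x)).norm]
    refine tsum_congr fun n => ?_
    rw [Finset.sum_mul, Finset.sum_div]
    refine Finset.sum_congr rfl fun k hk => ?_
    have hk' : k ≤ n := by rw [Finset.mem_range] at hk; omega
    rw [Nat.cast_choose ℝ hk', mul_pow, mul_pow]
    have : x ^ n = x ^ k * x ^ (n - k) := by rw [← pow_add]; congr 1; omega
    rw [this]
    have := Nat.factorial_ne_zero n
    field_simp
  have hsum_c : Summable fun n : ℕ => (∑ k ∈ Finset.range (n + 1),
        (n.choose k : ℝ) * p ^ (n - k) * (1 - p) ^ k * mu p k) * x ^ n / (n.factorial : ℝ) := by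
    refine (summable_egf (A := 2) (fun n => ?_) x).of_norm
    have hq : 0 ≤ 1 - p := by linarith
    rw [abs_of_nonneg (Finset.sum_nonneg fun k _ => mul_nonneg (by positivity)
      (mu_bounds hp0 hp1 k).1)]
    calc _ ≤ ∑ k ∈ Finset.range (n + 1), (n.choose k : ℝ) * p ^ (n - k) * (1 - p) ^ k * 2 ^ n := by
          refine Finset.sum_le_sum fun k hk => mul_le_mul_of_nonneg_left ?_ (by positivity)
          rw [Finset.mem_range] at hk
          exact (mu_bounds hp0 hp1 k).2.trans (pow_le_pow_right₀ (by norm_num) (by omega))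
      _ = ((1 - p) + p) ^ n * 2 ^ n := by
          rw [add_pow, Finset.sum_mul]
          exact Finset.sum_congr rfl fun k _ => by ring
      _ = 2 ^ n := by simp
  have hE := (summable_egf hmu x).of_norm
  -- The exceptional first step of the recurrence is a series with the single term 1; it is the
  -- source of the inhomogeneity e^{-x}.
  have hδ : HasSum (fun n : ℕ => (if n = 0 then (1 : ℝ) else 0) * x ^ n / (n.factorial : ℝ)) 1 := by
    convert hasSum_single (f := fun n : ℕ =>
      (if n = 0 then (1 : ℝ) else 0) * x ^ n / (n.factorial : ℝ)) 0 (fun n hn => by simp [hn])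
    simp
  have hsplit : ∑' n : ℕ, mu p (n + 1) * x ^ n / (n.factorial : ℝ) =
      (∑' n : ℕ, mu p n * x ^ n / (n.factorial : ℝ)) +
      (∑' n : ℕ, mu p n * ((1 - p) * x) ^ n / (n.factorial : ℝ)) * Real.exp (p * x) + 1 := by
    rw [← hcauchy]
    refine HasSum.tsum_eq (((hE.hasSum.add hsum_c.hasSum).add hδ).congr_fun fun n => ?_)
    rw [mu_succ]
    ring
  have e1 : Real.exp (-((1 - p) * x)) = Real.exp (-x) * Real.exp (p * x) := by
    rw [← Real.exp_add]; ring_nf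
  refine h2.congr_deriv ?_
  rw [hsplit]
  unfold poissonGF
  simp only [Function.comp]
  rw [e1]
  ring

/-! ### Series solution of the differential equation -/

/-- The convolution `∫₀ˣ s^j / j! · e^{-c (x - s)} ds`, whose Laplace transform is
`s^{-j-1} / (s + c)`. -/
noncomputable def expConv (j : ℕ) (c x : ℝ) : ℝ :=
  Real.exp (-(c * x)) * ∫ s in (0 : ℝ)..x, s ^ j / (j.factorial : ℝ) * Real.exp (c * s)

theorem expConv_zero (j : ℕ) (c : ℝ) : expConv j c 0 = 0 := by simp [expConv]

theorem expConv_nonneg (j : ℕ) (c : ℝ) {x : ℝ} (hx : 0 ≤ x) : 0 ≤ expConv j c x := by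
  refine mul_nonneg (Real.exp_nonneg _) (intervalIntegral.integral_nonneg hx fun s hs => ?_)
  have := hs.1
  positivity

theorem hasDerivAt_expConv (j : ℕ) (c x : ℝ) :
    HasDerivAt (expConv j c) (x ^ j / (j.factorial : ℝ) - c * expConv j c x) x := by
  have hc : Continuous fun s : ℝ => s ^ j / (j.factorial : ℝ) * Real.exp (c * s) := by fun_prop
  have h1 : HasDerivAt (fun x => ∫ s in (0 : ℝ)..x, s ^ j / (j.factorial : ℝ) * Real.exp (c * s))
      (x ^ j / (j.factorial : ℝ) * Real.exp (c * x)) x :=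
    (hc.integral_hasStrictDerivAt 0 x).hasDerivAt
  have h2 : HasDerivAt (fun x => Real.exp (-(c * x))) (Real.exp (-(c * x)) * (-(c * 1))) x :=
    (((hasDerivAt_id x).const_mul c).neg).exp
  refine (h2.mul h1).congr_deriv ?_
  have : Real.exp (-(c * x)) * Real.exp (c * x) = 1 := by rw [← Real.exp_add]; simp
  unfold expConv
  linear_combination (x ^ j / (j.factorial : ℝ)) * this

theorem eq_zero_of_hasDerivAt_neg_mul {D : ℝ → ℝ} {c : ℝ}
    (hD : ∀ x, HasDerivAt D (-(c * D x)) x) (h0 : D 0 = 0) (x : ℝ) : D x = 0 := by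
  have h : ∀ x, HasDerivAt (fun x => Real.exp (c * x) * D x) 0 x := fun x => by
    have h2 : HasDerivAt (fun x => Real.exp (c * x)) (Real.exp (c * x) * (c * 1)) x :=
      ((hasDerivAt_id x).const_mul c).exp
    exact (h2.mul (hD x)).congr_deriv (by ring)
  have := is_const_of_deriv_eq_zero (fun x => (h x).differentiableAt) (fun x => (h x).deriv) x 0
  simpa [h0, Real.exp_ne_zero] using this

/-- In Laplace transforms this is s^{-j-1}/(s+c) + c s^{-j-2}/(s+c) = s^{-j-2}. Here the difference
D of the two sides satisfies D' = -cD and D(0) = 0. -/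
theorem expConv_add_mul_succ (j : ℕ) (c x : ℝ) :
    expConv j c x + c * expConv (j + 1) c x = x ^ (j + 1) / ((j + 1).factorial : ℝ) := by
  have key := eq_zero_of_hasDerivAt_neg_mul (c := c)
    (D := fun x => expConv j c x + c * expConv (j + 1) c x - x ^ (j + 1) / ((j + 1).factorial : ℝ))
    (fun x => ?_) (by simp [expConv_zero]) x
  · linarith
  · refine (((hasDerivAt_expConv j c x).add ((hasDerivAt_expConv (j + 1) c x).const_mul c)).sub
      ((hasDerivAt_pow (j + 1) x).div_const _)).congr_deriv ?_
    have : (j.factorial : ℝ) ≠ 0 := Nat.cast_ne_zero.mpr j.factorial_ne_zero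
    rw [Nat.factorial_succ, Nat.add_sub_cancel]
    push_cast
    field_simp
    ring

theorem hasDerivAt_expConv_succ (j : ℕ) (c x : ℝ) :
    HasDerivAt (expConv (j + 1) c) (expConv j c x) x := by
  refine (hasDerivAt_expConv (j + 1) c x).congr_deriv ?_
  linarith [expConv_add_mul_succ j c x]

theorem expConv_mul (j : ℕ) (c a x : ℝ) :
    expConv j c (a * x) = a ^ (j + 1) * expConv j (a * c) x := by
  unfold expConv
  have := intervalIntegral.mul_integral_comp_mul_left (a := 0) (b := x)
    (f := fun s => s ^ j / (j.factorial : ℝ) * Real.exp (c * s)) a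
  have h2 : ∫ s in (0 : ℝ)..x, (a * s) ^ j / (j.factorial : ℝ) * Real.exp (c * (a * s)) =
      a ^ j * ∫ s in (0 : ℝ)..x, s ^ j / (j.factorial : ℝ) * Real.exp (a * c * s) := by
    rw [← intervalIntegral.integral_const_mul]
    congr 1
    ext s
    rw [mul_pow, show c * (a * s) = a * c * s by ring]
    ring
  rw [mul_zero, h2] at this
  rw [← this, show -(c * (a * x)) = -(a * c * x) by ring]
  ring

/-- The `j`-th term of the series of the Poisson generating function. -/
noncomputable def gfTerm (q : ℝ) (j : ℕ) (x : ℝ) : ℝ :=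
  q ^ (j * (j + 1) / 2) * expConv j (q ^ j) x

theorem hasDerivAt_gfTerm_zero (q x : ℝ) : HasDerivAt (gfTerm q 0) (Real.exp (-x)) x := by
  have h : ∀ y, gfTerm q 0 y = 1 - Real.exp (-y) := fun y => by
    simp only [gfTerm, expConv, zero_mul, Nat.zero_div, pow_zero, one_mul, Nat.factorial_zero,
      Nat.cast_one, div_one, integral_exp, Real.exp_zero]
    rw [mul_sub, ← Real.exp_add]
    simp
  rw [funext h]
  exact (((hasDerivAt_neg x).exp).const_sub 1).congr_deriv (by simp)

/-- Scaling by q in `expConv_mul` costs q^{j+1}, exactly the increment between consecutive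
triangular exponents. Hence the partial sums telescope in the differential equation. -/
theorem hasDerivAt_gfTerm_succ (q : ℝ) (j : ℕ) (x : ℝ) :
    HasDerivAt (gfTerm q (j + 1)) (gfTerm q j (q * x)) x := by
  refine ((hasDerivAt_expConv_succ j (q ^ (j + 1)) x).const_mul _).congr_deriv ?_
  rw [gfTerm, expConv_mul, ← mul_assoc, ← pow_add, ← pow_succ']
  congr 2
  rw [show (j + 1) * (j + 1 + 1) = j * (j + 1) + 2 * (j + 1) by ring,
    Nat.add_mul_div_left _ _ (by norm_num)]

/-- The remainder R_n after n terms satisfies R_{n+1}'(y) = R_n(qy) and R_{n+1}(0) = 0. As qy ≤ y,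
induction with the mean value inequality gives |R_n(y)| ≤ M y^n / n! on [0, x], where M bounds the
generating function there. -/
theorem hasSum_gfTerm {p : ℝ} (hp0 : 0 ≤ p) (hp1 : p ≤ 1) {x : ℝ} (hx : 0 ≤ x) :
    HasSum (fun j => gfTerm (1 - p) j x) (poissonGF p x) := by
  set q := 1 - p with hq
  have hq0 : 0 ≤ q := by linarith
  have hq1 : q ≤ 1 := by linarith
  obtain ⟨M, hM⟩ := (isCompact_Icc (a := (0 : ℝ)) (b := x)).exists_bound_of_continuousOn
    (f := poissonGF p) fun y _ => (hasDerivAt_poissonGF hp0 hp1 y).continuousAt.continuousWithinAt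
  have hR : ∀ n : ℕ, ∀ y ∈ Set.Icc 0 x,
      ‖poissonGF p y - ∑ j ∈ Finset.range n, gfTerm q j y‖ ≤ M * (y ^ n / (n.factorial : ℝ)) := by
    intro n
    induction n with
    | zero => intro y hy; simpa using hM y hy
    | succ n ih =>
      have hd : ∀ y, HasDerivAt (fun y => poissonGF p y - ∑ j ∈ Finset.range (n + 1), gfTerm q j y)
          (poissonGF p (q * y) - ∑ j ∈ Finset.range n, gfTerm q j (q * y)) y := fun y => by
        have h1 : HasDerivAt (fun y => ∑ j ∈ Finset.range (n + 1), gfTerm q j y)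
            (∑ j ∈ Finset.range n, gfTerm q j (q * y) + Real.exp (-y)) y := by
          simp only [Finset.sum_range_succ']
          exact (HasDerivAt.fun_sum fun j _ => hasDerivAt_gfTerm_succ q j y).add
            (hasDerivAt_gfTerm_zero q y)
        exact ((hasDerivAt_poissonGF hp0 hp1 y).sub h1).congr_deriv (by ring)
      refine image_norm_le_of_norm_deriv_right_le_deriv_boundary
        (fun y _ => (hd y).continuousAt.continuousWithinAt)
        (fun y _ => (hd y).hasDerivWithinAt) ?_
        (fun y => ((hasDerivAt_pow (n + 1) y).div_const _).const_mul M) ?_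
      · simp [poissonGF_zero, gfTerm, expConv_zero]
      · intro y hy
        have hqy : q * y ≤ y := mul_le_of_le_one_left hy.1 hq1
        have hM0 : 0 ≤ M := (norm_nonneg _).trans (hM 0 ⟨le_rfl, hx⟩)
        refine (ih (q * y) ⟨mul_nonneg hq0 hy.1, hqy.trans hy.2.le⟩).trans ?_
        rw [Nat.factorial_succ, Nat.add_sub_cancel]
        push_cast
        rw [mul_div_mul_left _ _ (by positivity)]
        have := mul_nonneg hq0 hy.1
        gcongr
  have h0 : ∀ j, 0 ≤ gfTerm q j x := fun j =>
    mul_nonneg (by positivity) (expConv_nonneg _ _ hx)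
  rw [hasSum_iff_tendsto_nat_of_nonneg h0]
  have hz : Tendsto (fun n : ℕ => M * (x ^ n / (n.factorial : ℝ))) atTop (nhds 0) := by
    simpa using (FloorSemiring.tendsto_pow_div_factorial_atTop x).const_mul M
  have := squeeze_zero_norm (fun n => hR n x ⟨hx, le_rfl⟩) hz
  simpa using this.const_sub (poissonGF p x)

/-! ### Laplace transforms and their inversion on Re w = 1 -/

theorem expConv_le (j : ℕ) {c : ℝ} (hc : 0 ≤ c) {x : ℝ} (hx : 0 ≤ x) :
    expConv j c x ≤ x ^ (j + 1) / ((j + 1).factorial : ℝ) := by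
  rw [← expConv_add_mul_succ j c x]
  exact le_add_of_nonneg_right (mul_nonneg hc (expConv_nonneg _ _ hx))

theorem continuous_expConv (j : ℕ) (c : ℝ) : Continuous (expConv j c) :=
  continuous_iff_continuousAt.mpr fun x => (hasDerivAt_expConv j c x).continuousAt

theorem integrableOn_pow_mul_exp_neg (k : ℕ) :
    MeasureTheory.IntegrableOn (fun y : ℝ => y ^ k * Real.exp (-y)) (Set.Ioi 0) := by
  refine (Real.GammaIntegral_convergent (s := k + 1) (by positivity)).congr_fun (fun y hy => ?_)
    measurableSet_Ioi
  simp [mul_comm]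

theorem norm_exp_neg_mul {w : ℂ} (hw : w.re = 1) (y : ℝ) :
    ‖Complex.exp (-(w * y))‖ = Real.exp (-y) := by
  rw [Complex.norm_exp]; simp [hw]

theorem integrableOn_mul_exp_neg {h : ℝ → ℝ} (hc : Continuous h) {k : ℕ}
    (hb : ∀ y, 0 ≤ y → |h y| ≤ y ^ k) {w : ℂ} (hw : w.re = 1) :
    MeasureTheory.IntegrableOn (fun y : ℝ => (h y : ℂ) * Complex.exp (-(w * y))) (Set.Ioi 0) := by
  refine MeasureTheory.Integrable.mono' (integrableOn_pow_mul_exp_neg k)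
    (Continuous.aestronglyMeasurable (by fun_prop)) ?_
  filter_upwards [MeasureTheory.ae_restrict_mem measurableSet_Ioi] with y hy
  rw [norm_mul, norm_exp_neg_mul hw, Complex.norm_real, Real.norm_eq_abs]
  exact mul_le_mul_of_nonneg_right (hb y (le_of_lt hy)) (Real.exp_nonneg _)

/-- The Laplace transform of a solution of `h' = g - c h`, `h 0 = 0`. -/
theorem laplace_of_hasDerivAt {h g : ℝ → ℝ} {c : ℝ} (hd : ∀ y, HasDerivAt h (g y - c * h y) y)
    (hg : Continuous g) (h0 : h 0 = 0) {k l : ℕ} (hb : ∀ y, 0 ≤ y → |h y| ≤ y ^ k)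
    (gb : ∀ y, 0 ≤ y → |g y| ≤ y ^ l) {w : ℂ} (hw : w.re = 1) :
    ∫ y in Set.Ioi (0 : ℝ), (g y : ℂ) * Complex.exp (-(w * y)) =
      (w + c) * ∫ y in Set.Ioi (0 : ℝ), (h y : ℂ) * Complex.exp (-(w * y)) := by
  have hc : Continuous h := continuous_iff_continuousAt.mpr fun x => (hd x).continuousAt
  have I1 := integrableOn_mul_exp_neg hc hb hw
  have I2 := integrableOn_mul_exp_neg hg gb hw
  have hder : ∀ y : ℝ, HasDerivAt (fun y : ℝ => (h y : ℂ) * Complex.exp (-(w * y)))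
      ((g y : ℂ) * Complex.exp (-(w * y)) - (w + c) * ((h y : ℂ) * Complex.exp (-(w * y)))) y := by
    intro y
    have e1 : HasDerivAt (fun y : ℝ => Complex.exp (-(w * y))) (Complex.exp (-(w * y)) * -(w * 1)) y :=
      (((hasDerivAt_id y).ofReal_comp.const_mul w).neg).cexp
    refine ((hd y).ofReal_comp.mul e1).congr_deriv ?_
    push_cast
    ring
  have ht : Tendsto (fun y : ℝ => (h y : ℂ) * Complex.exp (-(w * y))) atTop (nhds 0) := by
    refine squeeze_zero_norm' ?_ (Real.tendsto_pow_mul_exp_neg_atTop_nhds_zero k)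
    filter_upwards [eventually_ge_atTop 0] with y hy
    rw [norm_mul, norm_exp_neg_mul hw, Complex.norm_real, Real.norm_eq_abs]
    exact mul_le_mul_of_nonneg_right (hb y hy) (Real.exp_nonneg _)
  have key := MeasureTheory.integral_Ioi_of_hasDerivAt_of_tendsto' (a := 0)
    (fun y _ => hder y) (I2.sub (I1.const_mul (w + c))) ht
  rw [MeasureTheory.integral_sub I2 (I1.const_mul _), MeasureTheory.integral_const_mul] at key
  simp only [h0, Complex.ofReal_zero, zero_mul, sub_zero] at key
  exact sub_eq_zero.mp key

theorem laplace_pow (j : ℕ) {w : ℂ} (hw : w.re = 1) :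
    ∫ y in Set.Ioi (0 : ℝ), ((y ^ j / (j.factorial : ℝ) : ℝ) : ℂ) * Complex.exp (-(w * y)) =
      (w ^ (j + 1))⁻¹ := by
  have hw0 : w ≠ 0 := by rintro rfl; simp at hw
  have hb : ∀ (j : ℕ) (y : ℝ), 0 ≤ y → |y ^ j / (j.factorial : ℝ)| ≤ y ^ j := fun j y hy => by
    rw [abs_of_nonneg (by positivity)]
    exact div_le_self (by positivity) (mod_cast j.factorial_pos)
  induction j with
  | zero =>
    have h2 := integral_exp_mul_complex_Ioi (a := -w) (by simp [hw]) 0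
    simp only [pow_zero, Nat.factorial_zero, Nat.cast_one, div_one, Complex.ofReal_one, one_mul,
      zero_add, pow_one]
    simp only [← neg_mul]
    rw [h2]
    simp [neg_div]
  | succ j ih =>
    have := laplace_of_hasDerivAt (h := fun y => y ^ (j + 1) / ((j + 1).factorial : ℝ))
      (g := fun y => y ^ j / (j.factorial : ℝ)) (c := 0)
      (k := j + 1) (l := j) (fun y => ((hasDerivAt_pow (j + 1) y).div_const _).congr_deriv (by
        rw [Nat.factorial_succ, Nat.add_sub_cancel]
        push_cast
        rw [mul_div_mul_left _ _ (by positivity)]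
        ring)) (by fun_prop) (by simp) (hb _) (hb _) hw
    rw [ih] at this
    rw [Complex.ofReal_zero, add_zero] at this
    rw [pow_succ w (j + 1), mul_inv, this]
    field_simp

theorem laplace_expConv (j : ℕ) {c : ℝ} (hc : 0 ≤ c) {w : ℂ} (hw : w.re = 1) :
    ∫ y in Set.Ioi (0 : ℝ), (expConv j c y : ℂ) * Complex.exp (-(w * y)) =
      (w ^ (j + 1))⁻¹ * (w + c)⁻¹ := by
  have hwc : w + c ≠ 0 := fun h => by
    have := congrArg Complex.re h
    simp [hw] at this
    linarith
  have := laplace_of_hasDerivAt (h := expConv j c) (k := j + 1) (l := j)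
    (hasDerivAt_expConv j c) (by fun_prop) (expConv_zero j c) (fun y hy => ?_) (fun y hy => ?_) hw
  · rw [laplace_pow j hw] at this
    rw [this]
    field_simp
  · rw [abs_of_nonneg (expConv_nonneg _ _ hy)]
    exact (expConv_le j hc hy).trans
      (div_le_self (by positivity) (mod_cast (j + 1).factorial_pos))
  · rw [abs_of_nonneg (by positivity)]
    exact div_le_self (by positivity) (mod_cast j.factorial_pos)

/-- The vertical line `Re w = 1`, parametrized by frequency. -/
noncomputable def wLine (ξ : ℝ) : ℂ := 1 + (2 * Real.pi * ξ : ℝ) * Complex.I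

theorem wLine_re (ξ : ℝ) : (wLine ξ).re = 1 := by simp [wLine]

theorem continuous_wLine : Continuous wLine := by unfold wLine; fun_prop

theorem wLine_ne_zero (ξ : ℝ) : wLine ξ ≠ 0 := fun h => by
  have := wLine_re ξ
  simp [h] at this

theorem norm_wLine_sq (ξ : ℝ) : ‖wLine ξ‖ ^ 2 = 1 + (2 * Real.pi * ξ) ^ 2 := by
  rw [← Complex.normSq_eq_norm_sq, Complex.normSq_apply]
  simp [wLine]
  ring

theorem one_le_norm_wLine (ξ : ℝ) : 1 ≤ ‖wLine ξ‖ := by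
  have := norm_wLine_sq ξ
  nlinarith [norm_nonneg (wLine ξ), sq_nonneg (2 * Real.pi * ξ)]

theorem integrable_inv_norm_wLine_sq :
    MeasureTheory.Integrable fun ξ : ℝ => (‖wLine ξ‖ ^ 2)⁻¹ := by
  simp only [norm_wLine_sq]
  exact integrable_inv_one_add_sq.comp_mul_left' (by positivity)

/-- Laplace inversion on the line `Re w = 1`. -/
theorem laplace_inversion {h : ℝ → ℝ} (hc : Continuous h) {k : ℕ}
    (hb : ∀ y, 0 ≤ y → |h y| ≤ y ^ k) {Φ : ℂ → ℂ}
    (hΦ : ∀ w : ℂ, w.re = 1 →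
      ∫ y in Set.Ioi (0 : ℝ), (h y : ℂ) * Complex.exp (-(w * y)) = Φ w)
    (hint : MeasureTheory.Integrable fun ξ => Φ (wLine ξ)) {u : ℝ} (hu : 0 < u) :
    ∫ ξ : ℝ, Complex.exp ((2 * Real.pi * ξ * u : ℝ) * Complex.I) * Φ (wLine ξ) =
      (h u * Real.exp (-u) : ℝ) := by
  -- Extended by zero to the left, h(y) e^{-y} has as Fourier transform the restriction of Φ to the
  -- line; u > 0 makes u a point of continuity.
  set f : ℝ → ℂ := (Set.Ioi (0 : ℝ)).indicator fun y => (h y : ℂ) * Complex.exp (-((1 : ℂ) * y))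
    with hf
  have hfi : MeasureTheory.Integrable f :=
    (MeasureTheory.integrable_indicator_iff measurableSet_Ioi).mpr
      (integrableOn_mul_exp_neg hc hb (by simp))
  have hF : FourierTransform.fourier f = fun ξ => Φ (wLine ξ) := by
    ext ξ
    rw [Real.fourier_real_eq_integral_exp_smul, ← hΦ _ (wLine_re ξ),
      ← MeasureTheory.integral_indicator measurableSet_Ioi]
    congr 1
    ext y
    simp only [hf, Set.indicator_apply]
    split_ifs
    · rw [smul_eq_mul, mul_left_comm, ← Complex.exp_add]
      congr 2
      simp only [wLine]
      push_cast
      ring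
    · simp
  have hcont : ContinuousAt f u := by
    have : (fun y : ℝ => (h y : ℂ) * Complex.exp (-((1 : ℂ) * y))) =ᶠ[nhds u] f := by
      filter_upwards [lt_mem_nhds hu] with y hy
      simp [hf, hy]
    exact ContinuousAt.congr (by fun_prop) this
  have key := hfi.fourierInv_fourier_eq (by rw [hF]; exact hint) hcont
  rw [hF, Real.fourierInv_eq'] at key
  rw [show f u = (h u * Real.exp (-u) : ℝ) by simp [hf, hu]] at key
  rw [← key]
  congr 1
  ext ξ
  rw [smul_eq_mul]
  congr 3
  push_cast
  simp
  ring

theorem integrable_inv_wLine_pow {n : ℕ} (hn : 2 ≤ n) {g : ℝ → ℂ} (hg : Continuous g)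
    (hb : ∀ ξ, ‖g ξ‖ ≤ 1) :
    MeasureTheory.Integrable fun ξ => ((wLine ξ) ^ n)⁻¹ * g ξ := by
  have hcw := continuous_wLine
  refine integrable_inv_norm_wLine_sq.mono' (Continuous.aestronglyMeasurable
    (((hcw.pow n).inv₀ fun ξ => pow_ne_zero _ (wLine_ne_zero ξ)).mul hg)) ?_
  filter_upwards with ξ
  rw [norm_mul, norm_inv, norm_pow]
  have h1 := one_le_norm_wLine ξ
  calc _ ≤ (‖wLine ξ‖ ^ n)⁻¹ * 1 := by gcongr; exact hb ξ
    _ ≤ _ := by rw [mul_one]; gcongr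

/-- The Poisson weight `e^{-u} u^j / j!`. -/
noncomputable def poissonWeight (j : ℕ) (u : ℝ) : ℝ := u ^ j / (j.factorial : ℝ) * Real.exp (-u)

theorem integral_inv_wLine_pow {j : ℕ} (hj : 1 ≤ j) {u : ℝ} (hu : 0 < u) :
    ∫ ξ : ℝ, Complex.exp ((2 * Real.pi * ξ * u : ℝ) * Complex.I) * ((wLine ξ) ^ (j + 1))⁻¹ =
      (poissonWeight j u : ℝ) := by
  refine laplace_inversion (h := fun u => u ^ j / (j.factorial : ℝ))
    (Φ := fun w => (w ^ (j + 1))⁻¹) (k := j) (by fun_prop)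
    (fun y hy => ?_) (fun w hw => laplace_pow j hw) ?_ hu
  · rw [abs_of_nonneg (by positivity)]
    exact div_le_self (by positivity) (mod_cast j.factorial_pos)
  · simpa using integrable_inv_wLine_pow (n := j + 1) (by omega) (g := fun _ => 1)
      continuous_const (by simp)

theorem norm_inv_wLine_add {c : ℝ} (hc : 0 ≤ c) (ξ : ℝ) : ‖(wLine ξ + c)⁻¹‖ ≤ 1 := by
  rw [norm_inv]
  refine inv_le_one_of_one_le₀ ((?_ : (1 : ℝ) ≤ (wLine ξ + c).re).trans (Complex.re_le_norm _))
  simp [wLine_re, hc]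

theorem wLine_add_ne_zero {c : ℝ} (hc : 0 ≤ c) (ξ : ℝ) : wLine ξ + c ≠ 0 := fun h => by
  have := congrArg Complex.re h
  simp [wLine_re] at this
  linarith

theorem integral_inv_wLine_pow_mul {j : ℕ} (hj : 1 ≤ j) {c : ℝ} (hc : 0 ≤ c) {u : ℝ} (hu : 0 < u) :
    ∫ ξ : ℝ, Complex.exp ((2 * Real.pi * ξ * u : ℝ) * Complex.I) *
      (((wLine ξ) ^ (j + 1))⁻¹ * (wLine ξ + c)⁻¹) = (expConv j c u * Real.exp (-u) : ℝ) := by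
  refine laplace_inversion (h := expConv j c)
    (Φ := fun w => (w ^ (j + 1))⁻¹ * (w + c)⁻¹) (k := j + 1) (continuous_expConv j c)
    (fun y hy => ?_) (fun w hw => laplace_expConv j hc hw) ?_ hu
  · rw [abs_of_nonneg (expConv_nonneg _ _ hy)]
    exact (expConv_le j hc hy).trans
      (div_le_self (by positivity) (mod_cast (j + 1).factorial_pos))
  · have hcw := continuous_wLine
    exact integrable_inv_wLine_pow (n := j + 1) (by omega) (g := fun ξ => (wLine ξ + c)⁻¹)
      ((hcw.add continuous_const).inv₀ (wLine_add_ne_zero hc)) (norm_inv_wLine_add hc)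

/-! ### Decay of integrals along the line -/

/-- With τ = 2πξ and b = n/(2(K+1)) ≥ 1, Bernoulli's inequality gives ‖w‖^n = ((1+τ²)^b)^{K+1} ≥
(1+bτ²)^{K+1}. Of these K+1 factors, K absorb |sτ|^K and the last one keeps the bound integrable. -/
theorem pow_mul_inv_norm_wLine_pow_le {K n : ℕ} (hn : 2 * (K + 1) ≤ n) (ξ : ℝ) {s : ℝ}
    (hs : s = √((n : ℝ) / (2 * (K + 1)))) :
    |2 * Real.pi * ξ| ^ K * (‖wLine ξ‖ ^ n)⁻¹ ≤ (s ^ K)⁻¹ * (1 + (s * (2 * Real.pi * ξ)) ^ 2)⁻¹ := by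
  set b : ℝ := (n : ℝ) / (2 * (K + 1)) with hb
  set τ := 2 * Real.pi * ξ with hτ
  have hK : (0 : ℝ) < 2 * (K + 1) := by positivity
  have hb1 : 1 ≤ b := by
    rw [hb, le_div_iff₀ hK, one_mul]
    exact_mod_cast hn
  have hs0 : 0 < s := by rw [hs]; exact Real.sqrt_pos.mpr (by linarith)
  have hsb : s ^ 2 = b := by rw [hs]; exact Real.sq_sqrt (by linarith)
  have h1 : (1 + b * τ ^ 2) ^ (K + 1) ≤ ‖wLine ξ‖ ^ n := by
    have h2 := one_add_mul_self_le_rpow_one_add (s := τ ^ 2) (by nlinarith [sq_nonneg τ]) hb1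
    calc (1 + b * τ ^ 2) ^ (K + 1) ≤ ((1 + τ ^ 2) ^ b) ^ (K + 1) := by gcongr
      _ = ‖wLine ξ‖ ^ n := by
        rw [hτ, ← norm_wLine_sq, ← Real.rpow_natCast, ← Real.rpow_natCast,
          ← Real.rpow_natCast, ← Real.rpow_mul (by positivity), ← Real.rpow_mul (norm_nonneg _)]
        congr 1
        rw [hb]
        push_cast
        field_simp
  have h3 : |s * τ| ≤ 1 + b * τ ^ 2 := by
    rw [← hsb, ← mul_pow]
    nlinarith [sq_abs (s * τ), sq_nonneg (|s * τ| - 1)]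
  have h4 : |s * τ| ^ K ≤ (1 + b * τ ^ 2) ^ K := pow_le_pow_left₀ (abs_nonneg _) h3 K
  have h5 : 0 < 1 + b * τ ^ 2 := by positivity
  rw [mul_pow, hsb, ← div_eq_mul_inv, ← mul_inv, ← one_div, div_le_div_iff₀
    (pow_pos (by linarith [one_le_norm_wLine ξ]) _) (by positivity), one_mul]
  calc |τ| ^ K * (s ^ K * (1 + b * τ ^ 2)) = |s * τ| ^ K * (1 + b * τ ^ 2) := by
        rw [abs_mul s, abs_of_pos hs0]; ring
    _ ≤ (1 + b * τ ^ 2) ^ K * (1 + b * τ ^ 2) := by gcongr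
    _ ≤ _ := by rw [← pow_succ]; exact h1

/-- Each power of ξ in the integrand and the integration itself gain a factor of order n^{-1/2},
hence the exponent K + 1. The remaining integral of the Cauchy kernel equals 1/(2s). -/
theorem norm_integral_le_of_wLine {K n : ℕ} (hn : 2 * (K + 1) ≤ n) {G : ℝ → ℂ} {A : ℝ}
    (hA : 0 ≤ A) (hG : ∀ ξ, ‖G ξ‖ ≤ A * (|2 * Real.pi * ξ| ^ K * (‖wLine ξ‖ ^ n)⁻¹)) :
    ‖∫ ξ, G ξ‖ ≤ A * √(2 * (K + 1) / (n : ℝ)) ^ (K + 1) := by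
  set s := √((n : ℝ) / (2 * (K + 1))) with hs
  have hn0 : (0 : ℝ) < n := by exact_mod_cast (by omega : 0 < n)
  have hs0 : 0 < s := Real.sqrt_pos.mpr (by positivity)
  have hss : √(2 * (K + 1) / (n : ℝ)) = s⁻¹ := by
    rw [hs, ← Real.sqrt_inv, inv_div]
  have hint : MeasureTheory.Integrable fun ξ : ℝ =>
      A * ((s ^ K)⁻¹ * (1 + (s * (2 * Real.pi * ξ)) ^ 2)⁻¹) := by
    simp only [← mul_assoc s]
    exact ((integrable_inv_one_add_sq.comp_mul_left' (by positivity)).const_mul _).const_mul _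
  refine (MeasureTheory.norm_integral_le_of_norm_le hint (Eventually.of_forall fun ξ =>
    (hG ξ).trans (mul_le_mul_of_nonneg_left (pow_mul_inv_norm_wLine_pow_le hn ξ hs) hA))).trans ?_
  rw [MeasureTheory.integral_const_mul, MeasureTheory.integral_const_mul]
  refine mul_le_mul_of_nonneg_left ?_ hA
  simp only [← mul_assoc s]
  rw [MeasureTheory.Measure.integral_comp_mul_left (fun x => (1 + x ^ 2)⁻¹),
    integral_univ_inv_one_add_sq, hss, smul_eq_mul,
    abs_of_pos (inv_pos.mpr (by positivity)), pow_succ, inv_pow]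
  refine mul_le_mul_of_nonneg_left ?_ (by positivity)
  have := Real.pi_pos
  rw [mul_inv, mul_inv, mul_assoc, inv_mul_cancel₀ this.ne', mul_one]
  exact mul_le_of_le_one_right (by positivity) (by norm_num)

/-! ### Taylor expansion of the theta terms -/

/-- The `l`-th Taylor coefficient at the origin. -/
noncomputable def taylorCoeff (φ : ℂ → ℂ) (l : ℕ) : ℂ := (l.factorial : ℂ)⁻¹ * iteratedDeriv l φ 0

theorem norm_taylorCoeff_le {φ : ℂ → ℂ} {M : ℝ}
    (hφ : DifferentiableOn ℂ φ (Metric.ball 0 1)) (hM : ∀ v : ℂ, ‖v‖ ≤ 1 / 2 → ‖φ v‖ ≤ M) (l : ℕ) : ‖taylorCoeff φ l‖ ≤ M * 2 ^ l := by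
  have hcl : DiffContOnCl ℂ φ (Metric.ball 0 (1 / 2)) := by
    refine DifferentiableOn.diffContOnCl (hφ.mono ?_)
    rw [closure_ball _ (by norm_num)]
    exact Metric.closedBall_subset_ball (by norm_num)
  have := Complex.norm_iteratedDeriv_le_of_forall_mem_sphere_norm_le l (by norm_num) hcl
    (C := M) (fun z hz => hM z (by rw [mem_sphere_zero_iff_norm] at hz; exact hz.le))
  rw [taylorCoeff, norm_mul, norm_inv, RCLike.norm_natCast, inv_mul_le_iff₀
    (mod_cast l.factorial_pos)]
  refine this.trans (le_of_eq ?_)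
  rw [one_div, inv_pow, div_inv_eq_mul, mul_assoc]

theorem hasSum_taylorCoeff {φ : ℂ → ℂ}
    (hφ : DifferentiableOn ℂ φ (Metric.ball 0 1)) {v : ℂ} (hv : ‖v‖ ≤ 1 / 2) :
    HasSum (fun l => taylorCoeff φ l * v ^ l) (φ v) := by
  have := Complex.hasSum_taylorSeries_on_ball hφ (z := v) (by
    rw [mem_ball_zero_iff]; linarith)
  refine this.congr_fun fun l => ?_
  simp only [taylorCoeff, sub_zero, smul_eq_mul]
  ring

/-- Cauchy's estimate on the circle of radius 1/2 bounds the tail by a geometric series of ratio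
2‖v‖ ≤ 1/2. -/
theorem norm_sub_taylor_le {φ : ℂ → ℂ} {M : ℝ}
    (hφ : DifferentiableOn ℂ φ (Metric.ball 0 1)) (hM : ∀ v : ℂ, ‖v‖ ≤ 1 / 2 → ‖φ v‖ ≤ M) (K : ℕ) {v : ℂ} (hv : ‖v‖ ≤ 1 / 4) :
    ‖φ v - ∑ l ∈ Finset.range K, taylorCoeff φ l * v ^ l‖ ≤ M * 2 ^ (K + 1) * ‖v‖ ^ K := by
  have hM0 : 0 ≤ M := (norm_nonneg _).trans (hM 0 (by simp))
  have h1 := (hasSum_nat_add_iff' K).mpr (hasSum_taylorCoeff hφ (v := v) (by linarith))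
  have h2 : ∀ l, ‖taylorCoeff φ (l + K) * v ^ (l + K)‖ ≤ M * (2 * ‖v‖) ^ K * (1 / 2) ^ l := by
    intro l
    rw [norm_mul, norm_pow]
    calc _ ≤ M * 2 ^ (l + K) * ‖v‖ ^ (l + K) := by
          gcongr
          exact norm_taylorCoeff_le hφ hM _
      _ = M * (2 * ‖v‖) ^ K * (2 * ‖v‖) ^ l := by ring
      _ ≤ _ := by gcongr; linarith
  have h3 := (hasSum_geometric_of_lt_one (by norm_num : (0 : ℝ) ≤ 1 / 2) (by norm_num)).mul_left
    (M * (2 * ‖v‖) ^ K)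
  rw [← h1.tsum_eq]
  refine (tsum_of_norm_bounded h3 h2).trans (le_of_eq ?_)
  ring

/-- The normalized term `(1 + v)^{i+1} / (1 + c (1 + v))` of the theta series. -/
noncomputable def thetaTerm (c : ℝ) (i : ℤ) (v : ℂ) : ℂ := (1 + v) ^ (i + 1) / (1 + c * (1 + v))

theorem one_le_norm_one_add_mul {c : ℝ} (hc : 0 ≤ c) {z : ℂ} (hz : 0 ≤ z.re) :
    1 ≤ ‖1 + c * z‖ := by
  refine (?_ : (1 : ℝ) ≤ (1 + c * z).re).trans (Complex.re_le_norm _)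
  simp
  positivity

theorem re_one_add_nonneg {v : ℂ} (hv : ‖v‖ ≤ 1) : 0 ≤ (1 + v).re := by
  have := (abs_le.mp (Complex.abs_re_le_norm v)).1
  simp
  linarith

theorem differentiableOn_thetaTerm {c : ℝ} (hc : 0 ≤ c) (i : ℤ) :
    DifferentiableOn ℂ (thetaTerm c i) (Metric.ball 0 1) := by
  intro v hv
  rw [mem_ball_zero_iff] at hv
  have h1 : (1 + v) ≠ 0 := fun h => by
    have : v = -1 := by linear_combination h
    simp [this] at hv
  have h2 : 1 + c * (1 + v) ≠ 0 := norm_pos_iff.mp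
    (lt_of_lt_of_le one_pos (one_le_norm_one_add_mul hc (re_one_add_nonneg hv.le)))
  refine DifferentiableAt.differentiableWithinAt ?_
  exact ((differentiableAt_zpow.mpr (Or.inl h1)).comp v (by fun_prop)).div (by fun_prop) h2

/-- The denominator has real part at least 1, and 1/2 ≤ ‖1 + v‖ ≤ 2. The bound does not depend on c,
which matters since c = q^i Q runs through all scales. -/
theorem norm_thetaTerm_le {c : ℝ} (hc : 0 ≤ c) (i : ℤ) {v : ℂ} (hv : ‖v‖ ≤ 1 / 2) :
    ‖thetaTerm c i v‖ ≤ 2 ^ (i.natAbs + 1) := by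
  have h1 := one_le_norm_one_add_mul hc (re_one_add_nonneg (v := v) (by linarith))
  have hlo : 1 / 2 ≤ ‖1 + v‖ := by
    have := norm_sub_norm_le (1 : ℂ) (-v)
    rw [norm_neg, norm_one, sub_neg_eq_add] at this
    linarith
  have hhi : ‖1 + v‖ ≤ 2 := by
    have := norm_add_le (1 : ℂ) v
    rw [norm_one] at this
    linarith
  rw [thetaTerm, norm_div, norm_zpow]
  refine (div_le_self (by positivity) h1).trans ?_
  rcases le_total 0 (i + 1) with h | h
  · lift i + 1 to ℕ using h with m hm
    rw [zpow_natCast]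
    calc ‖1 + v‖ ^ m ≤ 2 ^ m := by gcongr
      _ ≤ _ := pow_le_pow_right₀ (by norm_num) (by omega)
  · obtain ⟨m, hm⟩ := Int.eq_ofNat_of_zero_le (neg_nonneg.mpr h)
    rw [show i + 1 = -(m : ℤ) by omega, zpow_neg, zpow_natCast, ← inv_pow]
    have : ‖1 + v‖⁻¹ ≤ 2 := inv_le_of_inv_le₀ (by norm_num) (by linarith)
    calc ‖1 + v‖⁻¹ ^ m ≤ 2 ^ m := by gcongr
      _ ≤ _ := pow_le_pow_right₀ (by norm_num) (by omega)

theorem norm_inv_wLine_sub_one_le (ξ : ℝ) :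
    ‖(wLine ξ)⁻¹ - 1‖ ≤ |2 * Real.pi * ξ| ∧ ‖(wLine ξ)⁻¹ - 1‖ ≤ 1 := by
  have h0 := wLine_ne_zero ξ
  have h1 := one_le_norm_wLine ξ
  have e : (wLine ξ)⁻¹ - 1 = -((2 * Real.pi * ξ : ℝ) * Complex.I) * (wLine ξ)⁻¹ := by
    field_simp
    rw [wLine]
    ring
  have e2 : ‖(wLine ξ)⁻¹ - 1‖ = |2 * Real.pi * ξ| * ‖wLine ξ‖⁻¹ := by
    rw [e, norm_mul, norm_neg, norm_mul, Complex.norm_real, Complex.norm_I, mul_one, norm_inv,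
      Real.norm_eq_abs]
  rw [e2]
  constructor
  · exact mul_le_of_le_one_right (abs_nonneg _) (inv_le_one_of_one_le₀ h1)
  · rw [← div_eq_mul_inv, div_le_one (by linarith)]
    refine abs_le_of_sq_le_sq ?_ (by linarith)
    rw [norm_wLine_sq]
    linarith

/-- The Taylor bound is needed on the whole line, not only near v = 0. For ‖v‖ > 1/4 one has 1 ≤
(4‖v‖)^K, so crude bounds on the term and on the polynomial suffice, at the price of ‖w‖^|i|. That
factor is later paid for by w^{-N-1}. -/
theorem norm_thetaTerm_wLine_sub_le {c : ℝ} (hc : 0 ≤ c) (i : ℤ) (K : ℕ) (ξ : ℝ) :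
    ‖thetaTerm c i ((wLine ξ)⁻¹ - 1) - ∑ l ∈ Finset.range K,
        taylorCoeff (thetaTerm c i) l * ((wLine ξ)⁻¹ - 1) ^ l‖ ≤
      2 ^ (i.natAbs + 1) * 8 ^ (K + 1) * (‖wLine ξ‖ ^ i.natAbs * |2 * Real.pi * ξ| ^ K) := by
  set v := (wLine ξ)⁻¹ - 1 with hv
  set M : ℝ := 2 ^ (i.natAbs + 1) with hM
  obtain ⟨hv1, hv2⟩ := norm_inv_wLine_sub_one_le ξ
  rw [← hv] at hv1 hv2
  have hw := one_le_norm_wLine ξ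
  have hM1 : 1 ≤ M := one_le_pow₀ (by norm_num)
  have hwi : 1 ≤ ‖wLine ξ‖ ^ i.natAbs := one_le_pow₀ hw
  have hd := differentiableOn_thetaTerm hc i
  have hb : ∀ v : ℂ, ‖v‖ ≤ 1 / 2 → ‖thetaTerm c i v‖ ≤ M := fun v => norm_thetaTerm_le hc i
  suffices h : ‖thetaTerm c i v - ∑ l ∈ Finset.range K, taylorCoeff (thetaTerm c i) l * v ^ l‖ ≤
      M * 8 ^ (K + 1) * (‖wLine ξ‖ ^ i.natAbs * ‖v‖ ^ K) from
    h.trans (by gcongr)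
  rcases le_or_gt ‖v‖ (1 / 4) with h | h
  · refine (norm_sub_taylor_le hd hb K h).trans ?_
    rw [mul_assoc, mul_assoc]
    refine mul_le_mul_of_nonneg_left ?_ (by positivity)
    have : (2 : ℝ) ^ (K + 1) ≤ 8 ^ (K + 1) := by gcongr; norm_num
    refine mul_le_mul this ?_ (by positivity) (by positivity)
    exact le_mul_of_one_le_left (by positivity) hwi
  · have h1 : ‖thetaTerm c i v‖ ≤ ‖wLine ξ‖ ^ i.natAbs := by
      have h2 := one_le_norm_one_add_mul hc (re_one_add_nonneg hv2)
      rw [thetaTerm, norm_div, norm_zpow]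
      refine (div_le_self (by positivity) h2).trans ?_
      rw [hv, add_sub_cancel, norm_inv]
      rcases le_total 0 (i + 1) with h | h
      · lift i + 1 to ℕ using h with m hm
        rw [zpow_natCast]
        exact (pow_le_one₀ (by positivity) (inv_le_one_of_one_le₀ hw)).trans hwi
      · obtain ⟨m, hm⟩ := Int.eq_ofNat_of_zero_le (neg_nonneg.mpr h)
        rw [show i + 1 = -(m : ℤ) by omega, zpow_neg, zpow_natCast, ← inv_pow, inv_inv]
        exact pow_le_pow_right₀ hw (by omega)
    have h2 : ‖∑ l ∈ Finset.range K, taylorCoeff (thetaTerm c i) l * v ^ l‖ ≤ M * 2 ^ K := by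
      refine (norm_sum_le _ _).trans ?_
      calc _ ≤ ∑ l ∈ Finset.range K, M * 2 ^ l := by
            refine Finset.sum_le_sum fun l _ => ?_
            rw [norm_mul, norm_pow]
            exact (mul_le_of_le_one_right (norm_nonneg _) (pow_le_one₀ (norm_nonneg _) hv2)).trans
              (norm_taylorCoeff_le hd hb l)
        _ = M * (2 ^ K - 1) := by
            rw [← Finset.mul_sum, geom_sum_eq (by norm_num)]
            norm_num
        _ ≤ _ := by gcongr; linarith
    have h3 : (1 : ℝ) ≤ 4 ^ K * ‖v‖ ^ K := by
      rw [← mul_pow]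
      exact one_le_pow₀ (by linarith)
    calc _ ≤ ‖wLine ξ‖ ^ i.natAbs + M * 2 ^ K := (norm_sub_le _ _).trans (add_le_add h1 h2)
      _ ≤ M * 2 ^ K * ‖wLine ξ‖ ^ i.natAbs + M * 2 ^ K * ‖wLine ξ‖ ^ i.natAbs := by
          have : 1 ≤ M * 2 ^ K := one_le_mul_of_one_le_of_one_le hM1 (one_le_pow₀ (by norm_num))
          refine add_le_add (le_mul_of_one_le_left (by positivity) this)
            (le_mul_of_one_le_right (by positivity) hwi)
      _ = M * 2 ^ (K + 1) * ‖wLine ξ‖ ^ i.natAbs * 1 := by ring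
      _ ≤ M * 2 ^ (K + 1) * ‖wLine ξ‖ ^ i.natAbs * (4 ^ K * ‖v‖ ^ K) := by gcongr
      _ = M * (2 * 8 ^ K) * (‖wLine ξ‖ ^ i.natAbs * ‖v‖ ^ K) := by
          rw [show (8 : ℝ) = 2 * 4 by norm_num, mul_pow]; ring
      _ ≤ _ := by gcongr; rw [pow_succ]; nlinarith [pow_pos (by norm_num : (0 : ℝ) < 8) K]

/-! ### Poisson differences and the approximation of a single term -/

/-- The `l`-th forward difference in the index of the Poisson weights. -/
noncomputable def poissonDiff (l N : ℕ) (u : ℝ) : ℝ :=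
  ∑ m ∈ Finset.range (l + 1), ((-1) ^ (l - m) * (l.choose m : ℝ)) * poissonWeight (N + m) u

theorem poissonWeight_nonneg (j : ℕ) {u : ℝ} (hu : 0 ≤ u) : 0 ≤ poissonWeight j u := by
  unfold poissonWeight; positivity

theorem poissonWeight_le_one (j : ℕ) {u : ℝ} (hu : 0 ≤ u) : poissonWeight j u ≤ 1 := by
  rw [poissonWeight, Real.exp_neg, ← div_eq_mul_inv, div_le_one (Real.exp_pos _)]
  exact Real.pow_div_factorial_le_exp u hu j

theorem abs_poissonDiff_le (l N : ℕ) {u : ℝ} (hu : 0 ≤ u) : |poissonDiff l N u| ≤ 2 ^ l := by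
  refine (Finset.abs_sum_le_sum_abs _ _).trans ?_
  calc _ ≤ ∑ m ∈ Finset.range (l + 1), (l.choose m : ℝ) := by
        refine Finset.sum_le_sum fun m _ => ?_
        rw [abs_mul, abs_mul, abs_pow, abs_neg, abs_one, one_pow, one_mul, Nat.abs_cast,
          abs_of_nonneg (poissonWeight_nonneg _ hu)]
        exact mul_le_of_le_one_right (by positivity) (poissonWeight_le_one _ hu)
    _ = 2 ^ l := by exact_mod_cast Nat.sum_range_choose l

/-- The oscillating factor of the inversion integral. -/
noncomputable def osc (u ξ : ℝ) : ℂ := Complex.exp ((2 * Real.pi * ξ * u : ℝ) * Complex.I)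

theorem norm_osc (u ξ : ℝ) : ‖osc u ξ‖ = 1 := Complex.norm_exp_ofReal_mul_I _

theorem continuous_osc (u : ℝ) : Continuous (osc u) := by unfold osc; fun_prop

theorem integrable_osc_mul {n : ℕ} (hn : 2 ≤ n) (u : ℝ) :
    MeasureTheory.Integrable fun ξ => osc u ξ * ((wLine ξ) ^ n)⁻¹ := by
  simpa only [mul_comm] using integrable_inv_wLine_pow hn (continuous_osc u)
    (fun ξ => (norm_osc u ξ).le)

theorem integrable_osc_mul_diff (l : ℕ) {N : ℕ} (hN : 1 ≤ N) (u : ℝ) :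
    MeasureTheory.Integrable fun ξ =>
      osc u ξ * (((wLine ξ) ^ (N + 1))⁻¹ * ((wLine ξ)⁻¹ - 1) ^ l) := by
  have := integrable_inv_wLine_pow (n := N + 1) (by omega)
    (g := fun ξ => osc u ξ * ((wLine ξ)⁻¹ - 1) ^ l)
    ((continuous_osc u).mul (((continuous_wLine.inv₀ wLine_ne_zero).sub continuous_const).pow l))
    (fun ξ => by
      rw [norm_mul, norm_osc, one_mul, norm_pow]
      exact pow_le_one₀ (norm_nonneg _) (norm_inv_wLine_sub_one_le ξ).2)
  simpa only [mul_left_comm] using this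

/-- Multiplication by 1/w raises the index of the inverted Poisson weight by one, so (1/w - 1)^l
acts as the l-th forward difference. -/
theorem poissonDiff_eq_integral (l : ℕ) {N : ℕ} (hN : 1 ≤ N) {u : ℝ} (hu : 0 < u) :
    (poissonDiff l N u : ℂ) =
      ∫ ξ : ℝ, osc u ξ * (((wLine ξ) ^ (N + 1))⁻¹ * ((wLine ξ)⁻¹ - 1) ^ l) := by
  have h : ∀ ξ, osc u ξ * (((wLine ξ) ^ (N + 1))⁻¹ * ((wLine ξ)⁻¹ - 1) ^ l) =
      ∑ m ∈ Finset.range (l + 1), (((-1) ^ (l - m) * (l.choose m : ℝ) : ℝ) : ℂ) *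
        (osc u ξ * ((wLine ξ) ^ (N + m + 1))⁻¹) := fun ξ => by
    rw [sub_eq_add_neg, add_pow, Finset.mul_sum, Finset.mul_sum]
    refine Finset.sum_congr rfl fun m _ => ?_
    have := wLine_ne_zero ξ
    rw [show N + m + 1 = N + 1 + m by ring, pow_add _ (N + 1), mul_inv, inv_pow]
    push_cast
    ring
  simp only [h]
  rw [MeasureTheory.integral_finsetSum _ fun m _ => (integrable_osc_mul (by omega) u).const_mul _,
    poissonDiff]
  push_cast
  refine Finset.sum_congr rfl fun m _ => ?_
  rw [MeasureTheory.integral_const_mul, ← integral_inv_wLine_pow (by omega) hu]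
  rfl

/-- Since ‖1/w - 1‖ ≤ |2πξ|, every difference gains N^{-1/2}. This size estimate later forces the
coefficients with 2j < l to vanish. -/
theorem abs_poissonDiff_le_sqrt (l : ℕ) {N : ℕ} (hN : 2 * (l + 1) ≤ N) {u : ℝ} (hu : 0 < u) :
    |poissonDiff l N u| ≤ √(2 * (l + 1) / (N : ℝ)) ^ (l + 1) := by
  have h1 := norm_integral_le_of_wLine (K := l) hN (A := 1) zero_le_one (G := fun ξ =>
    osc u ξ * (((wLine ξ) ^ (N + 1))⁻¹ * ((wLine ξ)⁻¹ - 1) ^ l)) (fun ξ => by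
      rw [norm_mul, norm_osc, norm_mul, norm_inv, norm_pow, norm_pow, one_mul, one_mul, mul_comm]
      have := one_le_norm_wLine ξ
      gcongr
      · exact (norm_inv_wLine_sub_one_le ξ).1
      · omega)
  rw [← poissonDiff_eq_integral l (by omega) hu, Complex.norm_real, Real.norm_eq_abs,
    one_mul] at h1
  exact h1

theorem inv_wLine_pow_mul_eq_thetaTerm {c : ℝ} (hc : 0 ≤ c) {N j : ℕ} {i : ℤ}
    (hj : (j : ℤ) = N + i) (ξ : ℝ) :
    ((wLine ξ) ^ (j + 1))⁻¹ * (wLine ξ + c)⁻¹ =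
      ((wLine ξ) ^ (N + 1))⁻¹ * thetaTerm c i ((wLine ξ)⁻¹ - 1) := by
  have hw := wLine_ne_zero ξ
  have hwc := wLine_add_ne_zero hc ξ
  rw [thetaTerm, add_sub_cancel, show 1 + (c : ℂ) * (wLine ξ)⁻¹ = (wLine ξ + c) * (wLine ξ)⁻¹ by
    field_simp, inv_zpow, ← zpow_neg]
  have e : ((wLine ξ) ^ (j + 1))⁻¹ = ((wLine ξ) ^ (N + 1))⁻¹ * ((wLine ξ) ^ (-(i + 1)) * wLine ξ) := by
    rw [← zpow_natCast, ← zpow_natCast, ← zpow_neg, ← zpow_neg, ← zpow_add_one₀ hw,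
      ← zpow_add₀ hw]
    congr 1
    push_cast
    omega
  rw [e]
  field_simp

/-- The real part of the `l`-th Taylor coefficient of `thetaTerm`. -/
noncomputable def thetaCoeff (c : ℝ) (i : ℤ) (l : ℕ) : ℝ := (taylorCoeff (thetaTerm c i) l).re

theorem abs_thetaCoeff_le {c : ℝ} (hc : 0 ≤ c) (i : ℤ) (l : ℕ) :
    |thetaCoeff c i l| ≤ 2 ^ (i.natAbs + 1) * 2 ^ l :=
  (Complex.abs_re_le_norm _).trans
    (norm_taylorCoeff_le (differentiableOn_thetaTerm hc i) (fun _ => norm_thetaTerm_le hc i) l)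

theorem abs_expConv_sub_le {c : ℝ} (hc : 0 ≤ c) {N j : ℕ} {i : ℤ} (hj : (j : ℤ) = N + i) (K : ℕ)
    (hN : 4 * (K + 1) ≤ N) (hi : 2 * i.natAbs ≤ N) {u : ℝ} (hu : 0 < u) :
    |expConv j c u * Real.exp (-u) - ∑ l ∈ Finset.range K, thetaCoeff c i l * poissonDiff l N u| ≤
      2 ^ (i.natAbs + 1) * 8 ^ (K + 1) * √(4 * (K + 1) / (N : ℝ)) ^ (K + 1) := by
  have hN1 : 1 ≤ N := by omega
  set T : ℝ → ℂ := fun ξ => osc u ξ * (((wLine ξ) ^ (N + 1))⁻¹ * thetaTerm c i ((wLine ξ)⁻¹ - 1) -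
    ∑ l ∈ Finset.range K, taylorCoeff (thetaTerm c i) l *
      (((wLine ξ) ^ (N + 1))⁻¹ * ((wLine ξ)⁻¹ - 1) ^ l)) with hT
  have hI : ∫ ξ, T ξ = (expConv j c u * Real.exp (-u) : ℝ) -
      ∑ l ∈ Finset.range K, taylorCoeff (thetaTerm c i) l * (poissonDiff l N u : ℂ) := by
    have e1 := integral_inv_wLine_pow_mul (j := j) (by omega) hc hu
    have i1 : MeasureTheory.Integrable fun ξ : ℝ =>
        osc u ξ * (((wLine ξ) ^ (j + 1))⁻¹ * (wLine ξ + c)⁻¹) := by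
      have := integrable_inv_wLine_pow (n := j + 1) (by omega)
        (g := fun ξ => osc u ξ * (wLine ξ + c)⁻¹)
        ((continuous_osc u).mul ((continuous_wLine.add continuous_const).inv₀
          (wLine_add_ne_zero hc)))
        (fun ξ => by
          rw [norm_mul, norm_osc, one_mul]
          exact norm_inv_wLine_add hc ξ)
      simpa only [mul_left_comm] using this
    rw [← e1]
    simp only [poissonDiff_eq_integral _ hN1 hu]
    simp only [← MeasureTheory.integral_const_mul]
    rw [← MeasureTheory.integral_finsetSum _ fun l _ =>
      (integrable_osc_mul_diff l hN1 u).const_mul _]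
    change _ = (∫ ξ : ℝ, osc u ξ * _) - _
    rw [← MeasureTheory.integral_sub i1 (MeasureTheory.integrable_finsetSum _ fun l _ =>
      (integrable_osc_mul_diff l hN1 u).const_mul _)]
    congr 1
    ext ξ
    rw [hT]
    simp only
    rw [inv_wLine_pow_mul_eq_thetaTerm hc hj, mul_sub, Finset.mul_sum]
    congr 1
    exact Finset.sum_congr rfl fun l _ => by ring
  -- Taking real parts makes it unnecessary to know that the Taylor coefficients are real.
  have hre : expConv j c u * Real.exp (-u) -
      ∑ l ∈ Finset.range K, thetaCoeff c i l * poissonDiff l N u = (∫ ξ, T ξ).re := by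
    rw [hI]
    simp only [Complex.sub_re, Complex.ofReal_re, Complex.re_sum, Complex.re_mul_ofReal]
    rfl
  rw [hre]
  refine (Complex.abs_re_le_norm _).trans ?_
  -- The factor ‖w‖^|i| of the remainder bound is taken out of ‖w‖^(N+1); as 2|i| ≤ N, more than
  -- half of the exponent remains, whence the 4 in place of 2 under the root.
  set n := N + 1 - i.natAbs with hn
  have hb := norm_integral_le_of_wLine (K := K) (n := n) (by omega) (G := T)
    (A := 2 ^ (i.natAbs + 1) * 8 ^ (K + 1)) (by positivity) (fun ξ => ?_)
  · refine hb.trans (mul_le_mul_of_nonneg_left (pow_le_pow_left₀ (Real.sqrt_nonneg _)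
      (Real.sqrt_le_sqrt ?_) _) (by positivity))
    have h2 : (N : ℝ) ≤ 2 * n := by exact_mod_cast (by omega : N ≤ 2 * n)
    have hN0 : (0 : ℝ) < N := by exact_mod_cast (by omega : 0 < N)
    rw [div_le_div_iff₀ (by linarith) hN0]
    have : (0 : ℝ) ≤ K + 1 := by positivity
    nlinarith
  · have h1 := norm_thetaTerm_wLine_sub_le hc i K ξ
    have hw := one_le_norm_wLine ξ
    have e : T ξ = osc u ξ * (((wLine ξ) ^ (N + 1))⁻¹ * (thetaTerm c i ((wLine ξ)⁻¹ - 1) -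
        ∑ l ∈ Finset.range K, taylorCoeff (thetaTerm c i) l * ((wLine ξ)⁻¹ - 1) ^ l)) := by
      rw [hT]
      simp only
      rw [mul_sub ((wLine ξ ^ (N + 1))⁻¹), Finset.mul_sum]
      congr 2
      exact Finset.sum_congr rfl fun l _ => by ring
    rw [e, norm_mul, norm_osc, one_mul, norm_mul, norm_inv, norm_pow]
    have e2 : ‖wLine ξ‖ ^ (N + 1) = ‖wLine ξ‖ ^ n * ‖wLine ξ‖ ^ i.natAbs := by
      rw [← pow_add]; congr 1; omega
    calc _ ≤ (‖wLine ξ‖ ^ (N + 1))⁻¹ * (2 ^ (i.natAbs + 1) * 8 ^ (K + 1) *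
          (‖wLine ξ‖ ^ i.natAbs * |2 * Real.pi * ξ| ^ K)) := by gcongr
      _ = _ := by
        rw [e2]
        have : ‖wLine ξ‖ ^ i.natAbs ≠ 0 := by positivity
        field_simp

/-- The normalized term of index `N + i`, extended by zero. -/
noncomputable def shiftedTerm (N : ℕ) (i : ℤ) (c u : ℝ) : ℝ :=
  if 0 ≤ N + i then expConv (N + i).toNat c u * Real.exp (-u) else 0

theorem abs_shiftedTerm_le_one (N : ℕ) (i : ℤ) {c u : ℝ} (hc : 0 ≤ c) (hu : 0 ≤ u) :
    |shiftedTerm N i c u| ≤ 1 := by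
  unfold shiftedTerm
  split_ifs with h
  · rw [abs_of_nonneg (mul_nonneg (expConv_nonneg _ _ hu) (Real.exp_nonneg _))]
    exact (mul_le_mul_of_nonneg_right (expConv_le _ hc hu) (Real.exp_nonneg _)).trans
      (poissonWeight_le_one _ hu)
  · simp

theorem exists_pow_le_two_pow (k : ℕ) : ∃ C : ℝ, 0 ≤ C ∧ ∀ n : ℕ, (n : ℝ) ^ k ≤ C * 2 ^ n := by
  obtain ⟨C, hC⟩ := (tendsto_pow_const_div_const_pow_of_one_lt k
    (by norm_num : (1 : ℝ) < 2)).bddAbove_range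
  refine ⟨C, ?_, fun n => ?_⟩
  · exact (by positivity : (0 : ℝ) ≤ ((0 : ℕ) : ℝ) ^ k / 2 ^ 0).trans (hC ⟨0, rfl⟩)
  · exact (div_le_iff₀ (by positivity)).mp (hC ⟨n, rfl⟩)

/-- For 2|i| ≤ N this is the inversion estimate. For larger |i| both quantities are trivially
O(2^|i|), and the powers of N^{-1/2} come from |i| itself, as 1 ≤ 2|i| N^{-1/2}. The growth 4^|i| is
harmless against the Gaussian weights. -/
theorem exists_abs_shiftedTerm_sub_le (K : ℕ) : ∃ C : ℝ, 0 ≤ C ∧ ∀ (N : ℕ) (i : ℤ) (c u : ℝ),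
    4 * (K + 1) ≤ N → 0 ≤ c → 0 < u →
    |shiftedTerm N i c u - ∑ l ∈ Finset.range K, thetaCoeff c i l * poissonDiff l N u| ≤
      C * 4 ^ i.natAbs * √((N : ℝ)⁻¹) ^ (K + 1) := by
  obtain ⟨C₀, hC₀, hpow⟩ := exists_pow_le_two_pow (K + 1)
  set C₁ : ℝ := 2 * 8 ^ (K + 1) * √(4 * (K + 1)) ^ (K + 1) with hC₁
  set C₂ : ℝ := 4 * 4 ^ K * (2 ^ (K + 1) * C₀) with hC₂
  refine ⟨C₁ + C₂, by positivity, fun N i c u hN hc hu => ?_⟩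
  have hN0 : (0 : ℝ) < N := by exact_mod_cast (by omega : 0 < N)
  set ε := √((N : ℝ)⁻¹) with hε
  have hε0 : 0 ≤ ε := Real.sqrt_nonneg _
  rcases le_or_gt (2 * i.natAbs) N with hi | hi
  · have hnn : 0 ≤ (N : ℤ) + i := by omega
    rw [shiftedTerm, if_pos hnn]
    refine (abs_expConv_sub_le hc (Int.toNat_of_nonneg hnn) K hN hi hu).trans ?_
    have e : √(4 * (K + 1) / (N : ℝ)) = √(4 * (K + 1)) * ε := by
      rw [div_eq_mul_inv, Real.sqrt_mul (by positivity)]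
    rw [e, mul_pow]
    calc _ = C₁ * 2 ^ i.natAbs * ε ^ (K + 1) := by rw [hC₁]; ring
      _ ≤ _ := by
        gcongr
        · exact le_add_of_nonneg_right (by positivity)
        · norm_num
  · have h1 : |∑ l ∈ Finset.range K, thetaCoeff c i l * poissonDiff l N u| ≤
        2 ^ (i.natAbs + 1) * (4 ^ K - 1) := by
      refine (Finset.abs_sum_le_sum_abs _ _).trans ?_
      calc _ ≤ ∑ l ∈ Finset.range K, 2 ^ (i.natAbs + 1) * (4 : ℝ) ^ l := by
            refine Finset.sum_le_sum fun l _ => ?_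
            rw [abs_mul]
            calc _ ≤ 2 ^ (i.natAbs + 1) * 2 ^ l * (2 : ℝ) ^ l :=
                  mul_le_mul (abs_thetaCoeff_le hc i l) (abs_poissonDiff_le l N hu.le)
                    (abs_nonneg _) (by positivity)
              _ = _ := by rw [mul_assoc, ← mul_pow]; norm_num
        _ = 2 ^ (i.natAbs + 1) * ((4 ^ K - 1) / 3) := by
            rw [← Finset.mul_sum, geom_sum_eq (by norm_num)]
            norm_num
        _ ≤ _ := by
            have : (1 : ℝ) ≤ 4 ^ K := one_le_pow₀ (by norm_num)
            gcongr
            linarith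
    have h2 := abs_shiftedTerm_le_one N i hc hu.le
    have h3 : (1 : ℝ) ≤ 2 ^ (K + 1) * (C₀ * 2 ^ i.natAbs) * ε ^ (K + 1) := by
      have hεN : ε ^ 2 * N = 1 := by
        rw [hε, Real.sq_sqrt (by positivity), inv_mul_cancel₀ hN0.ne']
      have hε1 : ε ≤ 1 := by
        have : (1 : ℝ) ≤ N := by exact_mod_cast (by omega : 1 ≤ N)
        nlinarith
      have h4 : 1 ≤ ε * (2 * (i.natAbs : ℝ)) := by
        have : (N : ℝ) ≤ 2 * (i.natAbs : ℝ) := by exact_mod_cast hi.le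
        calc (1 : ℝ) = ε ^ 2 * N := hεN.symm
          _ = ε * (ε * N) := by ring
          _ ≤ ε * (1 * (2 * (i.natAbs : ℝ))) := by gcongr
          _ = _ := by ring
      calc (1 : ℝ) ≤ (ε * (2 * (i.natAbs : ℝ))) ^ (K + 1) := one_le_pow₀ h4
        _ = 2 ^ (K + 1) * ((i.natAbs : ℝ) ^ (K + 1)) * ε ^ (K + 1) := by ring
        _ ≤ _ := by gcongr; exact hpow _
    have h5 : (1 : ℝ) ≤ 2 ^ (i.natAbs + 1) := one_le_pow₀ (by norm_num)
    calc _ ≤ 1 + 2 ^ (i.natAbs + 1) * (4 ^ K - 1) := (abs_sub _ _).trans (add_le_add h2 h1)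
      _ ≤ 4 * 4 ^ K * 2 ^ i.natAbs * 1 := by
          have : (0 : ℝ) < 4 ^ K := by positivity
          rw [pow_succ] at h5 ⊢
          nlinarith [pow_pos (by norm_num : (0 : ℝ) < 2) i.natAbs]
      _ ≤ 4 * 4 ^ K * 2 ^ i.natAbs * (2 ^ (K + 1) * (C₀ * 2 ^ i.natAbs) * ε ^ (K + 1)) := by gcongr
      _ = C₂ * 4 ^ i.natAbs * ε ^ (K + 1) := by
          rw [hC₂, show (4 : ℝ) ^ i.natAbs = 2 ^ i.natAbs * 2 ^ i.natAbs by
            rw [← mul_pow]; norm_num]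
          ring
      _ ≤ _ := by
          gcongr
          exact le_add_of_nonneg_left (by positivity)

/-! ### The theta series F and its derivatives -/

theorem triangle_succ (i : ℤ) : (i + 1) * (i + 1 + 1) / 2 = i * (i + 1) / 2 + (i + 1) := by
  rw [show (i + 1) * (i + 1 + 1) = i * (i + 1) + 2 * (i + 1) by ring,
    Int.add_mul_ediv_left _ _ (by norm_num)]

theorem two_mul_triangle (i : ℤ) : 2 * (i * (i + 1) / 2) = i * (i + 1) :=
  Int.mul_ediv_cancel' (Int.even_mul_succ_self i).two_dvd

theorem summable_triangle {q : ℝ} (hq0 : 0 < q) (hq1 : q < 1) {A : ℝ} (hA : 0 < A) :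
    Summable fun i : ℤ => q ^ (i * (i + 1) / 2) * A ^ i.natAbs := by
  have hn : Summable fun n : ℕ => q ^ ((n : ℤ) * (n + 1) / 2) * A ^ n := by
    refine summable_of_ratio_test_tendsto_lt_one (l := 0) one_pos
      (Eventually.of_forall fun n => by positivity) ?_
    have h : ∀ n : ℕ, ‖q ^ (((n + 1 : ℕ) : ℤ) * ((n + 1 : ℕ) + 1) / 2) * A ^ (n + 1)‖ /
        ‖q ^ ((n : ℤ) * (n + 1) / 2) * A ^ n‖ = q ^ n * (q * A) := fun n => by
      rw [Real.norm_of_nonneg (by positivity), Real.norm_of_nonneg (by positivity)]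
      push_cast
      rw [triangle_succ, zpow_add₀ hq0.ne', zpow_add_one₀ hq0.ne', zpow_natCast, pow_succ A]
      field_simp
    simp only [h]
    simpa using (tendsto_pow_atTop_nhds_zero_of_lt_one hq0.le hq1).mul_const (q * A)
  refine Summable.of_nat_of_neg_add_one ?_ ?_
  · simpa using hn
  -- The reflection i ↦ -i-1 preserves i(i+1), so the negative half repeats the positive one up to a
  -- factor A.
  · refine (hn.mul_right A).congr fun n => ?_
    rw [show -((n : ℤ) + 1) * (-((n : ℤ) + 1) + 1) = (n : ℤ) * (n + 1) by ring,
      show (-((n : ℤ) + 1)).natAbs = n + 1 by omega, pow_succ]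
    ring

/-- The weight `q^{i(i+1)/2} Q^{i+1}`. -/
noncomputable def thetaWeight (q Q : ℝ) (i : ℤ) : ℝ := q ^ (i * (i + 1) / 2) * Q ^ (i + 1)

theorem thetaWeight_pos {q Q : ℝ} (hq : 0 < q) (hQ : 0 < Q) (i : ℤ) : 0 < thetaWeight q Q i := by
  unfold thetaWeight; positivity

theorem thetaWeight_le {q Q A : ℝ} (hq : 0 < q) (hA : 1 ≤ A) (h1 : A⁻¹ ≤ Q) (h2 : Q ≤ A) (i : ℤ) :
    thetaWeight q Q i ≤ A * (q ^ (i * (i + 1) / 2) * A ^ i.natAbs) := by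
  have hA0 : 0 < A := by linarith
  have hQ : 0 < Q := lt_of_lt_of_le (by positivity) h1
  have : Q ^ (i + 1) ≤ A ^ (i.natAbs + 1) := by
    rcases le_total 0 (i + 1) with h | h
    · obtain ⟨m, hm⟩ := Int.eq_ofNat_of_zero_le h
      rw [hm]
      calc Q ^ m ≤ A ^ m := by gcongr
        _ ≤ _ := pow_le_pow_right₀ hA (by omega)
    · obtain ⟨m, hm⟩ := Int.eq_ofNat_of_zero_le (neg_nonneg.mpr h)
      rw [show i + 1 = -(m : ℤ) by omega, zpow_neg, zpow_natCast, ← inv_pow]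
      calc Q⁻¹ ^ m ≤ A ^ m := by
            gcongr
            exact inv_le_of_inv_le₀ hA0 h1
        _ ≤ _ := pow_le_pow_right₀ hA (by omega)
  rw [thetaWeight]
  calc _ ≤ q ^ (i * (i + 1) / 2) * A ^ (i.natAbs + 1) := by gcongr
    _ = _ := by ring

/-- The bound is uniform for Q in a compact interval because Q = q^{-f} varies over [1, 1/q] with
the fractional part. -/
theorem exists_tsum_thetaWeight_le {q A : ℝ} (hq0 : 0 < q) (hq1 : q < 1) (hA : 1 ≤ A) :
    ∃ S : ℝ, 0 ≤ S ∧ ∀ Q, A⁻¹ ≤ Q → Q ≤ A →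
      Summable (fun i : ℤ => thetaWeight q Q i * 4 ^ i.natAbs) ∧
      ∑' i : ℤ, thetaWeight q Q i * 4 ^ i.natAbs ≤ S := by
  have hA0 : 0 < A := by linarith
  have hs : Summable fun i : ℤ => A * (q ^ (i * (i + 1) / 2) * (A * 4) ^ i.natAbs) :=
    (summable_triangle hq0 hq1 (A := A * 4) (by positivity)).mul_left A
  have hle : ∀ Q, A⁻¹ ≤ Q → Q ≤ A → ∀ i : ℤ, thetaWeight q Q i * 4 ^ i.natAbs ≤
      A * (q ^ (i * (i + 1) / 2) * (A * 4) ^ i.natAbs) := fun Q h1 h2 i => by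
    calc _ ≤ A * (q ^ (i * (i + 1) / 2) * A ^ i.natAbs) * 4 ^ i.natAbs := by
          gcongr
          exact thetaWeight_le hq0 hA h1 h2 i
      _ = _ := by rw [mul_pow]; ring
  refine ⟨∑' i : ℤ, A * (q ^ (i * (i + 1) / 2) * (A * 4) ^ i.natAbs),
    tsum_nonneg fun i => by positivity, fun Q h1 h2 => ?_⟩
  have hQ : 0 < Q := lt_of_lt_of_le (by positivity) h1
  have hsum : Summable fun i : ℤ => thetaWeight q Q i * 4 ^ i.natAbs :=
    hs.of_nonneg_of_le (fun i => mul_nonneg (thetaWeight_pos hq0 hQ i).le (by positivity))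
      (hle Q h1 h2)
  exact ⟨hsum, hsum.tsum_le_tsum (hle Q h1 h2) hs⟩

theorem summable_thetaWeight {q Q : ℝ} (hq0 : 0 < q) (hq1 : q < 1) (hQ : 0 < Q) :
    Summable fun i : ℤ => thetaWeight q Q i * 4 ^ i.natAbs := by
  obtain ⟨S, -, hS⟩ := exists_tsum_thetaWeight_le hq0 hq1 (A := max 1 (max Q Q⁻¹)) (le_max_left _ _)
  refine (hS Q ?_ ?_).1
  · exact inv_le_of_inv_le₀ hQ ((le_max_right _ _).trans (le_max_right _ _))
  · exact (le_max_left _ _).trans (le_max_right _ _)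

/-- The scaled Taylor coefficient `Q^l F^{(l)}(Q) / l!` of the theta series `F`. -/
noncomputable def thetaTaylor (q Q : ℝ) (l : ℕ) : ℝ :=
  ∑' i : ℤ, thetaWeight q Q i * thetaCoeff (q ^ i * Q) i l

theorem norm_thetaWeight_mul_thetaCoeff_le {q Q : ℝ} (hq : 0 < q) (hQ : 0 < Q) (i : ℤ) (l : ℕ) :
    ‖thetaWeight q Q i * thetaCoeff (q ^ i * Q) i l‖ ≤
      (thetaWeight q Q i * 4 ^ i.natAbs) * (2 * 2 ^ l) := by
  rw [norm_mul, Real.norm_of_nonneg (thetaWeight_pos hq hQ i).le, mul_assoc]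
  refine mul_le_mul_of_nonneg_left ?_ (thetaWeight_pos hq hQ i).le
  refine (abs_thetaCoeff_le (by positivity) i l).trans ?_
  rw [pow_succ, mul_assoc]
  gcongr
  norm_num

theorem summable_thetaTaylor {q Q : ℝ} (hq0 : 0 < q) (hq1 : q < 1) (hQ : 0 < Q) (l : ℕ) :
    Summable fun i : ℤ => thetaWeight q Q i * thetaCoeff (q ^ i * Q) i l :=
  ((summable_thetaWeight hq0 hq1 hQ).mul_right _).of_norm_bounded
    fun i => norm_thetaWeight_mul_thetaCoeff_le hq0 hQ i l

theorem abs_thetaTaylor_le {q Q : ℝ} (hq0 : 0 < q) (hq1 : q < 1) (hQ : 0 < Q) (l : ℕ) :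
    |thetaTaylor q Q l| ≤ (∑' i : ℤ, thetaWeight q Q i * 4 ^ i.natAbs) * (2 * 2 ^ l) := by
  rw [← tsum_mul_right]
  exact tsum_of_norm_bounded ((summable_thetaWeight hq0 hq1 hQ).mul_right _).hasSum
    fun i => norm_thetaWeight_mul_thetaCoeff_le hq0 hQ i l

theorem hasSum_thetaCoeff {c : ℝ} (hc : 0 ≤ c) (i : ℤ) {v : ℝ} (hv : |v| ≤ 1 / 2) :
    HasSum (fun l => thetaCoeff c i l * v ^ l) ((1 + v) ^ (i + 1) / (1 + c * (1 + v))) := by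
  have h := hasSum_taylorCoeff (differentiableOn_thetaTerm hc i) (v := (v : ℂ)) (by
    rwa [Complex.norm_real, Real.norm_eq_abs])
  have h2 := Complex.hasSum_re h
  have e : thetaTerm c i v = (((1 + v) ^ (i + 1) / (1 + c * (1 + v)) : ℝ) : ℂ) := by
    unfold thetaTerm; push_cast; rfl
  rw [e, Complex.ofReal_re] at h2
  refine h2.congr_fun fun l => ?_
  rw [← Complex.ofReal_pow, Complex.re_mul_ofReal]
  rfl

theorem thetaF_mul_eq (q : ℝ) {Q : ℝ} (v : ℝ) :
    thetaF q (Q * (1 + v)) = ∑' i : ℤ, thetaWeight q Q i *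
      ((1 + v) ^ (i + 1) / (1 + q ^ i * Q * (1 + v))) := by
  refine tsum_congr fun i => ?_
  rw [mul_zpow, thetaWeight, ← mul_assoc (q ^ i)]
  ring

/-- The double family over (i, l) is dominated by the weights 4^|i| times a geometric series of
ratio 2|v| < 1, so the sums may be exchanged. The derivatives of F are then read off by uniqueness
of power series coefficients. -/
theorem hasSum_thetaTaylor {q Q : ℝ} (hq0 : 0 < q) (hq1 : q < 1) (hQ : 0 < Q) {v : ℝ}
    (hv : |v| < 1 / 2) :
    HasSum (fun l => thetaTaylor q Q l * v ^ l) (thetaF q (Q * (1 + v))) := by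
  have hg : Summable fun l : ℕ => (2 * (2 * |v|) ^ l : ℝ) :=
    (summable_geometric_of_lt_one (by positivity) (by linarith)).mul_left 2
  have hprod := (summable_thetaWeight hq0 hq1 hQ).mul_of_nonneg hg
    (fun i => mul_nonneg (thetaWeight_pos hq0 hQ i).le (by positivity)) (fun l => by positivity)
  have hS : Summable fun x : ℤ × ℕ =>
      thetaWeight q Q x.1 * thetaCoeff (q ^ x.1 * Q) x.1 x.2 * v ^ x.2 := by
    refine hprod.of_norm_bounded fun x => ?_
    rw [norm_mul, norm_pow, Real.norm_eq_abs v]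
    refine (mul_le_mul_of_nonneg_right (norm_thetaWeight_mul_thetaCoeff_le hq0 hQ x.1 x.2)
      (by positivity)).trans (le_of_eq ?_)
    ring
  have h1 : HasSum (fun i : ℤ => thetaWeight q Q i *
      ((1 + v) ^ (i + 1) / (1 + q ^ i * Q * (1 + v)))) (∑' x : ℤ × ℕ,
        thetaWeight q Q x.1 * thetaCoeff (q ^ x.1 * Q) x.1 x.2 * v ^ x.2) := by
    refine hS.hasSum.prod_fiberwise fun i => ?_
    simp only [mul_assoc (thetaWeight q Q i)]
    exact (hasSum_thetaCoeff (by positivity) i hv.le).mul_left _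
  have h2 : HasSum (fun l => thetaTaylor q Q l * v ^ l) (∑' x : ℤ × ℕ,
        thetaWeight q Q x.1 * thetaCoeff (q ^ x.1 * Q) x.1 x.2 * v ^ x.2) := by
    rw [← (Equiv.prodComm ℕ ℤ).tsum_eq]
    refine hS.prod_symm.hasSum.prod_fiberwise fun l => ?_
    exact (summable_thetaTaylor hq0 hq1 hQ l).hasSum.mul_right _
  rw [thetaF_mul_eq, h1.tsum_eq]
  exact h2

theorem hasFPowerSeriesAt_thetaF {q Q : ℝ} (hq0 : 0 < q) (hq1 : q < 1) (hQ : 0 < Q) :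
    HasFPowerSeriesAt (thetaF q)
      (FormalMultilinearSeries.ofScalars ℝ fun l => thetaTaylor q Q l * (Q⁻¹) ^ l) Q := by
  rw [hasFPowerSeriesAt_iff]
  filter_upwards [Metric.ball_mem_nhds (0 : ℝ) (ε := Q / 2) (by positivity)] with z hz
  rw [mem_ball_zero_iff, Real.norm_eq_abs] at hz
  have := hasSum_thetaTaylor hq0 hq1 hQ (v := z * Q⁻¹) (by
    rw [abs_mul, abs_inv, abs_of_pos hQ, ← div_eq_mul_inv, div_lt_iff₀ hQ]; linarith)
  rw [show Q * (1 + z * Q⁻¹) = Q + z by field_simp] at this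
  refine this.congr_fun fun l => ?_
  rw [FormalMultilinearSeries.coeff_ofScalars, mul_pow, smul_eq_mul]
  ring

theorem pow_mul_iteratedDeriv_thetaF {q Q : ℝ} (hq0 : 0 < q) (hq1 : q < 1) (hQ : 0 < Q) (l : ℕ) :
    Q ^ l * iteratedDeriv l (thetaF q) Q = l.factorial * thetaTaylor q Q l := by
  have h1 := hasFPowerSeriesAt_thetaF hq0 hq1 hQ
  have h2 := h1.analyticAt.hasFPowerSeriesAt
  have h3 := congrArg (fun p => p.coeff l) (h1.eq_formalMultilinearSeries h2)
  simp only [FormalMultilinearSeries.coeff_ofScalars] at h3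
  rw [eq_div_iff (Nat.cast_ne_zero.mpr l.factorial_ne_zero)] at h3
  rw [← h3, inv_pow]
  field_simp

theorem thetaTaylor_zero {q Q : ℝ} (hq0 : 0 < q) (hq1 : q < 1) (hQ : 0 < Q) :
    thetaTaylor q Q 0 = thetaF q Q := by
  simpa using (pow_mul_iteratedDeriv_thetaF hq0 hq1 hQ 0).symm

theorem summable_thetaF {q Q : ℝ} (hq0 : 0 < q) (hq1 : q < 1) (hQ : 0 < Q) :
    Summable fun j : ℤ => q ^ (j * (j + 1) / 2) / (1 + q ^ j * Q) * Q ^ (j + 1) := by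
  refine (summable_thetaWeight hq0 hq1 hQ).of_nonneg_of_le (fun i => by positivity) fun i => ?_
  have h1 : (1 : ℝ) ≤ 1 + q ^ i * Q := by
    have : 0 < q ^ i * Q := by positivity
    linarith
  calc _ ≤ q ^ (i * (i + 1) / 2) * Q ^ (i + 1) := by
        gcongr
        exact div_le_self (by positivity) h1
    _ ≤ _ := le_mul_of_one_le_right (by positivity) (one_le_pow₀ (by norm_num))

theorem half_le_thetaF {q Q : ℝ} (hq0 : 0 < q) (hq1 : q < 1) (hQ : 1 ≤ Q) :
    1 / 2 ≤ thetaF q Q := by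
  have hQ0 : 0 < Q := by linarith
  refine le_trans ?_ ((summable_thetaF hq0 hq1 hQ0).le_tsum 0 fun j _ => by positivity)
  simp only [zero_mul, Int.zero_ediv, zpow_zero, one_mul, zero_add, zpow_one]
  rw [div_mul_eq_mul_div, one_mul, div_le_div_iff₀ (by norm_num) (by linarith)]
  linarith

theorem thetaF_pos {q Q : ℝ} (hq0 : 0 < q) (hq1 : q < 1) (hQ : 0 < Q) : 0 < thetaF q Q :=
  (summable_thetaF hq0 hq1 hQ).tsum_pos (fun j => by positivity) 0 (by positivity)

/-- Shifting the summation index by one leaves the bilateral series unchanged. -/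
theorem thetaF_eq_mul {q s : ℝ} (hq0 : 0 < q) (hs : 0 < s) :
    thetaF q s = s * thetaF q (q * s) := by
  unfold thetaF
  rw [← (Equiv.addRight (1 : ℤ)).tsum_eq (fun j : ℤ =>
    q ^ (j * (j + 1) / 2) / (1 + q ^ j * s) * s ^ (j + 1)), ← tsum_mul_left]
  refine tsum_congr fun j => ?_
  simp only [Equiv.coe_addRight]
  rw [triangle_succ, zpow_add₀ hq0.ne', zpow_add_one₀ hs.ne', mul_zpow, zpow_add_one₀ hq0.ne']
  ring

/-! ### Rescaling around the dominant index -/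

/-- The prefactor `q^{-N(N+1)/2} Q^N`. -/
noncomputable def shiftPref (q Q : ℝ) (N : ℕ) : ℝ := q ^ (-((N : ℤ) * (N + 1) / 2)) * Q ^ N

/-- With j = N + i, scaling by Q q^{-N} turns the rate q^j into q^i Q, and j(j+1)/2 - N(j+1) =
i(i+1)/2 - N(N+1)/2. The series is thereby recentred at index N; indices i < -N contribute zero. -/
theorem hasSum_shiftedTerm {p q Q : ℝ} (hp0 : 0 < p) (hp1 : p < 1) (hq : q = 1 - p) (hQ : 0 < Q)
    (N : ℕ) {u : ℝ} (hu : 0 < u) :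
    HasSum (fun i : ℤ => thetaWeight q Q i * shiftedTerm N i (q ^ i * Q) u)
      (poissonGF p (Q * q ^ (-(N : ℤ)) * u) * Real.exp (-u) / shiftPref q Q N) := by
  have hq0 : 0 < q := by linarith
  have hs := hasSum_gfTerm hp0.le hp1.le (x := Q * q ^ (-(N : ℤ)) * u) (by positivity)
  rw [← hq] at hs
  have hP : shiftPref q Q N ≠ 0 := by unfold shiftPref; positivity
  have hinj : Function.Injective fun j : ℕ => (j : ℤ) - N := fun a b h => by simpa using h
  refine (hinj.hasSum_iff fun i hi => ?_).mp
    (((hs.mul_right (Real.exp (-u))).div_const (shiftPref q Q N)).congr_fun fun j => ?_)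
  · rw [shiftedTerm, if_neg, mul_zero]
    intro h
    exact hi ⟨(N + i).toNat, by simp only; omega⟩
  · simp only [Function.comp]
    rw [shiftedTerm, if_pos (by omega), show ((N : ℤ) + ((j : ℤ) - N)).toNat = j by omega,
      eq_div_iff hP, gfTerm, expConv_mul]
    have e1 : Q * q ^ (-(N : ℤ)) * q ^ j = q ^ ((j : ℤ) - N) * Q := by
      rw [sub_eq_neg_add, zpow_add₀ hq0.ne', zpow_natCast]; ring
    have e2 : q ^ (j * (j + 1) / 2) * (Q * q ^ (-(N : ℤ))) ^ (j + 1) =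
        thetaWeight q Q ((j : ℤ) - N) * shiftPref q Q N := by
      have e3 : q ^ (j * (j + 1) / 2) = q ^ ((j : ℤ) * (j + 1) / 2) := by
        rw [← zpow_natCast]; push_cast; rfl
      have e4 : ((q ^ (-(N : ℤ))) ^ (j + 1) : ℝ) = q ^ (-((N : ℤ) * (j + 1))) := by
        rw [← zpow_natCast, ← zpow_mul]; congr 1; push_cast; ring
      have e5 : (Q ^ (j + 1) : ℝ) = Q ^ ((j : ℤ) - N + 1) * Q ^ N := by
        rw [← zpow_natCast, ← zpow_natCast, ← zpow_add₀ hQ.ne']; congr 1; push_cast; ring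
      rw [mul_pow, e4, e5, e3, thetaWeight, shiftPref]
      have e6 : (q ^ ((j : ℤ) * (j + 1) / 2) * q ^ (-((N : ℤ) * (j + 1))) : ℝ) =
          q ^ (((j : ℤ) - N) * ((j : ℤ) - N + 1) / 2) * q ^ (-((N : ℤ) * (N + 1) / 2)) := by
        rw [← zpow_add₀ hq0.ne', ← zpow_add₀ hq0.ne']
        congr 1
        have a1 := two_mul_triangle (j : ℤ)
        have a2 := two_mul_triangle (N : ℤ)
        have a3 := two_mul_triangle ((j : ℤ) - N)
        linarith
      linear_combination (Q ^ ((j : ℤ) - N + 1) * Q ^ N) * e6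
    rw [e1]
    linear_combination (-(expConv j (q ^ ((j : ℤ) - N) * Q) u * Real.exp (-u))) * e2

theorem exists_abs_poissonGF_sub_le {p q A : ℝ} (hp0 : 0 < p) (hp1 : p < 1) (hq : q = 1 - p)
    (hA : 1 ≤ A) (K : ℕ) : ∃ C : ℝ, 0 ≤ C ∧ ∀ (N : ℕ) (Q u : ℝ), 4 * (K + 1) ≤ N → A⁻¹ ≤ Q →
      Q ≤ A → 0 < u →
      |poissonGF p (Q * q ^ (-(N : ℤ)) * u) * Real.exp (-u) / shiftPref q Q N -
        ∑ l ∈ Finset.range K, thetaTaylor q Q l * poissonDiff l N u| ≤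
      C * √((N : ℝ)⁻¹) ^ (K + 1) := by
  have hq0 : 0 < q := by linarith
  have hq1 : q < 1 := by linarith
  obtain ⟨C, hC0, hC⟩ := exists_abs_shiftedTerm_sub_le K
  obtain ⟨S, hS0, hS⟩ := exists_tsum_thetaWeight_le hq0 hq1 hA
  refine ⟨C * S, by positivity, fun N Q u hN h1 h2 hu => ?_⟩
  have hQ : 0 < Q := lt_of_lt_of_le (by positivity) h1
  obtain ⟨hs, hle⟩ := hS Q h1 h2
  have e1 : HasSum (fun i : ℤ => thetaWeight q Q i * (shiftedTerm N i (q ^ i * Q) u -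
      ∑ l ∈ Finset.range K, thetaCoeff (q ^ i * Q) i l * poissonDiff l N u))
      (poissonGF p (Q * q ^ (-(N : ℤ)) * u) * Real.exp (-u) / shiftPref q Q N -
        ∑ l ∈ Finset.range K, thetaTaylor q Q l * poissonDiff l N u) := by
    refine ((hasSum_shiftedTerm hp0 hp1 hq hQ N hu).sub (hasSum_sum fun l _ =>
      (summable_thetaTaylor hq0 hq1 hQ l).hasSum.mul_right (poissonDiff l N u))).congr_fun
        fun i => ?_
    rw [mul_sub, Finset.mul_sum]
    congr 1
    exact Finset.sum_congr rfl fun l _ => by ring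
  have h3 := tsum_of_norm_bounded (hs.hasSum.mul_left (C * √((N : ℝ)⁻¹) ^ (K + 1)))
    (fun i => show ‖thetaWeight q Q i * (shiftedTerm N i (q ^ i * Q) u -
      ∑ l ∈ Finset.range K, thetaCoeff (q ^ i * Q) i l * poissonDiff l N u)‖ ≤ _ by
      rw [norm_mul, Real.norm_of_nonneg (thetaWeight_pos hq0 hQ i).le]
      refine (mul_le_mul_of_nonneg_left (hC N i (q ^ i * Q) u hN (by positivity) hu)
        (thetaWeight_pos hq0 hQ i).le).trans (le_of_eq ?_)
      ring)
  rw [e1.tsum_eq] at h3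
  refine h3.trans ?_
  calc _ ≤ C * √((N : ℝ)⁻¹) ^ (K + 1) * S := by gcongr
    _ = _ := by ring

/-! ### Stirling's series -/

theorem analyticAt_dslope {f : ℝ → ℝ} (hf : AnalyticAt ℝ f 0) : AnalyticAt ℝ (dslope f 0) 0 :=
  (hf.hasFPowerSeriesAt.has_fpower_series_dslope_fslope).analyticAt

theorem eq_add_mul_dslope (f : ℝ → ℝ) (t : ℝ) : f t = f 0 + t * dslope f 0 t := by
  have := sub_smul_dslope f 0 t
  simp only [sub_zero, smul_eq_mul] at this
  linarith

/-- The logarithmic remainder in Stirling's formula. -/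
noncomputable def stirlingErr (n : ℕ) : ℝ :=
  Real.log (Stirling.stirlingSeq n) - Real.log (√Real.pi)

theorem tendsto_stirlingErr : Tendsto stirlingErr atTop (nhds 0) := by
  have h := (Stirling.tendsto_stirlingSeq_sqrt_pi.log (by positivity)).sub_const
    (Real.log (√Real.pi))
  simpa [stirlingErr] using! h

/-- The difference is (n + 1/2) log(1 + 1/n) - 1. The divided slope of log(1 + t) expresses it as
the value at t = 1/n of a function analytic at 0. -/
theorem stirlingErr_sub_succ {n : ℕ} (hn : 1 ≤ n) :
    stirlingErr n - stirlingErr (n + 1) =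
      (1 + ((n : ℝ)⁻¹) / 2) * dslope (fun t => Real.log (1 + t)) 0 (n : ℝ)⁻¹ - 1 := by
  have hn0 : (0 : ℝ) < n := by exact_mod_cast hn
  rw [dslope_of_ne _ (by positivity), slope_def_field]
  simp only [stirlingErr, Stirling.log_stirlingSeq_formula, Nat.factorial_succ]
  have e : (1 : ℝ) + (n : ℝ)⁻¹ = (n + 1) / n := by field_simp
  rw [e]
  push_cast
  rw [Real.log_mul (by positivity) (by positivity), Real.log_mul (by positivity) (by positivity),
    Real.log_mul (by positivity) (by positivity), Real.log_div (by positivity) (by positivity),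
    Real.log_div (by positivity) (by positivity), Real.log_div (by positivity) (by positivity),
    Real.log_exp]
  simp
  field_simp
  ring

/-- The difference lies between the first term 1/(3(2n+1)²) of its positive series and 1/(12
n(n+1)). -/
theorem tendsto_sq_mul_stirlingErr_sub :
    Tendsto (fun n : ℕ => (n : ℝ) ^ 2 * (stirlingErr n - stirlingErr (n + 1))) atTop
      (nhds (1 / 12)) := by
  have hinv : Tendsto (fun n : ℕ => ((n : ℝ))⁻¹) atTop (nhds 0) := tendsto_inv_atTop_nhds_zero_nat
  have h1 : Tendsto (fun n : ℕ => 1 / (3 * (2 + ((n : ℝ))⁻¹) ^ 2)) atTop (nhds (1 / 12)) := by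
    have := ((hinv.const_add 2).pow 2).const_mul 3
    have h2 := this.inv₀ (by norm_num)
    norm_num at h2 ⊢
    simpa using h2
  have h2 : Tendsto (fun n : ℕ => 1 / (12 * (1 + ((n : ℝ))⁻¹))) atTop (nhds (1 / 12)) := by
    have := ((hinv.const_add 1)).const_mul 12
    have h2 := this.inv₀ (by norm_num)
    norm_num at h2 ⊢
    simpa using h2
  refine tendsto_of_tendsto_of_tendsto_of_le_of_le' h1 h2 ?_ ?_
  · filter_upwards [eventually_ge_atTop 1] with n hn
    obtain ⟨m, rfl⟩ := Nat.exists_eq_add_of_le' hn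
    have h3 := (Stirling.log_stirlingSeq_sdiff_hasSum m).summable.le_tsum 0
      (fun k _ => by positivity)
    rw [(Stirling.log_stirlingSeq_sdiff_hasSum m).tsum_eq] at h3
    have h4 : stirlingErr (m + 1) - stirlingErr (m + 1 + 1) =
        Real.log (Stirling.stirlingSeq (m + 1)) - Real.log (Stirling.stirlingSeq (m + 2)) := by
      simp [stirlingErr]
    rw [h4]
    refine le_trans (le_of_eq ?_) (mul_le_mul_of_nonneg_left h3 (by positivity))
    push_cast
    field_simp
    ring
  · filter_upwards [eventually_ge_atTop 1] with n hn
    have hn0 : (0 : ℝ) < n := by exact_mod_cast hn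
    have h3 := Stirling.log_stirlingSeq_sdiff_le n
    have h4 : stirlingErr n - stirlingErr (n + 1) =
        Real.log (Stirling.stirlingSeq n) - Real.log (Stirling.stirlingSeq (n + 1)) := by
      simp [stirlingErr]
    rw [h4]
    refine (mul_le_mul_of_nonneg_left h3 (by positivity)).trans (le_of_eq ?_)
    field_simp

theorem inv_pow_le_telescope (K : ℕ) {n : ℕ} (hn : 1 ≤ n) :
    ((n : ℝ)⁻¹) ^ (K + 2) ≤ 2 * (((n : ℝ)⁻¹) ^ (K + 1) - (((n + 1 : ℕ) : ℝ)⁻¹) ^ (K + 1)) := by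
  have hn0 : (1 : ℝ) ≤ n := by exact_mod_cast hn
  push_cast
  have h1 : ((n : ℝ) ^ (K + 1)) + ((n : ℝ) + 1) ^ K ≤ ((n : ℝ) + 1) ^ (K + 1) := by
    rw [pow_succ, pow_succ, mul_add, mul_one]
    gcongr
    linarith
  have h2 : ((n : ℝ)⁻¹) ^ (K + 1) - (((n : ℝ) + 1)⁻¹) ^ (K + 1) =
      (((n : ℝ) + 1) ^ (K + 1) - (n : ℝ) ^ (K + 1)) / ((n : ℝ) ^ (K + 1) * ((n : ℝ) + 1) ^ (K + 1)) := by
    rw [inv_pow, inv_pow]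
    field_simp
  have hp : 0 < (n : ℝ) ^ (K + 1) := by positivity
  have hq : 0 < ((n : ℝ) + 1) ^ K := by positivity
  rw [h2, inv_pow, ← one_div, ← mul_div_assoc, div_le_div_iff₀ (by positivity) (by positivity)]
  calc 1 * ((n : ℝ) ^ (K + 1) * ((n : ℝ) + 1) ^ (K + 1))
      = (n : ℝ) ^ (K + 1) * (((n : ℝ) + 1) ^ K * (n + 1)) := by ring
    _ ≤ (n : ℝ) ^ (K + 1) * (((n : ℝ) + 1) ^ K * (2 * n)) := by gcongr; linarith
    _ = 2 * ((n : ℝ) + 1) ^ K * (n : ℝ) ^ (K + 2) := by ring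
    _ ≤ _ := by gcongr; linarith

/-- A bound on consecutive differences is turned into a bound on the sequence: e(m) - 2C m^{-K-1} is
nondecreasing in m ≥ n and tends to 0, so it is at most 0. -/
theorem le_of_telescope {e : ℕ → ℝ} (he : Tendsto e atTop (nhds 0)) {K n₀ : ℕ} {C : ℝ}
    (hC : 0 ≤ C) (hn₀ : 1 ≤ n₀) (h : ∀ n, n₀ ≤ n → e n - e (n + 1) ≤ C * ((n : ℝ)⁻¹) ^ (K + 2))
    {n : ℕ} (hn : n₀ ≤ n) : e n ≤ 2 * C * ((n : ℝ)⁻¹) ^ (K + 1) := by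
  set g : ℕ → ℝ := fun k => e (n + k) - 2 * C * (((n + k : ℕ) : ℝ)⁻¹) ^ (K + 1) with hg
  have hmono : Monotone g := by
    refine monotone_nat_of_le_succ fun k => ?_
    have h1 := h (n + k) (by omega)
    have h2 := mul_le_mul_of_nonneg_left (inv_pow_le_telescope K (n := n + k) (by omega)) hC
    simp only [hg]
    rw [show n + (k + 1) = n + k + 1 by ring]
    linarith
  have hlim : Tendsto g atTop (nhds 0) := by
    have h1 : Tendsto (fun k : ℕ => n + k) atTop atTop := 
      tendsto_atTop_mono (fun k => Nat.le_add_left k n) tendsto_id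
    have h2 := (((tendsto_inv_atTop_nhds_zero_nat (𝕜 := ℝ)).comp h1).pow (K + 1)).const_mul (2 * C)
    have h3 := (he.comp h1).sub h2
    rw [zero_pow (by omega), mul_zero, sub_zero] at h3
    exact h3
  have := hmono.ge_of_tendsto hlim 0
  simp only [hg, add_zero] at this
  linarith

theorem isBigO_of_telescope {e : ℕ → ℝ} (he : Tendsto e atTop (nhds 0)) {K : ℕ}
    (h : (fun n => e n - e (n + 1)) =O[atTop] fun n : ℕ => ((n : ℝ)⁻¹) ^ (K + 2)) :
    e =O[atTop] fun n : ℕ => ((n : ℝ)⁻¹) ^ (K + 1) := by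
  obtain ⟨C, hC, hb⟩ := h.exists_nonneg
  obtain ⟨n₁, hn₁⟩ := eventually_atTop.mp hb.bound
  have hb' : ∀ n, max n₁ 1 ≤ n → |e n - e (n + 1)| ≤ C * ((n : ℝ)⁻¹) ^ (K + 2) := fun n hn => by
    have := hn₁ n (le_of_max_le_left hn)
    rwa [Real.norm_eq_abs, Real.norm_of_nonneg (by positivity)] at this
  refine IsBigO.of_bound (2 * C) ?_
  filter_upwards [eventually_ge_atTop (max n₁ 1)] with n hn
  rw [Real.norm_eq_abs, Real.norm_of_nonneg (by positivity)]
  refine abs_le'.mpr ⟨?_, ?_⟩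
  · exact le_of_telescope he hC (le_max_right _ _) (fun n hn => (le_abs_self _).trans (hb' n hn)) hn
  · have he' : Tendsto (fun n => -e n) atTop (nhds 0) := by simpa using he.neg
    exact le_of_telescope (e := fun n => -e n) he' hC (le_max_right _ _)
      (fun n hn => (by linarith [neg_abs_le (e n - e (n + 1))] :
        -e n - -e (n + 1) ≤ |e n - e (n + 1)|).trans (hb' n hn)) hn

/-- The substitution t ↦ t/(1+t) sends 1/n to 1/(n+1). The equation S(t) - S(t/(1+t)) = A(t) is
solved one degree at a time. -/
theorem exists_telescoping_polynomial {A h₀ : ℝ → ℝ} (h₀a : AnalyticAt ℝ h₀ 0)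
    (hA : ∀ᶠ t in nhds 0, A t = t ^ 2 * h₀ t) (K : ℕ) :
    ∃ (S : Polynomial ℝ) (h : ℝ → ℝ), AnalyticAt ℝ h 0 ∧ S.coeff 0 = 0 ∧
      (1 ≤ K → S.coeff 1 = h₀ 0) ∧ (K = 0 → h 0 = h₀ 0 ∧ S = 0) ∧
      ∀ᶠ t in nhds 0, A t - S.eval t + S.eval (t / (1 + t)) = t ^ (K + 2) * h t := by
  induction K with
  | zero => exact ⟨0, h₀, h₀a, by simp, by simp, by simp, by simpa using hA⟩
  | succ K ih =>
    obtain ⟨S, h, ha, hS0, hS1, hK, heq⟩ := ih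
    -- The monomial t^{K+1} changes by (K+1) t^{K+2} + ... under the substitution, so this
    -- coefficient removes the leading error.
    set b := h 0 / (K + 1) with hb
    set g : ℝ → ℝ := fun t => h t -
      b * ((∑ i ∈ Finset.range (K + 1), (1 + t) ^ i) / (1 + t) ^ (K + 1)) with hg
    have hga : AnalyticAt ℝ g 0 := by
      refine ha.sub (analyticAt_const.mul (AnalyticAt.div ?_ ?_ (by simp)))
      · exact Finset.analyticAt_fun_sum _ fun i _ => (analyticAt_const.add analyticAt_id).pow i
      · exact (analyticAt_const.add analyticAt_id).pow _
    have hg0 : g 0 = 0 := by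
      simp only [hg, hb, add_zero, one_pow, Finset.sum_const, Finset.card_range, nsmul_eq_mul]
      push_cast
      field_simp
      simp
    refine ⟨S + Polynomial.C b * Polynomial.X ^ (K + 1), dslope g 0, analyticAt_dslope hga,
      ?_, fun _ => ?_, fun h => absurd h (by omega), ?_⟩
    · simp [hS0]
    · rcases Nat.eq_zero_or_pos K with rfl | hKp
      · obtain ⟨h1, h2⟩ := hK rfl
        simp [h2, hb, h1]
      · rw [Polynomial.coeff_add, hS1 hKp, Polynomial.coeff_C_mul, Polynomial.coeff_X_pow,
          if_neg (by omega)]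
        simp
    · filter_upwards [heq, Metric.ball_mem_nhds (0 : ℝ) one_pos] with t ht hb1
      rw [mem_ball_zero_iff, Real.norm_eq_abs, abs_lt] at hb1
      have h1t : 1 + t ≠ 0 := by linarith [hb1.1]
      have e1 := eq_add_mul_dslope g t
      rw [hg0, zero_add] at e1
      have e2 : t ^ (K + 1 + 2) * dslope g 0 t = t ^ (K + 2) * g t := by rw [e1]; ring
      rw [e2]
      simp only [Polynomial.eval_add, Polynomial.eval_mul, Polynomial.eval_C, Polynomial.eval_pow,
        Polynomial.eval_X, hg]
      rw [mul_sub, ← ht]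
      have e3 := mul_geom_sum (1 + t) (K + 1)
      rw [add_sub_cancel_left] at e3
      rw [div_pow]
      have e4 : t ^ (K + 2) * (b * ((∑ i ∈ Finset.range (K + 1), (1 + t) ^ i) / (1 + t) ^ (K + 1))) =
          b * t ^ (K + 1) * ((t * ∑ i ∈ Finset.range (K + 1), (1 + t) ^ i) / (1 + t) ^ (K + 1)) := by
        ring
      rw [e4, e3]
      field_simp
      ring

/-- The Stirling series. -/
theorem exists_stirling_series (K : ℕ) : ∃ S : Polynomial ℝ, S.coeff 0 = 0 ∧
    (1 ≤ K → S.coeff 1 = 1 / 12) ∧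
    (fun n : ℕ => stirlingErr n - S.eval (n : ℝ)⁻¹) =O[atTop]
      fun n : ℕ => ((n : ℝ)⁻¹) ^ (K + 1) := by
  have hinv : Tendsto (fun n : ℕ => ((n : ℝ))⁻¹) atTop (nhds 0) := tendsto_inv_atTop_nhds_zero_nat
  set A : ℝ → ℝ := fun t => (1 + t / 2) * dslope (fun t => Real.log (1 + t)) 0 t - 1 with hA
  have hAa : AnalyticAt ℝ A 0 := by
    refine AnalyticAt.sub (AnalyticAt.mul (by fun_prop) (analyticAt_dslope ?_)) analyticAt_const
    exact (analyticAt_const.add analyticAt_id).log (by simp)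
  have hAn : ∀ᶠ n : ℕ in atTop, stirlingErr n - stirlingErr (n + 1) = A (n : ℝ)⁻¹ := by
    filter_upwards [eventually_ge_atTop 1] with n hn
    exact stirlingErr_sub_succ hn
  -- That A vanishes to second order, and the coefficient 1/12, are read off from limits along t =
  -- 1/n instead of from derivatives of the logarithm.
  have hA0 : A 0 = 0 := by
    refine tendsto_nhds_unique (hAa.continuousAt.tendsto.comp hinv) ?_
    have := tendsto_stirlingErr.sub (tendsto_stirlingErr.comp (tendsto_add_atTop_nat 1))
    rw [sub_zero] at this
    exact this.congr' hAn
  set B := dslope A 0 with hB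
  have hBa : AnalyticAt ℝ B 0 := analyticAt_dslope hAa
  have hAB : ∀ t, A t = t * B t := fun t => by rw [eq_add_mul_dslope A t, hA0, zero_add]
  have hBn : ∀ᶠ n : ℕ in atTop, (n : ℝ) * (stirlingErr n - stirlingErr (n + 1)) = B (n : ℝ)⁻¹ := by
    filter_upwards [hAn, eventually_ge_atTop 1] with n hn h1
    have hn0 : (0 : ℝ) < n := by exact_mod_cast h1
    rw [hn, hAB]
    field_simp
  have hB0 : B 0 = 0 := by
    refine tendsto_nhds_unique (hBa.continuousAt.tendsto.comp hinv) ?_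
    have h1 := hinv.mul tendsto_sq_mul_stirlingErr_sub
    rw [zero_mul] at h1
    refine h1.congr' ?_
    filter_upwards [hBn, eventually_ge_atTop 1] with n hn h1
    have hn0 : (0 : ℝ) < n := by exact_mod_cast h1
    simp only [Function.comp]
    rw [← hn]
    field_simp
  set h₀ := dslope B 0 with hh₀
  have h₀a : AnalyticAt ℝ h₀ 0 := analyticAt_dslope hBa
  have hAh : ∀ t, A t = t ^ 2 * h₀ t := fun t => by
    rw [hAB, eq_add_mul_dslope B t, hB0, zero_add]; ring
  have h₀v : h₀ 0 = 1 / 12 := by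
    refine tendsto_nhds_unique (h₀a.continuousAt.tendsto.comp hinv) ?_
    refine tendsto_sq_mul_stirlingErr_sub.congr' ?_
    filter_upwards [hAn, eventually_ge_atTop 1] with n hn h1
    have hn0 : (0 : ℝ) < n := by exact_mod_cast h1
    simp only [Function.comp]
    rw [hn, hAh]
    field_simp
  obtain ⟨S, h, ha, hS0, hS1, -, heq⟩ := exists_telescoping_polynomial h₀a
    (Eventually.of_forall hAh) K
  refine ⟨S, hS0, fun hK => (hS1 hK).trans h₀v, isBigO_of_telescope ?_ ?_⟩
  · have h1 : Tendsto (fun n : ℕ => S.eval (n : ℝ)⁻¹) atTop (nhds 0) := by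
      have := S.continuous.continuousAt.tendsto.comp hinv
      rwa [← Polynomial.coeff_zero_eq_eval_zero, hS0] at this
    simpa using tendsto_stirlingErr.sub h1
  · have h2 : (fun n : ℕ => h (n : ℝ)⁻¹) =O[atTop] fun _ => (1 : ℝ) :=
      (ha.continuousAt.tendsto.comp hinv).isBigO_one ℝ
    have h3 := (isBigO_refl (fun n : ℕ => ((n : ℝ)⁻¹) ^ (K + 2)) atTop).mul h2
    simp only [mul_one] at h3
    refine h3.congr' ?_ EventuallyEq.rfl
    filter_upwards [hAn, hinv.eventually heq, eventually_ge_atTop 1] with n hn he h1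
    have hn0 : (0 : ℝ) < n := by exact_mod_cast h1
    rw [← he, ← hn]
    have : (n : ℝ)⁻¹ / (1 + (n : ℝ)⁻¹) = ((n + 1 : ℕ) : ℝ)⁻¹ := by
      push_cast
      field_simp
    rw [this]
    ring

/-! ### Calculus of expansions in 1/(N + f), uniform in f -/

/-- The filter `N → ∞`, uniformly in `f ∈ [0, 1)`. -/
def fractFilter : Filter (ℕ × ℝ) := atTop ×ˢ 𝓟 (Set.Ico 0 1)

/-- The small parameter `1 / (N + f)`. -/
noncomputable def invSum (x : ℕ × ℝ) : ℝ := ((x.1 : ℝ) + x.2)⁻¹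

theorem eventually_fractFilter (N₀ : ℕ) :
    ∀ᶠ x in fractFilter, N₀ ≤ x.1 ∧ 0 ≤ x.2 ∧ x.2 < 1 :=
  (eventually_ge_atTop N₀).prod_mk (mem_principal_self (Set.Ico (0 : ℝ) 1))

theorem eventually_invSum : ∀ᶠ x in fractFilter,
    0 < invSum x ∧ invSum x ≤ 1 ∧ invSum x ≤ ((x.1 : ℝ))⁻¹ ∧ ((x.1 : ℝ))⁻¹ ≤ 2 * invSum x := by
  filter_upwards [eventually_fractFilter 1] with x hx
  obtain ⟨h1, h2, h3⟩ := hx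
  have hN : (1 : ℝ) ≤ x.1 := by exact_mod_cast h1
  have hN0 : (0 : ℝ) < x.1 := by linarith
  refine ⟨by unfold invSum; positivity, ?_, ?_, ?_⟩
  · exact inv_le_one_of_one_le₀ (by linarith)
  · unfold invSum; gcongr; linarith
  · rw [invSum, ← one_div, ← div_eq_mul_inv, div_le_div_iff₀ hN0 (by linarith)]
    linarith

theorem tendsto_invSum : Tendsto invSum fractFilter (nhds 0) := by
  have h : Tendsto (fun x : ℕ × ℝ => ((x.1 : ℝ))⁻¹) fractFilter (nhds 0) :=
    tendsto_inv_atTop_nhds_zero_nat.comp tendsto_fst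
  refine squeeze_zero' ?_ ?_ h
  · filter_upwards [eventually_invSum] with x hx using hx.1.le
  · filter_upwards [eventually_invSum] with x hx using hx.2.2.1

/-- Evaluation of a polynomial in `1 / (N + f)` with coefficients polynomial in `f`. -/
noncomputable def evalInv (P : Polynomial (Polynomial ℝ)) (x : ℕ × ℝ) : ℝ :=
  P.eval₂ (Polynomial.evalRingHom x.2) (invSum x)

theorem evalInv_add (P R : Polynomial (Polynomial ℝ)) (x : ℕ × ℝ) :
    evalInv (P + R) x = evalInv P x + evalInv R x := Polynomial.eval₂_add _ _

theorem evalInv_sub (P R : Polynomial (Polynomial ℝ)) (x : ℕ × ℝ) :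
    evalInv (P - R) x = evalInv P x - evalInv R x := Polynomial.eval₂_sub _

theorem evalInv_mul (P R : Polynomial (Polynomial ℝ)) (x : ℕ × ℝ) :
    evalInv (P * R) x = evalInv P x * evalInv R x := Polynomial.eval₂_mul _ _

theorem evalInv_pow (P : Polynomial (Polynomial ℝ)) (n : ℕ) (x : ℕ × ℝ) :
    evalInv (P ^ n) x = evalInv P x ^ n := Polynomial.eval₂_pow _ _ _

theorem evalInv_C (a : Polynomial ℝ) (x : ℕ × ℝ) : evalInv (Polynomial.C a) x = a.eval x.2 := by
  simp [evalInv]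

theorem evalInv_X (x : ℕ × ℝ) : evalInv Polynomial.X x = invSum x := by
  simp [evalInv]

theorem evalInv_sum {ι : Type*} (s : Finset ι) (P : ι → Polynomial (Polynomial ℝ)) (x : ℕ × ℝ) :
    evalInv (∑ i ∈ s, P i) x = ∑ i ∈ s, evalInv (P i) x := Polynomial.eval₂_finsetSum _ _ _ _

theorem isBigO_eval_snd (a : Polynomial ℝ) :
    (fun x : ℕ × ℝ => a.eval x.2) =O[fractFilter] fun _ => (1 : ℝ) := by
  obtain ⟨C, hC⟩ := (isCompact_Icc (a := (0 : ℝ)) (b := 1)).exists_bound_of_continuousOn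
    (f := fun y => a.eval y) a.continuous.continuousOn
  refine IsBigO.of_bound C ?_
  filter_upwards [eventually_fractFilter 0] with x hx
  rw [norm_one, mul_one]
  exact hC _ ⟨hx.2.1, hx.2.2.le⟩

theorem isBigO_invSum_pow_of_le {m n : ℕ} (h : m ≤ n) :
    (fun x => invSum x ^ n) =O[fractFilter] fun x => invSum x ^ m := by
  refine IsBigO.of_bound 1 ?_
  filter_upwards [eventually_invSum] with x hx
  rw [Real.norm_of_nonneg (pow_nonneg hx.1.le _), Real.norm_of_nonneg (pow_nonneg hx.1.le _),
    one_mul]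
  exact pow_le_pow_of_le_one hx.1.le hx.2.1 h

theorem isBigO_evalInv (P : Polynomial (Polynomial ℝ)) :
    evalInv P =O[fractFilter] fun _ => (1 : ℝ) := by
  induction P using Polynomial.induction_on' with
  | add P R hP hR => exact (hP.add hR).congr_left fun x => (evalInv_add P R x).symm
  | monomial n a =>
    have h1 : (fun x => invSum x ^ n) =O[fractFilter] fun _ => (1 : ℝ) := by
      simpa using isBigO_invSum_pow_of_le (Nat.zero_le n)
    refine ((isBigO_eval_snd a).mul h1).congr (fun x => ?_) fun _ => by simp
    simp [evalInv]

/-- `h` agrees with a polynomial in `1 / (N + f)` and `f` up to `O((N + f)^{-J-1})`. -/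
def HasExp (J : ℕ) (h : ℕ × ℝ → ℝ) (P : Polynomial (Polynomial ℝ)) : Prop :=
  (fun x => h x - evalInv P x) =O[fractFilter] fun x => invSum x ^ (J + 1)

section HasExp

variable {J : ℕ} {h g : ℕ × ℝ → ℝ} {P R : Polynomial (Polynomial ℝ)}

theorem HasExp.isBigO_one (H : HasExp J h P) : h =O[fractFilter] fun _ => (1 : ℝ) := by
  have h1 : (fun x => invSum x ^ (J + 1)) =O[fractFilter] fun _ => (1 : ℝ) := by
    simpa using isBigO_invSum_pow_of_le (Nat.zero_le (J + 1))
  exact ((IsBigO.trans H h1).add (isBigO_evalInv P)).congr_left fun x => by ring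

theorem HasExp.add (H : HasExp J h P) (G : HasExp J g R) : HasExp J (fun x => h x + g x) (P + R) :=
  (IsBigO.add H G).congr_left fun x => by rw [evalInv_add]; ring

theorem HasExp.sub (H : HasExp J h P) (G : HasExp J g R) : HasExp J (fun x => h x - g x) (P - R) :=
  (IsBigO.sub H G).congr_left fun x => by rw [evalInv_sub]; ring

theorem HasExp.mul (H : HasExp J h P) (G : HasExp J g R) : HasExp J (fun x => h x * g x) (P * R) := by
  have h1 := (IsBigO.mul H G.isBigO_one)
  have h2 := (isBigO_evalInv P).mul (show (fun x => g x - evalInv R x) =O[fractFilter] _ from G)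
  simp only [mul_one, one_mul] at h1 h2
  exact (h1.add h2).congr_left fun x => by rw [evalInv_mul]; ring

theorem HasExp.congr' (H : HasExp J h P) (e : h =ᶠ[fractFilter] g) : HasExp J g P :=
  IsBigO.congr' H (e.sub EventuallyEq.rfl) EventuallyEq.rfl

theorem hasExp_evalInv (J : ℕ) (P : Polynomial (Polynomial ℝ)) : HasExp J (evalInv P) P := by
  simpa [HasExp] using isBigO_zero _ _

theorem hasExp_const (J : ℕ) (c : ℝ) : HasExp J (fun _ => c) (Polynomial.C (Polynomial.C c)) := by
  refine (hasExp_evalInv J _).congr' (Eventually.of_forall fun x => ?_)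
  simp [evalInv_C]

theorem hasExp_eval_snd (J : ℕ) (a : Polynomial ℝ) :
    HasExp J (fun x => a.eval x.2) (Polynomial.C a) :=
  (hasExp_evalInv J _).congr' (Eventually.of_forall fun x => evalInv_C a x)

theorem hasExp_invSum (J : ℕ) : HasExp J invSum Polynomial.X :=
  (hasExp_evalInv J _).congr' (Eventually.of_forall fun x => evalInv_X x)

theorem HasExp.pow (H : HasExp J h P) (n : ℕ) : HasExp J (fun x => h x ^ n) (P ^ n) := by
  induction n with
  | zero => simpa using hasExp_const J 1
  | succ n ih => simpa only [pow_succ] using ih.mul H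

theorem HasExp.sum {ι : Type*} (s : Finset ι) {h : ι → ℕ × ℝ → ℝ}
    {P : ι → Polynomial (Polynomial ℝ)} (H : ∀ i ∈ s, HasExp J (h i) (P i)) :
    HasExp J (fun x => ∑ i ∈ s, h i x) (∑ i ∈ s, P i) := by
  refine (IsBigO.fun_sum H).congr_left fun x => ?_
  rw [evalInv_sum, Finset.sum_sub_distrib]

theorem HasExp.add_isBigO (H : HasExp J h P)
    (G : (fun x => g x - h x) =O[fractFilter] fun x => invSum x ^ (J + 1)) : HasExp J g P :=
  (IsBigO.add H G).congr_left fun x => by ring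

theorem HasExp.congr_poly (H : HasExp J h P) {S : Polynomial (Polynomial ℝ)}
    (e : P = R + Polynomial.X ^ (J + 1) * S) : HasExp J h R := by
  have h1 := (isBigO_refl (fun x => invSum x ^ (J + 1)) fractFilter).mul (isBigO_evalInv S)
  simp only [mul_one] at h1
  refine (IsBigO.add H h1).congr_left fun x => ?_
  rw [e, evalInv_add, evalInv_mul, evalInv_pow, evalInv_X]
  ring

theorem HasExp.exp (H : HasExp J h P) (h0 : h =O[fractFilter] invSum) :
    HasExp J (fun x => Real.exp (h x))
      (∑ k ∈ Finset.range (J + 1), P ^ k * Polynomial.C (Polynomial.C ((k.factorial : ℝ)⁻¹))) := by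
  have h1 := (Real.exp_sub_sum_range_isBigO_pow (J + 1)).comp_tendsto (h0.trans_tendsto tendsto_invSum)
  refine (HasExp.sum (Finset.range (J + 1)) fun k _ => (H.pow k).mul
    (hasExp_const J ((k.factorial : ℝ)⁻¹))).add_isBigO ?_
  exact (h1.trans (h0.pow (J + 1))).congr_left fun _ => by simp [div_eq_mul_inv]

theorem HasExp.eval (H : HasExp J h P) (S : Polynomial ℝ) :
    ∃ R, HasExp J (fun x => S.eval (h x)) R := by
  induction S using Polynomial.induction_on' with
  | add S T hS hT =>
    obtain ⟨R₁, h₁⟩ := hS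
    obtain ⟨R₂, h₂⟩ := hT
    exact ⟨_, (h₁.add h₂).congr' (Eventually.of_forall fun _ => by simp)⟩
  | monomial n a =>
    exact ⟨_, ((hasExp_const J a).mul (H.pow n)).congr' (Eventually.of_forall fun _ => by simp)⟩

theorem isBigO_eval_mul_invSum (a : Polynomial ℝ) :
    (fun x : ℕ × ℝ => a.eval x.2 * invSum x) =O[fractFilter] invSum :=
  ((isBigO_eval_snd a).mul (isBigO_refl invSum fractFilter)).congr_right fun _ => one_mul _

theorem hasExp_inv_one_add (J : ℕ) (a : Polynomial ℝ) :
    HasExp J (fun x => (1 + a.eval x.2 * invSum x)⁻¹)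
      (∑ k ∈ Finset.range (J + 1), (Polynomial.C (-a) * Polynomial.X) ^ k) := by
  have hy := isBigO_eval_mul_invSum a
  have h0 := hy.trans_tendsto tendsto_invSum
  have h1 : Tendsto (fun x : ℕ × ℝ => 1 + a.eval x.2 * invSum x) fractFilter (nhds 1) := by
    simpa using h0.const_add 1
  have h2 := (h1.inv₀ one_ne_zero).isBigO_one ℝ
  refine (HasExp.sum (Finset.range (J + 1)) fun k _ =>
    ((hasExp_eval_snd J (-a)).mul (hasExp_invSum J)).pow k).add_isBigO ?_
  have h3 := (hy.neg_left.pow (J + 1)).mul h2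
  simp only [mul_one] at h3
  refine h3.congr' ?_ EventuallyEq.rfl
  filter_upwards [h1.eventually_ne one_ne_zero] with x hx
  have h4 := mul_neg_geom_sum (-(a.eval x.2 * invSum x)) (J + 1)
  rw [sub_neg_eq_add] at h4
  simp only [Polynomial.eval_neg, neg_mul]
  field_simp
  linear_combination h4

end HasExp

/-- Half-integer orders are allowed because the bound on an l-th difference is √τ^l. If X^j is
already split off, the quotient is O(√τ), so it vanishes at 0 and one more factor X splits off. -/
theorem X_pow_dvd_of_isBigO {p : Polynomial ℝ} {τ : ℕ → ℝ} (hτ0 : ∀ᶠ n in atTop, 0 < τ n)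
    (hτ : Tendsto τ atTop (nhds 0)) {s : ℕ}
    (h : (fun n => p.eval (τ n)) =O[atTop] fun n => √(τ n) ^ s) (j : ℕ) (hj : 2 * j ≤ s + 1) :
    Polynomial.X ^ j ∣ p := by
  induction j with
  | zero => simp
  | succ j ih =>
    obtain ⟨r, hr⟩ := ih (by omega)
    have hst : Tendsto (fun n => √(τ n)) atTop (nhds 0) := by
      have := (Real.continuous_sqrt.tendsto 0).comp hτ
      rwa [Real.sqrt_zero] at this
    have h1 : (fun n => r.eval (τ n)) =O[atTop] fun n => √(τ n) := by
      obtain ⟨C, hC⟩ := h.bound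
      refine IsBigO.of_bound C ?_
      filter_upwards [hC, hτ0, hst.eventually (gt_mem_nhds one_pos)] with n h2 h3 h4
      have h5 : 0 < √(τ n) := Real.sqrt_pos.mpr h3
      have e : τ n ^ j = √(τ n) ^ (2 * j) := by rw [pow_mul, Real.sq_sqrt h3.le]
      rw [hr, Polynomial.eval_mul, Polynomial.eval_pow, Polynomial.eval_X, norm_mul, norm_pow,
        Real.norm_of_nonneg h3.le, norm_pow, Real.norm_of_nonneg h5.le, e] at h2
      have hC0 : 0 ≤ C := by
        by_contra hneg
        have : C * √(τ n) ^ s < 0 := mul_neg_of_neg_of_pos (not_le.mp hneg) (by positivity)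
        have : 0 ≤ √(τ n) ^ (2 * j) * ‖r.eval (τ n)‖ := by positivity
        linarith
      rw [Real.norm_of_nonneg h5.le]
      refine le_of_mul_le_mul_left (h2.trans ?_) (pow_pos h5 (2 * j))
      calc C * √(τ n) ^ s ≤ C * √(τ n) ^ (2 * j + 1) :=
            mul_le_mul_of_nonneg_left (pow_le_pow_of_le_one h5.le h4.le (by omega)) hC0
        _ = _ := by ring
    have h2 : r.eval 0 = 0 := tendsto_nhds_unique (r.continuous.continuousAt.tendsto.comp hτ)
      (h1.trans_tendsto hst)
    have h3 : Polynomial.X ∣ r := by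
      rw [Polynomial.X_dvd_iff, Polynomial.coeff_zero_eq_eval_zero, h2]
    rw [hr, pow_succ]
    exact mul_dvd_mul_left _ h3

/-- For each fixed fractional part y the specialized coefficient vanishes, so the coefficient, a
polynomial in y, has infinitely many roots. This yields uniqueness of the expansions. -/
theorem coeff_eq_zero_of_isBigO {P : Polynomial (Polynomial ℝ)} {s : ℕ}
    (h : evalInv P =O[fractFilter] fun x => √(invSum x) ^ s) {j : ℕ} (hj : 2 * j < s) :
    P.coeff j = 0 := by
  refine Polynomial.eq_zero_of_infinite_isRoot _
    ((Set.Ico_infinite (zero_lt_one (α := ℝ))).mono fun y hy => ?_)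
  have ht : Tendsto (fun n : ℕ => (n, y)) atTop fractFilter :=
    tendsto_id.prodMk (tendsto_principal.mpr (Eventually.of_forall fun _ => hy))
  have h1 := X_pow_dvd_of_isBigO (p := P.map (Polynomial.evalRingHom y))
    (τ := fun n => invSum (n, y)) ?_ (tendsto_invSum.comp ht) (s := s) ?_ (j + 1) (by omega)
  · rw [Polynomial.X_pow_dvd_iff] at h1
    have := h1 j (by omega)
    rwa [Polynomial.coeff_map] at this
  · filter_upwards [ht.eventually eventually_invSum] with n hn using hn.1
  · refine (h.comp_tendsto ht).congr_left fun n => ?_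
    simp [evalInv, Polynomial.eval_map]

theorem isBigO_neg_log_one_sub (n : ℕ) :
    (fun x : ℕ × ℝ => -Real.log (1 - x.2 * invSum x) -
      ∑ k ∈ Finset.range n, (x.2 * invSum x) ^ (k + 1) * ((k : ℝ) + 1)⁻¹) =O[fractFilter]
      fun x => invSum x ^ (n + 1) := by
  refine IsBigO.of_bound 2 ?_
  filter_upwards [eventually_fractFilter 2, eventually_invSum] with x hx ht
  have hN : (2 : ℝ) ≤ x.1 := by exact_mod_cast hx.1
  have hy0 : 0 ≤ x.2 * invSum x := mul_nonneg hx.2.1 ht.1.le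
  have hy1 : x.2 * invSum x ≤ invSum x := mul_le_of_le_one_left ht.1.le hx.2.2.le
  have ht2 : invSum x ≤ 1 / 2 := by
    refine ht.2.2.1.trans ?_
    rw [one_div]
    gcongr
  have h1 := Real.abs_log_sub_add_sum_range_le (x := x.2 * invSum x)
    (by rw [abs_of_nonneg hy0]; linarith) n
  rw [abs_of_nonneg hy0] at h1
  rw [Real.norm_eq_abs, ← abs_neg, Real.norm_of_nonneg (pow_nonneg ht.1.le _)]
  have e : -(-Real.log (1 - x.2 * invSum x) -
      ∑ k ∈ Finset.range n, (x.2 * invSum x) ^ (k + 1) * ((k : ℝ) + 1)⁻¹) =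
      ∑ k ∈ Finset.range n, (x.2 * invSum x) ^ (k + 1) / ((k : ℝ) + 1) +
        Real.log (1 - x.2 * invSum x) := by
    simp only [div_eq_mul_inv]
    ring
  rw [e]
  refine h1.trans ?_
  rw [div_le_iff₀ (by linarith)]
  have h2 : (x.2 * invSum x) ^ (n + 1) ≤ invSum x ^ (n + 1) := by gcongr
  have h3 : 0 ≤ invSum x ^ (n + 1) := pow_nonneg ht.1.le _
  nlinarith

open Polynomial in
theorem hasExp_neg_log (J : ℕ) : HasExp J (fun x => -Real.log (1 - x.2 * invSum x))
    (∑ k ∈ Finset.range J, (C X * X) ^ (k + 1) * C (C (((k : ℝ) + 1)⁻¹))) := by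
  refine (HasExp.sum (Finset.range J) fun k _ => (((hasExp_eval_snd J X).mul
    (hasExp_invSum J)).pow (k + 1)).mul (hasExp_const J (((k : ℝ) + 1)⁻¹))).add_isBigO ?_
  simpa only [eval_X] using isBigO_neg_log_one_sub J

open Polynomial in
-- Dividing by t loses one order, so the logarithm is expanded one term further. The subtracted f
-- cancels the term k = 0, and the result is O(t).
theorem hasExp_neg_log_div (J : ℕ) :
    HasExp J (fun x => -Real.log (1 - x.2 * invSum x) * (invSum x)⁻¹ - x.2)
      (∑ k ∈ Finset.range (J + 1), C (X ^ (k + 1)) * X ^ k * C (C (((k : ℝ) + 1)⁻¹)) - C X) := by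
  refine ((HasExp.sum (Finset.range (J + 1)) fun k _ => ((hasExp_eval_snd J (X ^ (k + 1))).mul
    ((hasExp_invSum J).pow k)).mul (hasExp_const J (((k : ℝ) + 1)⁻¹))).sub
    (hasExp_eval_snd J X)).add_isBigO ?_
  have h := (isBigO_neg_log_one_sub (J + 1)).mul
    (isBigO_refl (fun x : ℕ × ℝ => (invSum x)⁻¹) fractFilter)
  refine h.congr' ?_ ?_
  · filter_upwards [eventually_invSum] with x hx
    simp only [eval_X, eval_pow]
    have e : ∑ k ∈ Finset.range (J + 1), (x.2 * invSum x) ^ (k + 1) * ((k : ℝ) + 1)⁻¹ =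
        (∑ k ∈ Finset.range (J + 1), x.2 ^ (k + 1) * invSum x ^ k * ((k : ℝ) + 1)⁻¹) *
          invSum x := by
      rw [Finset.sum_mul]
      exact Finset.sum_congr rfl fun k _ => by ring
    rw [e, sub_mul, mul_inv_cancel_right₀ hx.1.ne']
    ring
  · filter_upwards [eventually_invSum] with x hx
    rw [pow_succ, mul_inv_cancel_right₀ hx.1.ne']

theorem isBigO_inv_fst_pow (n : ℕ) :
    (fun x : ℕ × ℝ => ((x.1 : ℝ)⁻¹) ^ n) =O[fractFilter] fun x => invSum x ^ n := by
  refine IsBigO.pow (IsBigO.of_bound 2 ?_) n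
  filter_upwards [eventually_invSum] with x hx
  rw [Real.norm_of_nonneg hx.1.le, Real.norm_of_nonneg (by positivity)]
  exact hx.2.2.2

theorem inv_fst_eq {x : ℕ × ℝ} (h1 : 1 ≤ x.1) (h2 : 0 ≤ x.2) :
    ((x.1 : ℝ))⁻¹ = invSum x * (1 + (-Polynomial.X : Polynomial ℝ).eval x.2 * invSum x)⁻¹ := by
  have hN : (0 : ℝ) < x.1 := by exact_mod_cast h1
  have hu : (0 : ℝ) < x.1 + x.2 := by linarith
  have e : 1 + (-Polynomial.X : Polynomial ℝ).eval x.2 * invSum x = x.1 * invSum x := by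
    simp [invSum]
    field_simp
    ring
  rw [e, mul_inv, mul_left_comm, mul_inv_cancel₀ (by unfold invSum; positivity), mul_one]

theorem exists_hasExp_stirlingErr (J : ℕ) : ∃ P, HasExp J (fun x => stirlingErr x.1) P := by
  obtain ⟨S, -, -, hS⟩ := exists_stirling_series J
  obtain ⟨R, hR⟩ := ((hasExp_invSum J).mul
    (hasExp_inv_one_add J (-Polynomial.X))).eval S
  refine ⟨R, hR.add_isBigO ?_⟩
  refine IsBigO.congr' ((hS.comp_tendsto (tendsto_fst : Tendsto Prod.fst fractFilter atTop)).trans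
    (isBigO_inv_fst_pow (J + 1))) ?_ EventuallyEq.rfl
  filter_upwards [eventually_fractFilter 1] with x hx
  simp only [Function.comp]
  rw [inv_fst_eq hx.1 hx.2.1]

open Polynomial in
theorem hasExp_stirlingErr_one :
    HasExp 1 (fun x => stirlingErr x.1) (C (C (1 / 12)) * X) := by
  obtain ⟨S, h0, h1, hS⟩ := exists_stirling_series 1
  have hS' : ∀ y : ℝ, S.eval y = 1 / 12 * y + y ^ 2 * (S.divX.divX).eval y := fun y => by
    conv_lhs => rw [← divX_mul_X_add S, ← divX_mul_X_add S.divX]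
    simp only [eval_add, eval_mul, eval_C, eval_X, coeff_divX, h0, zero_add, h1 le_rfl]
    ring
  refine ((hasExp_const 1 (1 / 12)).mul (hasExp_invSum 1)).add_isBigO ?_
  have e1 := (hS.comp_tendsto (tendsto_fst : Tendsto Prod.fst fractFilter atTop)).trans
    (isBigO_inv_fst_pow 2)
  have hinv : Tendsto (fun x : ℕ × ℝ => ((x.1 : ℝ))⁻¹) fractFilter (nhds 0) :=
    tendsto_inv_atTop_nhds_zero_nat.comp tendsto_fst
  have e2 := (isBigO_inv_fst_pow 2).mul
    (((S.divX.divX).continuous.continuousAt.tendsto.comp hinv).isBigO_one ℝ)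
  simp only [mul_one] at e2
  have e3 : (fun x : ℕ × ℝ => 1 / 12 * (((x.1 : ℝ))⁻¹ - invSum x)) =O[fractFilter]
      fun x => invSum x ^ 2 := by
    refine IsBigO.const_mul_left (IsBigO.of_bound 2 ?_) _
    filter_upwards [eventually_fractFilter 1, eventually_invSum] with x hx ht
    have hN : (0 : ℝ) < x.1 := by exact_mod_cast hx.1
    have hu : (0 : ℝ) < x.1 + x.2 := by linarith [hx.2.1]
    have e : ((x.1 : ℝ))⁻¹ - invSum x = x.2 * (((x.1 : ℝ))⁻¹ * invSum x) := by
      rw [invSum]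
      field_simp
      ring
    rw [e, Real.norm_of_nonneg (mul_nonneg hx.2.1 (mul_nonneg (by positivity) ht.1.le)),
      Real.norm_of_nonneg (by positivity)]
    calc x.2 * (((x.1 : ℝ))⁻¹ * invSum x) ≤ 1 * ((2 * invSum x) * invSum x) := by
          refine mul_le_mul hx.2.2.le ?_ (mul_nonneg (by positivity) ht.1.le) zero_le_one
          exact mul_le_mul_of_nonneg_right ht.2.2.2 ht.1.le
      _ = _ := by ring
  refine ((e1.add e2).add e3).congr_left fun x => ?_
  simp only [Function.comp]
  rw [hS']
  ring

/-! ### Expansion of the Poisson weights and their differences -/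

/-- The normalized Poisson weight `√(2πu) e^{-u} u^N / N!`, `u = N + f`. -/
noncomputable def poissonNorm (x : ℕ × ℝ) : ℝ :=
  √(2 * Real.pi * (x.1 + x.2)) * poissonWeight x.1 (x.1 + x.2)

/-- The logarithm of `poissonNorm`. -/
noncomputable def logPoissonNorm (x : ℕ × ℝ) : ℝ :=
  -Real.log (1 - x.2 * invSum x) * (invSum x)⁻¹ - x.2 +
    (1 / 2 - x.2) * -Real.log (1 - x.2 * invSum x) - stirlingErr x.1

/-- With t = 1/u and L = log(u/N) = -log(1 - ft), Stirling's formula gives the logarithm as (N +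
1/2)L - f minus the Stirling error, and N = 1/t - f. -/
theorem poissonNorm_eq_exp {x : ℕ × ℝ} (h1 : 1 ≤ x.1) (h2 : 0 ≤ x.2) :
    poissonNorm x = Real.exp (logPoissonNorm x) := by
  have hN : (0 : ℝ) < x.1 := by exact_mod_cast h1
  have hu : (0 : ℝ) < x.1 + x.2 := by linarith
  have hf : (0 : ℝ) < x.1.factorial := by exact_mod_cast x.1.factorial_pos
  have hpos : 0 < poissonNorm x := by unfold poissonNorm poissonWeight; positivity
  rw [← Real.exp_log hpos]
  congr 1
  have e1 : 1 - x.2 * invSum x = x.1 / (x.1 + x.2) := by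
    rw [invSum]; field_simp; ring
  have e2 : (invSum x)⁻¹ = x.1 + x.2 := by rw [invSum, inv_inv]
  rw [logPoissonNorm, e1, e2, stirlingErr, Stirling.log_stirlingSeq_formula, poissonNorm,
    poissonWeight, Real.log_mul (by positivity) (by positivity),
    Real.log_mul (by positivity) (by positivity), Real.log_div (by positivity) (by positivity),
    Real.log_exp, Real.log_pow, Real.log_sqrt (by positivity), Real.log_sqrt (by positivity),
    Real.log_mul (by positivity) (by positivity), Real.log_mul (by positivity) (by positivity),
    Real.log_mul (by positivity) (by positivity), Real.log_div (by positivity) (by positivity),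
    Real.log_div (by positivity) (by positivity), Real.log_exp]
  ring

open Polynomial in
theorem hasExp_logPoissonNorm {J : ℕ} {P : ℝ[X][X]} (hP : HasExp J (fun x => stirlingErr x.1) P) :
    HasExp J logPoissonNorm
      (∑ k ∈ Finset.range (J + 1), C (X ^ (k + 1)) * X ^ k * C (C (((k : ℝ) + 1)⁻¹)) - C X +
      C (C (1 / 2) - X) *
        (∑ k ∈ Finset.range J, (C X * X) ^ (k + 1) * C (C (((k : ℝ) + 1)⁻¹))) - P) := by
  refine ((((hasExp_neg_log_div J).add ((hasExp_eval_snd J (C (1 / 2) - X)).mul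
    (hasExp_neg_log J))).sub hP)).congr' (Eventually.of_forall fun x => ?_)
  simp [logPoissonNorm]

open Polynomial in
theorem C_C_two : (C (C 2) : ℝ[X][X]) = 2 := by rw [map_ofNat, map_ofNat]

open Polynomial in
-- At order t the three parts contribute f²/2, (1/2 - f)f and -1/12.
theorem hasExp_logPoissonNorm_one :
    HasExp 1 logPoissonNorm (C (C (1 / 2) * (X - X ^ 2) - C (1 / 12)) * X) := by
  refine (hasExp_logPoissonNorm hasExp_stirlingErr_one).congr_poly (S := 0) ?_
  simp only [Finset.sum_range_succ, Finset.sum_range_zero, zero_add, map_sub, map_mul, map_pow,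
    map_one, Nat.cast_zero, Nat.cast_one, inv_one]
  have : (C (C ((1 + 1 : ℝ)⁻¹)) : ℝ[X][X]) = C (C (1 / 2)) := by norm_num
  rw [this]
  have h2 : (C (C (1 / 2)) : ℝ[X][X]) * 2 = 1 := by
    rw [← C_C_two, ← map_mul, ← map_mul]
    norm_num
  linear_combination ((C X : ℝ[X][X]) ^ 2 * X) * h2

theorem isBigO_logPoissonNorm : logPoissonNorm =O[fractFilter] invSum := by
  have h1 := IsBigO.trans hasExp_logPoissonNorm_one (isBigO_invSum_pow_of_le (m := 1) (by norm_num))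
  have h2 := isBigO_eval_mul_invSum
    (Polynomial.C (1 / 2) * (Polynomial.X - Polynomial.X ^ 2) - Polynomial.C (1 / 12))
  simp only [pow_one] at h1
  refine (h1.add h2).congr_left fun x => ?_
  rw [evalInv_mul, evalInv_C, evalInv_X]
  ring

theorem poissonNorm_eventuallyEq :
    (fun x => Real.exp (logPoissonNorm x)) =ᶠ[fractFilter] poissonNorm := by
  filter_upwards [eventually_fractFilter 1] with x hx
  exact (poissonNorm_eq_exp hx.1 hx.2.1).symm

/-- The ratio of the Poisson weights of indices `N + m` and `N`. -/
noncomputable def weightRatio (m : ℕ) (x : ℕ × ℝ) : ℝ :=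
  ∏ s ∈ Finset.range m,
    (1 + (Polynomial.C ((s : ℝ) + 1) - Polynomial.X : Polynomial ℝ).eval x.2 * invSum x)⁻¹

theorem poissonWeight_add (m : ℕ) {x : ℕ × ℝ} (h1 : 1 ≤ x.1) (h2 : 0 ≤ x.2) :
    √(2 * Real.pi * (x.1 + x.2)) * poissonWeight (x.1 + m) (x.1 + x.2) =
      poissonNorm x * weightRatio m x := by
  have hN : (0 : ℝ) < x.1 := by exact_mod_cast h1
  have hu : (0 : ℝ) < x.1 + x.2 := by linarith
  induction m with
  | zero => simp [weightRatio, poissonNorm]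
  | succ m ih =>
    have e : 1 + (Polynomial.C ((m : ℝ) + 1) - Polynomial.X : Polynomial ℝ).eval x.2 * invSum x =
        (x.1 + m + 1) / (x.1 + x.2) := by
      simp only [Polynomial.eval_sub, Polynomial.eval_C, Polynomial.eval_X, invSum]
      field_simp
      ring
    rw [weightRatio, Finset.prod_range_succ, e, ← weightRatio, ← mul_assoc, ← ih, poissonWeight,
      poissonWeight, ← add_assoc, Nat.factorial_succ]
    push_cast
    field_simp
    ring

open Polynomial in
theorem exists_hasExp_weightRatio (J m : ℕ) : ∃ P, HasExp J (weightRatio m) P := by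
  induction m with
  | zero => exact ⟨_, (hasExp_const J 1).congr' (Eventually.of_forall fun x => by simp [weightRatio])⟩
  | succ m ih =>
    obtain ⟨P, hP⟩ := ih
    exact ⟨_, (hP.mul (hasExp_inv_one_add J (C ((m : ℝ) + 1) - X))).congr'
      (Eventually.of_forall fun x => by
        simp only [weightRatio, Finset.prod_range_succ])⟩

/-- The normalized difference of the Poisson weights. -/
noncomputable def diffNorm (l : ℕ) (x : ℕ × ℝ) : ℝ :=
  √(2 * Real.pi * (x.1 + x.2)) * poissonDiff l x.1 (x.1 + x.2)

theorem diffNorm_eventuallyEq (l : ℕ) :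
    (fun x => ∑ m ∈ Finset.range (l + 1), ((-1) ^ (l - m) * (l.choose m : ℝ)) *
      (poissonNorm x * weightRatio m x)) =ᶠ[fractFilter] diffNorm l := by
  filter_upwards [eventually_fractFilter 1] with x hx
  rw [diffNorm, poissonDiff, Finset.mul_sum]
  refine Finset.sum_congr rfl fun m _ => ?_
  rw [← poissonWeight_add m hx.1 hx.2.1]
  ring

theorem exists_hasExp_diffNorm (l J : ℕ) : ∃ P, HasExp J (diffNorm l) P := by
  obtain ⟨P, hP⟩ := exists_hasExp_stirlingErr J
  have hE := ((hasExp_logPoissonNorm hP).exp isBigO_logPoissonNorm).congr' poissonNorm_eventuallyEq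
  choose R hR using exists_hasExp_weightRatio J
  exact ⟨_, (HasExp.sum (Finset.range (l + 1)) fun m _ =>
    (hasExp_const J ((-1) ^ (l - m) * (l.choose m : ℝ))).mul (hE.mul (hR m))).congr'
      (diffNorm_eventuallyEq l)⟩

open Polynomial in
theorem HasExp.mul_linear {h g : ℕ × ℝ → ℝ} {a b a' b' : ℝ[X]}
    (H : HasExp 1 h (C a + C b * X)) (G : HasExp 1 g (C a' + C b' * X)) :
    HasExp 1 (fun x => h x * g x) (C (a * a') + C (a * b' + b * a') * X) := by
  refine (H.mul G).congr_poly (S := C b * C b') ?_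
  simp only [map_add, map_mul]
  ring

/-- The linear coefficient of `poissonNorm`. -/
noncomputable def normCoeff : Polynomial ℝ :=
  Polynomial.C (1 / 2) * (Polynomial.X - Polynomial.X ^ 2) - Polynomial.C (1 / 12)

open Polynomial in
theorem hasExp_poissonNorm_one : HasExp 1 poissonNorm (C 1 + C normCoeff * X) := by
  refine ((hasExp_logPoissonNorm_one.exp isBigO_logPoissonNorm).congr'
    poissonNorm_eventuallyEq).congr_poly (S := 0) ?_
  simp [Finset.sum_range_succ, normCoeff]

open Polynomial in
theorem hasExp_inv_one_add_one (a : ℝ[X]) :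
    HasExp 1 (fun x => (1 + a.eval x.2 * invSum x)⁻¹) (C 1 + C (-a) * X) := by
  refine (hasExp_inv_one_add 1 a).congr_poly (S := 0) ?_
  simp [Finset.sum_range_succ]

open Polynomial in
theorem hasExp_diffNorm_zero : HasExp 1 (diffNorm 0) (C 1 + C normCoeff * X) := by
  refine hasExp_poissonNorm_one.congr' (EventuallyEq.trans ?_ (diffNorm_eventuallyEq 0))
  exact Eventually.of_forall fun x => by simp [weightRatio]

open Polynomial in
theorem hasExp_diffNorm_one : HasExp 1 (diffNorm 1) (C (X - 1) * X) := by
  have h0 := hasExp_poissonNorm_one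
  have h1 := h0.mul_linear (hasExp_inv_one_add_one (C (((0 : ℕ) : ℝ) + 1) - X))
  refine ((h1.sub h0).congr' (EventuallyEq.trans ?_ (diffNorm_eventuallyEq 1))).congr_poly (S := 0) ?_
  · exact Eventually.of_forall fun x => by simp [weightRatio, Finset.sum_range_succ]; ring
  · simp
    ring

open Polynomial in
theorem hasExp_diffNorm_two : HasExp 1 (diffNorm 2) (C (-1) * X) := by
  have h0 := hasExp_poissonNorm_one
  have h1 := h0.mul_linear (hasExp_inv_one_add_one (C (((0 : ℕ) : ℝ) + 1) - X))
  have h2 := h1.mul_linear (hasExp_inv_one_add_one (C (((1 : ℕ) : ℝ) + 1) - X))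
  refine (((h2.sub ((hasExp_const 1 2).mul h1)).add h0).congr'
    (EventuallyEq.trans ?_ (diffNorm_eventuallyEq 2))).congr_poly (S := 0) ?_
  · exact Eventually.of_forall fun x => by
      simp [weightRatio, Finset.sum_range_succ, Finset.prod_range_succ]; ring
  · simp [C_C_two]
    ring

/-- The normalization √(2πu) uses up one of the l + 1 half powers gained by the l-th difference. -/
theorem isBigO_diffNorm (l : ℕ) : diffNorm l =O[fractFilter] fun x => √(invSum x) ^ l := by
  refine IsBigO.of_bound (√(2 * Real.pi) * √(4 * (l + 1)) ^ (l + 1)) ?_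
  filter_upwards [eventually_fractFilter (2 * (l + 1)), eventually_invSum] with x hx ht
  have hN : (0 : ℝ) < x.1 := by exact_mod_cast (by omega : 0 < x.1)
  have hu : (0 : ℝ) < x.1 + x.2 := by linarith [hx.2.1]
  have h1 := abs_poissonDiff_le_sqrt l hx.1 hu
  set s := √(invSum x) with hs
  have hs0 : 0 < s := Real.sqrt_pos.mpr ht.1
  have h2 : √(2 * (l + 1) / (x.1 : ℝ)) ≤ √(4 * (l + 1)) * s := by
    rw [hs, ← Real.sqrt_mul (by positivity)]
    refine Real.sqrt_le_sqrt ?_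
    rw [div_eq_mul_inv]
    have : (0 : ℝ) ≤ l + 1 := by positivity
    nlinarith [ht.2.2.2]
  have h3 : √(2 * Real.pi * (x.1 + x.2)) = √(2 * Real.pi) * s⁻¹ := by
    rw [Real.sqrt_mul (by positivity), hs, invSum, Real.sqrt_inv, inv_inv]
  rw [Real.norm_of_nonneg (pow_nonneg hs0.le _), diffNorm, norm_mul, Real.norm_eq_abs,
    Real.norm_eq_abs, abs_of_nonneg (Real.sqrt_nonneg _), h3]
  calc _ ≤ √(2 * Real.pi) * s⁻¹ * (√(4 * (l + 1)) * s) ^ (l + 1) := by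
        gcongr
        exact h1.trans (by gcongr)
    _ = _ := by
        rw [mul_pow, pow_succ s]
        field_simp

open Polynomial in
/-- The expansion of the normalized differences in powers of `1 / u`. -/
theorem exists_diffNorm_expansion : ∃ c : ℕ → ℕ → ℝ[X],
    (∀ l J, (fun x => diffNorm l x - ∑ j ∈ Finset.range (J + 1), (c l j).eval x.2 * invSum x ^ j)
      =O[fractFilter] fun x => invSum x ^ (J + 1)) ∧
    (∀ l j, 2 * j < l → c l j = 0) ∧ c 0 0 = 1 ∧ c 0 1 = normCoeff ∧ c 1 1 = X - 1 ∧
    c 2 1 = -1 := by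
  choose P hP using exists_hasExp_diffNorm
  have hsq : ∀ n, (fun x => invSum x ^ n) =O[fractFilter] fun x => √(invSum x) ^ (2 * n) := by
    intro n
    refine IsBigO.of_bound 1 ?_
    filter_upwards [eventually_invSum] with x hx
    rw [pow_mul, Real.sq_sqrt hx.1.le, one_mul]
  -- Uniqueness makes the j-th coefficient independent of the truncation order, so it may be defined
  -- from the expansion of order j.
  have huniq : ∀ (l J j : ℕ) (R : ℝ[X][X]), j ≤ J → HasExp J (diffNorm l) R →
      R.coeff j = (P l j).coeff j := by
    intro l J j R hj hR
    have h1 := IsBigO.sub (hP l j)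
      (IsBigO.trans hR (isBigO_invSum_pow_of_le (by omega : j + 1 ≤ J + 1)))
    have h2 : evalInv (R - P l j) =O[fractFilter] fun x => √(invSum x) ^ (2 * (j + 1)) :=
      (h1.trans (hsq (j + 1))).congr_left fun x => by rw [evalInv_sub]; ring
    have h3 := coeff_eq_zero_of_isBigO h2 (j := j) (by omega)
    rw [coeff_sub] at h3
    exact sub_eq_zero.mp h3
  have hval : ∀ l j a b, j ≤ 1 → HasExp 1 (diffNorm l) (C a + C b * X) →
      (P l j).coeff j = if j = 0 then a else b := by
    intro l j a b hj h
    rw [← huniq l 1 j _ hj h]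
    interval_cases j <;> simp
  refine ⟨fun l j => (P l j).coeff j, fun l J => ?_, fun l j hlj => ?_, ?_, ?_, ?_, ?_⟩
  · have e : P l J = ∑ j ∈ Finset.range (J + 1), C ((P l j).coeff j) * X ^ j +
        X ^ (J + 1) * (divX^[J + 1] (P l J)) := by
      have h1 : ∀ n : ℕ, P l J = ∑ j ∈ Finset.range n, C ((P l J).coeff j) * X ^ j +
          X ^ n * (divX^[n] (P l J)) := by
        intro n
        induction n with
        | zero => simp
        | succ n ih =>
          have hc : (divX^[n] (P l J)).coeff 0 = (P l J).coeff n := by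
            have : ∀ (n k : ℕ) (p : ℝ[X][X]), (divX^[n] p).coeff k = p.coeff (k + n) := by
              intro n
              induction n with
              | zero => simp
              | succ n ih =>
                intro k p
                rw [Function.iterate_succ_apply, ih, coeff_divX]
                congr 1
            rw [this, zero_add]
          conv_lhs => rw [ih, ← divX_mul_X_add (divX^[n] (P l J)), hc]
          rw [Finset.sum_range_succ, Function.iterate_succ_apply']
          ring
      conv_lhs => rw [h1 (J + 1)]
      congr 1
      refine Finset.sum_congr rfl fun j hj => ?_
      rw [huniq l J j _ (by rw [Finset.mem_range] at hj; omega) (hP l J)]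
    refine IsBigO.congr_left ((hP l J).congr_poly e) fun x => ?_
    simp only [evalInv_sum, evalInv_mul, evalInv_C, evalInv_pow, evalInv_X]
  -- For 2j < l both the difference itself and the error of its order-j expansion are O(√t^(2j+1)),
  -- hence so is the expansion polynomial.
  · refine coeff_eq_zero_of_isBigO (s := 2 * j + 1) ?_ (by omega)
    have hle : ∀ m, 2 * j + 1 ≤ m →
        (fun x => √(invSum x) ^ m) =O[fractFilter] fun x => √(invSum x) ^ (2 * j + 1) := by
      intro m hm
      refine IsBigO.of_bound 1 ?_
      filter_upwards [eventually_invSum] with x hx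
      rw [Real.norm_of_nonneg (by positivity), Real.norm_of_nonneg (by positivity), one_mul]
      exact pow_le_pow_of_le_one (Real.sqrt_nonneg _) (Real.sqrt_le_one.mpr hx.2.1) hm
    refine (((isBigO_diffNorm l).trans (hle l (by omega))).sub
      ((IsBigO.trans (hP l j) (hsq (j + 1))).trans (hle _ (by omega)))).congr_left fun x => ?_
    ring
  · exact hval 0 0 _ _ (by norm_num) hasExp_diffNorm_zero
  · exact hval 0 1 _ _ (by norm_num) hasExp_diffNorm_zero
  · exact hval 1 1 0 _ (by norm_num) (by simpa using hasExp_diffNorm_one)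
  · exact hval 2 1 0 (-1) (by norm_num) (by simpa using hasExp_diffNorm_two)

/-! ### The coefficients φ_j and the normalized generating function -/

theorem rpow_neg_mem_Icc {q κ f : ℝ} (hq0 : 0 < q) (hq1 : q < 1) (hκ : κ = 1 / q) (hf0 : 0 ≤ f)
    (hf1 : f ≤ 1) : 1 ≤ q ^ (-f) ∧ q ^ (-f) ≤ κ := by
  constructor
  · exact Real.one_le_rpow_of_pos_of_le_one_of_nonpos hq0 hq1.le (by linarith)
  · rw [hκ, one_div, ← Real.rpow_neg_one]
    exact Real.rpow_le_rpow_of_exponent_ge hq0 hq1.le (by linarith)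

/-- The ratios `Q^l F^{(l)}(Q) / (l! F(Q))` at `Q = q^{-f}`. -/
noncomputable def thetaRatio (q f : ℝ) (l : ℕ) : ℝ :=
  thetaTaylor q (q ^ (-f)) l / thetaF q (q ^ (-f))

theorem thetaRatio_zero {q : ℝ} (hq0 : 0 < q) (hq1 : q < 1) (f : ℝ) : thetaRatio q f 0 = 1 := by
  have hQ : 0 < q ^ (-f) := by positivity
  rw [thetaRatio, thetaTaylor_zero hq0 hq1 hQ, div_self (thetaF_pos hq0 hq1 hQ).ne']

theorem thetaRatio_eq {q : ℝ} (hq0 : 0 < q) (hq1 : q < 1) (f : ℝ) (l : ℕ) :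
    thetaRatio q f l = (l.factorial : ℝ)⁻¹ *
      ((q ^ (-f)) ^ l * iteratedDeriv l (thetaF q) (q ^ (-f)) / thetaF q (q ^ (-f))) := by
  rw [pow_mul_iteratedDeriv_thetaF hq0 hq1 (by positivity), thetaRatio, mul_div_assoc,
    inv_mul_cancel_left₀ (Nat.cast_ne_zero.mpr l.factorial_ne_zero)]

theorem exists_abs_thetaRatio_le {q : ℝ} (hq0 : 0 < q) (hq1 : q < 1) (l : ℕ) :
    ∃ C : ℝ, ∀ f, 0 ≤ f → f ≤ 1 → |thetaRatio q f l| ≤ C := by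
  have hκ1 : 1 ≤ 1 / q := by rw [le_div_iff₀ hq0]; linarith
  obtain ⟨S, hS0, hS⟩ := exists_tsum_thetaWeight_le hq0 hq1 hκ1
  refine ⟨S * (2 * 2 ^ l) * 2, fun f hf0 hf1 => ?_⟩
  obtain ⟨h1, h2⟩ := rpow_neg_mem_Icc hq0 hq1 rfl hf0 hf1
  have hQ : 0 < q ^ (-f) := by positivity
  have h3 := half_le_thetaF hq0 hq1 h1
  have h4 := abs_thetaTaylor_le hq0 hq1 hQ l
  have h5 := (hS _ ((inv_le_one_of_one_le₀ hκ1).trans h1) h2).2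
  rw [thetaRatio, abs_div, abs_of_pos (a := thetaF q _) (by linarith), div_eq_mul_inv]
  have h6 : (thetaF q (q ^ (-f)))⁻¹ ≤ 2 := inv_le_of_inv_le₀ (by norm_num) (by linarith)
  have h7 : 0 ≤ (thetaF q (q ^ (-f)))⁻¹ := inv_nonneg.mpr (by linarith)
  gcongr
  exact h4.trans (by gcongr)

/-- The ratio of the Poisson generating function to the saddle-point prefactor. -/
noncomputable def saddleRatio (p q : ℝ) (x : ℕ × ℝ) : ℝ :=
  √(2 * Real.pi * (x.1 + x.2)) * (poissonGF p (q ^ (-x.2) * q ^ (-(x.1 : ℤ)) * (x.1 + x.2)) *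
    Real.exp (-(x.1 + x.2)) / shiftPref q (q ^ (-x.2)) x.1) / thetaF q (q ^ (-x.2))

/-- With 2J + 2 Taylor terms the error is O(N^{-(2J+3)/2}); after multiplication by √(2πu) this is
O(u^{-J-1}). Division by F is safe because F ≥ 1/2 on [1, 1/q]. -/
theorem saddleRatio_sub_isBigO {p q : ℝ} (hp0 : 0 < p) (hp1 : p < 1) (hq : q = 1 - p) (J : ℕ) :
    (fun x => saddleRatio p q x - ∑ l ∈ Finset.range (2 * J + 2), thetaRatio q x.2 l * diffNorm l x)
      =O[fractFilter] fun x => invSum x ^ (J + 1) := by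
  have hq0 : 0 < q := by linarith
  have hq1 : q < 1 := by linarith
  have hκ1 : 1 ≤ 1 / q := by rw [le_div_iff₀ hq0]; linarith
  obtain ⟨C, hC0, hC⟩ := exists_abs_poissonGF_sub_le hp0 hp1 hq hκ1 (2 * J + 2)
  refine IsBigO.of_bound (√(2 * Real.pi) * (C * √2 ^ (2 * J + 3)) * 2) ?_
  filter_upwards [eventually_fractFilter (4 * (2 * J + 2 + 1)), eventually_invSum] with x hx ht
  have hN : (0 : ℝ) < x.1 := by exact_mod_cast (by omega : 0 < x.1)
  have hu : (0 : ℝ) < x.1 + x.2 := by linarith [hx.2.1]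
  obtain ⟨h1, h2⟩ := rpow_neg_mem_Icc hq0 hq1 rfl hx.2.1 hx.2.2.le
  have h3 := half_le_thetaF hq0 hq1 h1
  have h4 := hC x.1 (q ^ (-x.2)) (x.1 + x.2) hx.1 ((inv_le_one_of_one_le₀ hκ1).trans h1) h2 hu
  set F := thetaF q (q ^ (-x.2)) with hF
  set s := √(invSum x) with hs
  have hs0 : 0 < s := Real.sqrt_pos.mpr ht.1
  have e1 : √(2 * Real.pi * (x.1 + x.2)) = √(2 * Real.pi) * s⁻¹ := by
    rw [Real.sqrt_mul (by positivity), hs, invSum, Real.sqrt_inv, inv_inv]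
  have e2 : √((x.1 : ℝ)⁻¹) ≤ √2 * s := by
    rw [hs, ← Real.sqrt_mul (by norm_num)]
    exact Real.sqrt_le_sqrt ht.2.2.2
  have e3 : saddleRatio p q x -
      ∑ l ∈ Finset.range (2 * J + 2), thetaRatio q x.2 l * diffNorm l x =
      √(2 * Real.pi * (x.1 + x.2)) *
      (poissonGF p (q ^ (-x.2) * q ^ (-(x.1 : ℤ)) * (x.1 + x.2)) *
        Real.exp (-(x.1 + x.2)) / shiftPref q (q ^ (-x.2)) x.1 -
        ∑ l ∈ Finset.range (2 * J + 2), thetaTaylor q (q ^ (-x.2)) l *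
          poissonDiff l x.1 (x.1 + x.2)) * F⁻¹ := by
    rw [mul_sub, sub_mul, saddleRatio, div_eq_mul_inv _ F, Finset.mul_sum, Finset.sum_mul]
    congr 1
    refine Finset.sum_congr rfl fun l _ => ?_
    rw [thetaRatio, diffNorm, ← hF]
    ring
  have h6 : F⁻¹ ≤ 2 := inv_le_of_inv_le₀ (by norm_num) (by linarith)
  have h7 : 0 ≤ F⁻¹ := inv_nonneg.mpr (by linarith)
  have e4 : invSum x ^ (J + 1) = s ^ (2 * J + 2) := by
    rw [show 2 * J + 2 = 2 * (J + 1) by ring, pow_mul, hs, Real.sq_sqrt ht.1.le]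
  rw [e3, norm_mul, norm_mul, Real.norm_of_nonneg (Real.sqrt_nonneg _), Real.norm_of_nonneg h7,
    Real.norm_eq_abs, Real.norm_of_nonneg (pow_nonneg ht.1.le _), e1, e4]
  calc _ ≤ √(2 * Real.pi) * s⁻¹ * (C * (√2 * s) ^ (2 * J + 2 + 1)) * 2 := by
        gcongr
        exact h4.trans (by gcongr)
    _ = _ := by
        rw [mul_pow, pow_succ s]
        field_simp

section Expansion

variable (q : ℝ) (c : ℕ → ℕ → Polynomial ℝ)

/-- The periodic coefficients of the expansion. -/
noncomputable def saddleCoeff (j : ℕ) (u : ℝ) : ℝ :=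
  ∑ l ∈ Finset.range (2 * j + 1), (c l j).eval (Int.fract u) * thetaRatio q (Int.fract u) l

theorem saddleCoeff_periodic (j : ℕ) : Function.Periodic (saddleCoeff q c j) 1 := fun u => by
  simp only [saddleCoeff, Int.fract_add_one]

variable {q}

theorem saddleCoeff_bounded (hq0 : 0 < q) (hq1 : q < 1) (j : ℕ) :
    ∃ C : ℝ, ∀ u : ℝ, |saddleCoeff q c j u| ≤ C := by
  have h : ∀ l, ∃ C : ℝ, ∀ f, 0 ≤ f → f ≤ 1 → |(c l j).eval f * thetaRatio q f l| ≤ C := fun l => by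
    obtain ⟨C₁, h₁⟩ := exists_abs_thetaRatio_le hq0 hq1 l
    obtain ⟨C₂, h₂⟩ := (isCompact_Icc (a := (0 : ℝ)) (b := 1)).exists_bound_of_continuousOn
      (f := fun y => (c l j).eval y) (c l j).continuous.continuousOn
    refine ⟨C₂ * C₁, fun f h0 h1 => ?_⟩
    rw [abs_mul]
    exact mul_le_mul (h₂ f ⟨h0, h1⟩) (h₁ f h0 h1) (abs_nonneg _)
      ((abs_nonneg _).trans (h₂ f ⟨h0, h1⟩))
  choose C hC using h
  refine ⟨∑ l ∈ Finset.range (2 * j + 1), C l, fun u => ?_⟩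
  exact (Finset.abs_sum_le_sum_abs _ _).trans (Finset.sum_le_sum fun l _ =>
    hC l _ (Int.fract_nonneg u) (Int.fract_lt_one u).le)

theorem saddleCoeff_mvPolynomial (hq0 : 0 < q) (hq1 : q < 1) (j : ℕ) :
    ∃ P : MvPolynomial (Fin (2 * j + 1)) ℝ, ∀ u : ℝ, saddleCoeff q c j u = MvPolynomial.eval
      (fun k : Fin (2 * j + 1) =>
        if (k : ℕ) = 0 then Int.fract u
        else (q ^ (-Int.fract u)) ^ (k : ℕ) *
          iteratedDeriv (k : ℕ) (thetaF q) (q ^ (-Int.fract u)) /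
            thetaF q (q ^ (-Int.fract u))) P := by
  -- Variable 0 stands for {u}; the ratio with l = 0 is identically 1, so it needs no variable of
  -- its own.
  refine ⟨∑ l : Fin (2 * j + 1), (c l j).eval₂ MvPolynomial.C (MvPolynomial.X 0) *
    (if (l : ℕ) = 0 then 1 else MvPolynomial.C (((l : ℕ).factorial : ℝ)⁻¹) * MvPolynomial.X l),
    fun u => ?_⟩
  rw [saddleCoeff, Finset.sum_range, map_sum]
  refine Finset.sum_congr rfl fun l _ => ?_
  rw [map_mul, Polynomial.hom_eval₂]
  congr 1
  · have : (MvPolynomial.eval fun k : Fin (2 * j + 1) =>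
        if (k : ℕ) = 0 then Int.fract u
        else (q ^ (-Int.fract u)) ^ (k : ℕ) *
          iteratedDeriv (k : ℕ) (thetaF q) (q ^ (-Int.fract u)) /
            thetaF q (q ^ (-Int.fract u))).comp MvPolynomial.C = RingHom.id ℝ := by
      ext y; simp
    rw [this, MvPolynomial.eval_X, Polynomial.eval₂_id]
    rfl
  · split_ifs with h
    · rw [h, thetaRatio_zero hq0 hq1, map_one]
    · rw [thetaRatio_eq hq0 hq1, map_mul, MvPolynomial.eval_C, MvPolynomial.eval_X, if_neg h]

/-- Each difference is replaced by its expansion and the sums are exchanged. Vanishing of the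
coefficients for l > 2j cuts the sum over l down to the one defining `saddleCoeff`. -/
theorem saddleRatio_expansion {p : ℝ} (hp0 : 0 < p) (hp1 : p < 1) (hq : q = 1 - p)
    (hc : ∀ l J, (fun x => diffNorm l x -
        ∑ j ∈ Finset.range (J + 1), (c l j).eval x.2 * invSum x ^ j)
      =O[fractFilter] fun x => invSum x ^ (J + 1))
    (hc0 : ∀ l j, 2 * j < l → c l j = 0) (J : ℕ) :
    (fun x => saddleRatio p q x -
      ∑ j ∈ Finset.range (J + 1), saddleCoeff q c j x.2 * invSum x ^ j)
      =O[fractFilter] fun x => invSum x ^ (J + 1) := by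
  have hq0 : 0 < q := by linarith
  have hq1 : q < 1 := by linarith
  have hW : ∀ l, (fun x : ℕ × ℝ => thetaRatio q x.2 l) =O[fractFilter] fun _ => (1 : ℝ) := fun l => by
    obtain ⟨C, hC⟩ := exists_abs_thetaRatio_le hq0 hq1 l
    refine IsBigO.of_bound C ?_
    filter_upwards [eventually_fractFilter 0] with x hx
    rw [norm_one, mul_one]
    exact hC _ hx.2.1 hx.2.2.le
  have h1 := IsBigO.fun_sum (s := Finset.range (2 * J + 2)) fun l _ => (hW l).mul (hc l J)
  simp only [one_mul] at h1
  refine ((saddleRatio_sub_isBigO hp0 hp1 hq J).add h1).congr' ?_ EventuallyEq.rfl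
  filter_upwards [eventually_fractFilter 0] with x hx
  have hfr : Int.fract x.2 = x.2 := Int.fract_eq_self.mpr hx.2
  have e : ∑ j ∈ Finset.range (J + 1), saddleCoeff q c j x.2 * invSum x ^ j =
      ∑ l ∈ Finset.range (2 * J + 2), thetaRatio q x.2 l *
        ∑ j ∈ Finset.range (J + 1), (c l j).eval x.2 * invSum x ^ j := by
    simp only [Finset.mul_sum]
    rw [Finset.sum_comm]
    refine Finset.sum_congr rfl fun j hj => ?_
    rw [Finset.mem_range] at hj
    rw [saddleCoeff, hfr, Finset.sum_mul]
    refine (Finset.sum_subset (Finset.range_subset_range.mpr (by omega)) fun l _ hl => ?_).trans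
      (Finset.sum_congr rfl fun l _ => by ring)
    rw [hc0 l j (by rw [Finset.mem_range] at hl; omega)]
    simp
  rw [e]
  simp only [mul_sub, Finset.sum_sub_distrib]
  ring

end Expansion

/-! ### The saddle-point equation and the full expansion -/

section Saddle

variable {q κ : ℝ}

theorem log_kappa_pos (hq0 : 0 < q) (hq1 : q < 1) (hκ : κ = 1 / q) :
    0 < Real.log κ ∧ Real.log q = -Real.log κ := by
  have h : Real.log κ = -Real.log q := by rw [hκ, one_div, Real.log_inv]
  exact ⟨by rw [h]; linarith [Real.log_neg hq0 hq1], by rw [h, neg_neg]⟩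

theorem rpow_eq_exp_kappa (hq0 : 0 < q) (hq1 : q < 1) (hκ : κ = 1 / q) (y : ℝ) :
    q ^ y = Real.exp (-(y * Real.log κ)) := by
  rw [Real.rpow_def_of_pos hq0, (log_kappa_pos hq0 hq1 hκ).2]
  ring_nf

theorem triangle_cast (N : ℕ) : (((N : ℤ) * (N + 1) / 2 : ℤ) : ℝ) = (N : ℝ) * (N + 1) / 2 := by
  have h : ((2 * ((N : ℤ) * (N + 1) / 2) : ℤ) : ℝ) = ((N : ℤ) * (N + 1) : ℤ) := by
    rw [two_mul_triangle]
  push_cast at h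
  linarith

theorem shiftPref_eq_exp (hq0 : 0 < q) (hq1 : q < 1) (hκ : κ = 1 / q) (N : ℕ) (f : ℝ) :
    shiftPref q (q ^ (-f)) N =
      Real.exp (((N : ℝ) * (N + 1) / 2 + f * N) * Real.log κ) := by
  rw [shiftPref, ← Real.rpow_intCast, ← Real.rpow_natCast, ← Real.rpow_mul hq0.le,
    ← Real.rpow_add hq0, rpow_eq_exp_kappa hq0 hq1 hκ]
  congr 1
  rw [Int.cast_neg, triangle_cast]
  ring

/-- With L = log κ and u = N + f, the exponents combine as u²L/2 - (f² + f)L/2 + uL/2 + u =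
(N(N+1)/2 + fN)L + u. -/
theorem saddleMain_eq (hq0 : 0 < q) (hq1 : q < 1) (hκ : κ = 1 / q) {r : ℝ} (hr : 0 < r) {N : ℕ}
    {f : ℝ} (hf : Int.fract (Real.logb κ (1 / r)) = f) (hu : Real.logb κ (1 / r) = N + f) :
    saddleMain q κ r = shiftPref q (q ^ (-f)) N * Real.exp (N + f) * thetaF q (q ^ (-f)) /
      √(2 * Real.pi * (N + f)) := by
  obtain ⟨hL, -⟩ := log_kappa_pos hq0 hq1 hκ
  set L := Real.log κ with hLd
  have hlog : Real.log (1 / r) = (N + f) * L := by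
    rw [← hu, Real.logb, ← hLd, div_mul_cancel₀ _ hL.ne']
  have hlogr : Real.log r = -((N + f) * L) := by
    rw [← hlog, one_div, Real.log_inv, neg_neg]
  rw [saddleMain, periodicG, hf, hu, hlog, ← hLd, Real.rpow_def_of_pos hr, hlogr,
    shiftPref_eq_exp hq0 hq1 hκ, rpow_eq_exp_kappa hq0 hq1 hκ ((f ^ 2 + f) / 2), ← hLd,
    div_mul_eq_div_div, ← mul_assoc, ← Real.exp_add, ← Real.exp_add, div_eq_mul_inv _ (Real.exp _),
    ← Real.exp_neg, mul_right_comm, ← Real.exp_add]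
  congr 3
  field_simp
  ring

theorem one_div_eq_of_logb (hq0 : 0 < q) (hq1 : q < 1) (hκ : κ = 1 / q) {r : ℝ} (hr : 0 < r)
    {N : ℕ} {f : ℝ} (hu : Real.logb κ (1 / r) = N + f) : 1 / r = q ^ (-f) * q ^ (-(N : ℤ)) := by
  obtain ⟨hL, -⟩ := log_kappa_pos hq0 hq1 hκ
  have hlog : Real.log (1 / r) = (N + f) * Real.log κ := by
    rw [← hu, Real.logb, div_mul_cancel₀ _ hL.ne']
  rw [← Real.exp_log (one_div_pos.mpr hr), hlog, ← Real.rpow_intCast, ← Real.rpow_add hq0,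
    rpow_eq_exp_kappa hq0 hq1 hκ]
  congr 1
  push_cast
  ring

theorem IsSaddle.eq_mul (hq0 : 0 < q) (hq1 : q < 1) (hκ : κ = 1 / q) {x r : ℝ}
    (h : IsSaddle κ x r) : x = 1 / r * Real.logb κ (1 / r) := by
  obtain ⟨hL, -⟩ := log_kappa_pos hq0 hq1 hκ
  rw [Real.logb, ← mul_div_assoc, h.2, mul_div_cancel_right₀ _ hL.ne']

theorem mul_log_lt_mul_log {a b : ℝ} (ha : 1 ≤ a) (hab : a < b) :
    a * Real.log a < b * Real.log b :=
  mul_lt_mul'' hab (Real.log_lt_log (by linarith) hab) (by linarith) (Real.log_nonneg ha)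

theorem one_lt_of_mul_log_pos {y : ℝ} (hy : 0 < y) (h : 0 < y * Real.log y) : 1 < y :=
  (Real.log_pos_iff hy.le).mp (pos_of_mul_pos_right h hy.le)

theorem existsUnique_isSaddle (hq0 : 0 < q) (hq1 : q < 1) (hκ : κ = 1 / q) {x : ℝ} (hx : 0 < x) :
    ∃! r : ℝ, IsSaddle κ x r := by
  obtain ⟨hL, -⟩ := log_kappa_pos hq0 hq1 hκ
  set T := x * Real.log κ with hT
  have hT0 : 0 < T := by positivity
  have hexp : 1 ≤ Real.exp T := Real.one_le_exp hT0.le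
  -- For y = 1/r the equation is y log y = T; at y = e^T the left side is T e^T ≥ T, which supplies
  -- the right endpoint.
  obtain ⟨y, ⟨hy1, -⟩, hy⟩ := intermediate_value_Icc hexp Real.continuous_mul_log.continuousOn
    (show T ∈ Set.Icc (1 * Real.log 1) (Real.exp T * Real.log (Real.exp T)) by
      rw [Real.log_one, mul_zero, Real.log_exp]
      exact ⟨hT0.le, le_mul_of_one_le_left hT0.le hexp⟩)
  have hy0 : 0 < y := by linarith
  refine ⟨1 / y, ⟨by positivity, by rw [one_div_one_div]; exact hy⟩, fun r hr => ?_⟩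
  obtain ⟨hr0, hr1⟩ := hr
  rw [← hT] at hr1
  have h1 : 1 < 1 / r := one_lt_of_mul_log_pos (by positivity) (hr1 ▸ hT0)
  have hy' : y * Real.log y = T := hy
  have : 1 / r = y := by
    rcases lt_trichotomy (1 / r) y with h | h | h
    · have := mul_log_lt_mul_log h1.le h
      linarith
    · exact h
    · have := mul_log_lt_mul_log hy1 h
      linarith
  rw [← this, one_div_one_div]

theorem tendsto_one_div_saddle (hq0 : 0 < q) (hq1 : q < 1) (hκ : κ = 1 / q) {r : ℝ → ℝ}
    (hr : ∀ᶠ x in atTop, IsSaddle κ x (r x)) : Tendsto (fun x => 1 / r x) atTop atTop := by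
  obtain ⟨hL, -⟩ := log_kappa_pos hq0 hq1 hκ
  refine tendsto_atTop.mpr fun B => ?_
  set B' := max B 1 with hB'
  filter_upwards [hr, eventually_gt_atTop 0,
    eventually_gt_atTop (B' * Real.log B' / Real.log κ)] with x hx hx0 hxB
  refine le_trans (le_max_left B 1) ?_
  by_contra hlt
  push Not at hlt
  have hy0 : 0 < 1 / r x := one_div_pos.mpr hx.1
  have h1 : 1 < 1 / r x := one_lt_of_mul_log_pos hy0 (by rw [hx.2]; positivity)
  have h2 := mul_log_lt_mul_log h1.le hlt
  rw [hx.2] at h2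
  rw [div_lt_iff₀ hL] at hxB
  linarith

theorem tendsto_logb_saddle (hq0 : 0 < q) (hq1 : q < 1) (hκ : κ = 1 / q) {r : ℝ → ℝ}
    (hr : ∀ᶠ x in atTop, IsSaddle κ x (r x)) :
    Tendsto (fun x => Real.logb κ (1 / r x)) atTop atTop :=
  (Real.tendsto_log_atTop.comp (tendsto_one_div_saddle hq0 hq1 hκ hr)).atTop_div_const
    (log_kappa_pos hq0 hq1 hκ).1

theorem tendsto_floor_fract : Tendsto (fun u : ℝ => (⌊u⌋₊, Int.fract u)) atTop fractFilter :=
  tendsto_nat_floor_atTop.prodMk (tendsto_principal.mpr (Eventually.of_forall fun u =>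
    ⟨Int.fract_nonneg u, Int.fract_lt_one u⟩))

theorem natFloor_add_fract {u : ℝ} (hu : 0 ≤ u) : (⌊u⌋₊ : ℝ) + Int.fract u = u := by
  rw [natCast_floor_eq_intCast_floor hu, Int.floor_add_fract]

/-- This identity is exact: the saddle-point equation is x = u/r with 1/r = Q q^{-N}, so the Poisson
parameter u matches the recentring index N = ⌊u⌋. -/
theorem saddleMain_mul_saddleRatio {p : ℝ} (hq0 : 0 < q) (hq1 : q < 1) (hκ : κ = 1 / q) {x r : ℝ}
    (h : IsSaddle κ x r) (hu : 0 < Real.logb κ (1 / r)) :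
    saddleMain q κ r * saddleRatio p q (⌊Real.logb κ (1 / r)⌋₊, Int.fract (Real.logb κ (1 / r))) =
      poissonGF p x := by
  have h1 := natFloor_add_fract hu.le
  rw [saddleMain_eq hq0 hq1 hκ h.1 rfl h1.symm, saddleRatio]
  simp only
  have h2 := one_div_eq_of_logb hq0 hq1 hκ h.1 h1.symm
  rw [← h2, h1, ← h.eq_mul hq0 hq1 hκ]
  have hF := thetaF_pos hq0 hq1 (Q := q ^ (-Int.fract (Real.logb κ (1 / r)))) (by positivity)
  have hP : shiftPref q (q ^ (-Int.fract (Real.logb κ (1 / r)))) ⌊Real.logb κ (1 / r)⌋₊ ≠ 0 := by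
    unfold shiftPref; positivity
  have hs : √(2 * Real.pi * Real.logb κ (1 / r)) ≠ 0 := by positivity
  rw [Real.exp_neg]
  field_simp

/-- The expansion in (N, f) is pulled back along u ↦ (⌊u⌋, {u}), which is legitimate because it is
uniform in f. -/
theorem poissonGF_expansion {p : ℝ} (hp0 : 0 < p) (hp1 : p < 1) (hq : q = 1 - p) (hκ : κ = 1 / q)
    {c : ℕ → ℕ → Polynomial ℝ} (hc : ∀ l J, (fun x => diffNorm l x -
        ∑ j ∈ Finset.range (J + 1), (c l j).eval x.2 * invSum x ^ j)
      =O[fractFilter] fun x => invSum x ^ (J + 1))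
    (hc0 : ∀ l j, 2 * j < l → c l j = 0) (hc00 : c 0 0 = 1) {r : ℝ → ℝ}
    (hr : ∀ᶠ x in atTop, IsSaddle κ x (r x)) (J : ℕ) :
    (fun x : ℝ => poissonGF p x - saddleMain q κ (r x) *
        (1 + ∑ j ∈ Finset.Icc 1 J,
          saddleCoeff q c j (Real.logb κ (1 / r x)) * (Real.logb κ (1 / r x) ^ j)⁻¹))
      =O[atTop] fun x : ℝ => saddleMain q κ (r x) * (Real.logb κ (1 / r x) ^ (J + 1))⁻¹ := by
  have hq0 : 0 < q := by linarith
  have hq1 : q < 1 := by linarith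
  have htu := tendsto_logb_saddle hq0 hq1 hκ hr
  have h1 := (saddleRatio_expansion c hp0 hp1 hq hc hc0 J).comp_tendsto
    (tendsto_floor_fract.comp htu)
  have h2 := (isBigO_refl (fun x => saddleMain q κ (r x)) atTop).mul h1
  refine h2.congr' ?_ ?_
  · filter_upwards [hr, htu.eventually_gt_atTop 0] with x hx hu
    simp only [Function.comp]
    rw [mul_sub, saddleMain_mul_saddleRatio hq0 hq1 hκ hx hu]
    congr 2
    have h0 : saddleCoeff q c 0 (Int.fract (Real.logb κ (1 / r x))) = 1 := by
      simp [saddleCoeff, hc00, thetaRatio_zero hq0 hq1]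
    rw [Finset.sum_range_eq_add_Ico _ (by omega), pow_zero, mul_one, h0]
    congr 1
    refine Finset.sum_congr rfl fun j _ => ?_
    simp only [invSum, natFloor_add_fract hu.le, inv_pow, saddleCoeff, Int.fract_fract]
  · filter_upwards [htu.eventually_gt_atTop 0] with x hu
    simp only [Function.comp, invSum, natFloor_add_fract hu.le, inv_pow]

end Saddle

theorem saddleCoeff_one {q : ℝ} (hq0 : 0 < q) (hq1 : q < 1) {c : ℕ → ℕ → Polynomial ℝ}
    (h0 : c 0 1 = normCoeff) (h1 : c 1 1 = Polynomial.X - 1) (h2 : c 2 1 = -1) (u : ℝ) :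
    saddleCoeff q c 1 u = -(1 / 12 - Int.fract u * (1 - Int.fract u) / 2
          + (1 - Int.fract u) * q ^ (-Int.fract u) * deriv (thetaF q) (q ^ (-Int.fract u)) /
              thetaF q (q ^ (-Int.fract u))
          + q ^ (-2 * Int.fract u) * iteratedDeriv 2 (thetaF q) (q ^ (-Int.fract u)) /
              (2 * thetaF q (q ^ (-Int.fract u)))) := by
  have e : q ^ (-2 * Int.fract u) = (q ^ (-Int.fract u)) ^ 2 := by
    rw [← Real.rpow_natCast, ← Real.rpow_mul hq0.le]
    congr 1
    push_cast
    ring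
  have hF := thetaF_pos hq0 hq1 (Q := q ^ (-Int.fract u)) (by positivity)
  simp only [saddleCoeff, Finset.sum_range_succ, Finset.sum_range_zero, h0, h1, h2, zero_add,
    thetaRatio_zero hq0 hq1, mul_one]
  rw [thetaRatio_eq hq0 hq1, thetaRatio_eq hq0 hq1, e, iteratedDeriv_one]
  simp [normCoeff]
  field_simp
  ring

/-! ### The leading term in terms of x -/

section LeadingTerm

variable {q κ : ℝ}

theorem periodicG_periodic (q : ℝ) : Function.Periodic (periodicG q) 1 := fun u => by
  simp only [periodicG, Int.fract_add_one]

/-- The functional equation F(s) = s F(qs) makes the right side 1-periodic, so the fractional parts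
may be dropped. In this form smoothness across the integers is visible. -/
theorem periodicG_eq (hq0 : 0 < q) (u : ℝ) :
    periodicG q u = q ^ ((u ^ 2 + u) / 2) * thetaF q (q ^ (-u)) := by
  have h : Function.Periodic (fun u : ℝ => q ^ ((u ^ 2 + u) / 2) * thetaF q (q ^ (-u))) 1 :=
    fun u => by
      have e1 : q * q ^ (-(u + 1)) = q ^ (-u) := by
        rw [show -u = 1 + -(u + 1) by ring, Real.rpow_add hq0, Real.rpow_one]
      simp only
      rw [thetaF_eq_mul hq0 (s := q ^ (-(u + 1))) (by positivity), e1, ← mul_assoc,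
        ← Real.rpow_add hq0]
      ring_nf
  have h2 := h.sub_zsmul_eq (x := u) ⌊u⌋
  rw [zsmul_one] at h2
  exact h2

theorem contDiff_periodicG (hq0 : 0 < q) (hq1 : q < 1) : ContDiff ℝ 1 (periodicG q) := by
  have h1 : periodicG q = fun u => q ^ ((u ^ 2 + u) / 2) * thetaF q (q ^ (-u)) :=
    funext (periodicG_eq hq0)
  have h2 : ∀ g : ℝ → ℝ, ContDiff ℝ 1 g → ContDiff ℝ 1 (fun u => q ^ g u) := fun g hg => by
    simp only [Real.rpow_def_of_pos hq0]
    fun_prop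
  rw [h1]
  refine (h2 _ (by fun_prop)).mul (contDiff_iff_contDiffAt.mpr fun u => ?_)
  exact ContDiffAt.comp u (f := fun u : ℝ => q ^ (-u)) (g := thetaF q)
    (hasFPowerSeriesAt_thetaF hq0 hq1 (by positivity)).analyticAt.contDiffAt
    (h2 _ (by fun_prop)).contDiffAt

theorem exists_abs_periodicG_sub_le (hq0 : 0 < q) (hq1 : q < 1) :
    ∃ C : ℝ, 0 ≤ C ∧ ∀ u v, |periodicG q v - periodicG q u| ≤ C * |v - u| := by
  have hd := contDiff_periodicG hq0 hq1
  have hp : Function.Periodic (deriv (periodicG q)) 1 := fun u => by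
    rw [← deriv_comp_add_const, funext (periodicG_periodic q)]
  obtain ⟨C, hC⟩ := isBounded_iff_forall_norm_le.mp
    (hp.isBounded_of_continuous one_ne_zero hd.continuous_deriv_one)
  refine ⟨C, (norm_nonneg _).trans (hC _ ⟨0, rfl⟩), fun u v => ?_⟩
  exact Convex.norm_image_sub_le_of_norm_deriv_le
    (fun x _ => (hd.differentiable one_ne_zero) x) (fun x _ => hC _ ⟨x, rfl⟩) convex_univ
    (Set.mem_univ u) (Set.mem_univ v)

theorem half_mul_le_periodicG (hq0 : 0 < q) (hq1 : q < 1) (u : ℝ) : q / 2 ≤ periodicG q u := by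
  have hf0 := Int.fract_nonneg u
  have hf1 := (Int.fract_lt_one u).le
  have h1 : q ≤ q ^ ((Int.fract u ^ 2 + Int.fract u) / 2) := by
    conv_lhs => rw [← Real.rpow_one q]
    exact Real.rpow_le_rpow_of_exponent_ge hq0 hq1.le (by nlinarith)
  have h2 := half_le_thetaF hq0 hq1 (rpow_neg_mem_Icc hq0 hq1 rfl hf0 hf1).1
  rw [periodicG, div_eq_mul_inv]
  exact mul_le_mul h1 (by linarith) (by norm_num) (by positivity)

/-- The ratio of the leading term in `x` to the saddle-point prefactor, in terms of
`u = log_κ (1/r)`. -/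
noncomputable def leadingRatio (q κ u : ℝ) : ℝ :=
  periodicG q (u - Real.log (1 + Real.log u / (u * Real.log κ)) / Real.log κ) / periodicG q u *
    (1 + Real.log u / (u * Real.log κ))⁻¹ *
    Real.exp (u * (Real.log u / (u * Real.log κ) - Real.log (1 + Real.log u / (u * Real.log κ))) +
      Real.log (1 + Real.log u / (u * Real.log κ)) ^ 2 / (2 * Real.log κ))

theorem log_eq_of_isSaddle (hq0 : 0 < q) (hq1 : q < 1) (hκ : κ = 1 / q) {x r : ℝ}
    (h : IsSaddle κ x r) (hu : 1 < Real.logb κ (1 / r)) :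
    Real.log x = Real.logb κ (1 / r) * Real.log κ + Real.log (Real.logb κ (1 / r)) := by
  obtain ⟨hL, -⟩ := log_kappa_pos hq0 hq1 hκ
  rw [h.eq_mul hq0 hq1 hκ, Real.log_mul (one_div_pos.mpr h.1).ne' (by linarith)]
  congr 1
  rw [Real.logb, div_mul_cancel₀ _ hL.ne']

/-- With w = log u / (u log κ) one has log_κ x = u(1 + w) and log(x / log_κ x) = u log κ - log(1 +
w). Of the factor u in log_κ x, one √u cancels against the power of x and the other is the √u of the
prefactor. -/
theorem logMain_eq (hq0 : 0 < q) (hq1 : q < 1) (hκ : κ = 1 / q) {x r : ℝ}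
    (h : IsSaddle κ x r) (hu : 1 < Real.logb κ (1 / r)) :
    logMain q κ x = saddleMain q κ r * leadingRatio q κ (Real.logb κ (1 / r)) := by
  obtain ⟨hL, -⟩ := log_kappa_pos hq0 hq1 hκ
  have hlx := log_eq_of_isSaddle hq0 hq1 hκ h hu
  have hx : 0 < x := by
    rw [h.eq_mul hq0 hq1 hκ]
    exact mul_pos (one_div_pos.mpr h.1) (by linarith)
  have hlogr : Real.log r = -(Real.logb κ (1 / r) * Real.log κ) := by
    rw [Real.logb, div_mul_cancel₀ _ hL.ne', one_div, Real.log_inv, neg_neg]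
  have hlogr' : Real.log (1 / r) = Real.logb κ (1 / r) * Real.log κ := by
    rw [Real.logb, div_mul_cancel₀ _ hL.ne']
  rw [saddleMain, leadingRatio, Real.rpow_def_of_pos h.1, hlogr, hlogr']
  set u := Real.logb κ (1 / r) with hud
  have hu0 : 0 < u := by linarith
  have hl : 0 < Real.log u := Real.log_pos hu
  set w := Real.log u / (u * Real.log κ) with hw
  have hw0 : 0 < w := by positivity
  have hLx : Real.logb κ x = u * (1 + w) := by
    rw [Real.logb, hlx, hw]
    field_simp
  have hv : Real.log (x / Real.logb κ x) = u * Real.log κ - Real.log (1 + w) := by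
    rw [hLx, Real.log_div hx.ne' (by positivity), hlx, Real.log_mul hu0.ne' (by positivity)]
    ring
  have hv' : Real.logb κ (x / Real.logb κ x) = u - Real.log (1 + w) / Real.log κ := by
    rw [Real.logb, hv]
    field_simp
  rw [logMain, hv', hv, hLx, Real.rpow_def_of_pos hx, hlx,
    Real.sqrt_mul (by positivity : 0 ≤ 2 * Real.pi) u]
  have hG : periodicG q u ≠ 0 := by
    have := half_mul_le_periodicG hq0 hq1 u
    exact (by linarith : 0 < periodicG q u).ne'
  have hlw : Real.log u = u * Real.log κ * w := by
    rw [hw]; field_simp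
  have hs : √u = Real.exp (Real.log u / 2) := by
    rw [← Real.log_sqrt hu0.le, Real.exp_log (Real.sqrt_pos.mpr hu0)]
  have hu2 : u = √u * √u := (Real.mul_self_sqrt hu0.le).symm
  have key : Real.exp ((u * Real.log κ + Real.log u) * (1 / Real.log κ + 1 / 2)) *
      Real.exp ((u * Real.log κ - Real.log (1 + w)) ^ 2 / (2 * Real.log κ)) =
      Real.exp ((u * Real.log κ) ^ 2 / (2 * Real.log κ)) *
      Real.exp (-(-(u * Real.log κ) * (1 / Real.log κ + 1 / 2))) * √u *
      Real.exp (u * (w - Real.log (1 + w)) + Real.log (1 + w) ^ 2 / (2 * Real.log κ)) := by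
    rw [hs, ← Real.exp_add, ← Real.exp_add, ← Real.exp_add, ← Real.exp_add]
    congr 1
    rw [hlw]
    field_simp
    ring
  generalize periodicG q (u - Real.log (1 + w) / Real.log κ) = g at *
  calc _ = g / √(2 * Real.pi) / (u * (1 + w)) *
        (Real.exp ((u * Real.log κ + Real.log u) * (1 / Real.log κ + 1 / 2)) *
      Real.exp ((u * Real.log κ - Real.log (1 + w)) ^ 2 / (2 * Real.log κ))) := by ring
    _ = g / √(2 * Real.pi) / (√u * √u * (1 + w)) * _ := by rw [key, ← hu2]
    _ = _ := by
      have : √u ≠ 0 := (Real.sqrt_pos.mpr hu0).ne'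
      rw [Real.exp_neg]
      field_simp

/-- The dominant error is u(w - log(1+w)) ≤ u w², of order (log u)²/u. The variation of G, the
factor 1/(1+w) and the squared logarithm are only O(w). -/
theorem isBigO_leadingRatio_sub_one (hq0 : 0 < q) (hq1 : q < 1) (hκ : κ = 1 / q) :
    (fun u => leadingRatio q κ u - 1) =O[atTop] fun u => Real.log u ^ 2 / u := by
  obtain ⟨hL, -⟩ := log_kappa_pos hq0 hq1 hκ
  have hε : Tendsto (fun u : ℝ => Real.log u ^ 2 / u) atTop (nhds 0) := by
    simpa using Real.tendsto_pow_log_div_mul_add_atTop 1 0 2 one_ne_zero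
  set w : ℝ → ℝ := fun u => Real.log u / (u * Real.log κ) with hw
  have hbase : ∀ᶠ u : ℝ in atTop, 0 < u ∧ 1 ≤ Real.log u :=
    (eventually_gt_atTop 0).and (Real.tendsto_log_atTop.eventually_ge_atTop 1)
  have hw0 : ∀ᶠ u in atTop, 0 ≤ w u ∧ w u ≤ (Real.log κ)⁻¹ * (Real.log u ^ 2 / u) ∧
      u * w u ^ 2 = (Real.log κ)⁻¹ ^ 2 * (Real.log u ^ 2 / u) := by
    filter_upwards [hbase] with u ⟨h0, h1⟩
    have h2 : w u = (Real.log κ)⁻¹ * (Real.log u / u) := by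
      simp only [hw]; field_simp
    refine ⟨by simp only [hw]; positivity, ?_, ?_⟩
    · rw [h2]
      gcongr
      nlinarith
    · simp only [hw]; field_simp
  have hwO : w =O[atTop] fun u => Real.log u ^ 2 / u := by
    refine IsBigO.of_bound (Real.log κ)⁻¹ ?_
    filter_upwards [hw0] with u h
    rw [Real.norm_of_nonneg h.1]
    exact h.2.1.trans (by gcongr; exact Real.le_norm_self _)
  have hwt : Tendsto w atTop (nhds 0) := hwO.trans_tendsto hε
  have hlog : ∀ᶠ u in atTop, 0 ≤ Real.log (1 + w u) ∧ Real.log (1 + w u) ≤ w u ∧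
      w u - Real.log (1 + w u) ≤ w u ^ 2 := by
    filter_upwards [hw0] with u h
    have h1 : 0 < 1 + w u := by linarith [h.1]
    have h2 := Real.one_sub_inv_le_log_of_pos h1
    -- This identity turns log(1+w) ≥ 1 - 1/(1+w) into log(1+w) ≥ w - w² for w ≥ 0.
    have h3 : 1 - (1 + w u)⁻¹ - w u + w u ^ 2 = w u ^ 3 * (1 + w u)⁻¹ := by
      field_simp; ring
    have h4 : 0 ≤ w u ^ 3 * (1 + w u)⁻¹ := mul_nonneg (pow_nonneg h.1 3) (by positivity)
    exact ⟨Real.log_nonneg (by linarith [h.1]), by linarith [Real.log_le_sub_one_of_pos h1],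
      by linarith⟩
  have hG : (fun u => periodicG q (u - Real.log (1 + w u) / Real.log κ) / periodicG q u - 1)
      =O[atTop] fun u => Real.log u ^ 2 / u := by
    obtain ⟨C, hC0, hC⟩ := exists_abs_periodicG_sub_le hq0 hq1
    refine IsBigO.trans (IsBigO.of_bound (C * (Real.log κ)⁻¹ * (2 / q)) ?_) hwO
    filter_upwards [hw0, hlog] with u h1 h2
    have h3 := half_mul_le_periodicG hq0 hq1 u
    have h4 : 0 < periodicG q u := by linarith
    have h5 : (periodicG q u)⁻¹ ≤ 2 / q := by
      rw [← inv_div]; exact inv_anti₀ (by positivity) h3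
    rw [div_sub_one h4.ne', norm_div, Real.norm_eq_abs, Real.norm_of_nonneg h4.le,
      Real.norm_of_nonneg h1.1, div_eq_mul_inv]
    have h6 := hC u (u - Real.log (1 + w u) / Real.log κ)
    rw [sub_sub_cancel_left, abs_neg, abs_of_nonneg (div_nonneg h2.1 hL.le)] at h6
    calc _ ≤ C * (w u / Real.log κ) * (2 / q) := by
          refine mul_le_mul (h6.trans ?_) h5 (inv_nonneg.mpr h4.le)
            (mul_nonneg hC0 (div_nonneg h1.1 hL.le))
          gcongr
          exact h2.2.1
      _ = _ := by ring
  have hI : (fun u => (1 + w u)⁻¹ - 1) =O[atTop] fun u => Real.log u ^ 2 / u := by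
    refine IsBigO.trans (IsBigO.of_bound 1 ?_) hwO
    filter_upwards [hw0] with u h
    have h1 : 1 ≤ 1 + w u := by linarith [h.1]
    rw [Real.norm_eq_abs, abs_sub_comm, abs_of_nonneg (by linarith [inv_le_one_of_one_le₀ h1]),
      Real.norm_of_nonneg h.1, one_mul]
    have := Real.one_sub_inv_le_log_of_pos (by linarith : 0 < 1 + w u)
    linarith [Real.log_le_sub_one_of_pos (by linarith : 0 < 1 + w u)]
  have hE : (fun u => u * (w u - Real.log (1 + w u)) +
      Real.log (1 + w u) ^ 2 / (2 * Real.log κ)) =O[atTop] fun u => Real.log u ^ 2 / u := by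
    refine IsBigO.add ?_ ?_
    · refine IsBigO.of_bound ((Real.log κ)⁻¹ ^ 2) ?_
      filter_upwards [hw0, hlog, eventually_ge_atTop 0] with u h1 h2 h3
      rw [Real.norm_of_nonneg (mul_nonneg h3 (by linarith)), Real.norm_of_nonneg (by positivity),
        ← h1.2.2]
      exact mul_le_mul_of_nonneg_left h2.2.2 h3
    · refine IsBigO.trans (IsBigO.of_bound (2 * Real.log κ)⁻¹ ?_) hwO
      filter_upwards [hw0, hlog, hwt.eventually_le_const one_pos] with u h1 h2 h3
      rw [Real.norm_of_nonneg (by positivity), Real.norm_of_nonneg h1.1, div_eq_inv_mul]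
      gcongr
      nlinarith
  have hX : (fun u => Real.exp (u * (w u - Real.log (1 + w u)) +
      Real.log (1 + w u) ^ 2 / (2 * Real.log κ)) - 1) =O[atTop] fun u => Real.log u ^ 2 / u := by
    refine IsBigO.trans (IsBigO.of_bound 2 ?_) hE
    filter_upwards [(hE.trans_tendsto hε).abs.eventually_le_const (by norm_num : |(0 : ℝ)| < 1)]
      with u hu
    exact Real.abs_exp_sub_one_le hu
  have hmul : ∀ {a b : ℝ → ℝ}, (fun u => a u - 1) =O[atTop] (fun u => Real.log u ^ 2 / u) →
      (fun u => b u - 1) =O[atTop] (fun u => Real.log u ^ 2 / u) →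
      (fun u => a u * b u - 1) =O[atTop] fun u => Real.log u ^ 2 / u := fun {a b} ha hb => by
    have h1 : (fun u => (a u - 1) * (b u - 1)) =O[atTop] fun u => Real.log u ^ 2 / u := by
      simpa using ha.mul ((hb.trans_tendsto hε).isBigO_one ℝ)
    exact ((h1.add ha).add hb).congr_left fun u => by ring
  exact hmul (hmul hG hI) hX

theorem poissonGF_sub_logMain_isBigO {p : ℝ} (hq0 : 0 < q) (hq1 : q < 1) (hκ : κ = 1 / q)
    {r : ℝ → ℝ} (hr : ∀ᶠ x in atTop, IsSaddle κ x (r x))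
    (h : (fun x => poissonGF p x - saddleMain q κ (r x)) =O[atTop]
      fun x => saddleMain q κ (r x) * (Real.logb κ (1 / r x))⁻¹) :
    (fun x : ℝ => poissonGF p x - logMain q κ x)
      =O[atTop] fun x : ℝ => logMain q κ x * (Real.log (Real.log x) ^ 2 / Real.log x) := by
  obtain ⟨hL, -⟩ := log_kappa_pos hq0 hq1 hκ
  have hu := tendsto_logb_saddle hq0 hq1 hκ hr
  set u : ℝ → ℝ := fun x => Real.logb κ (1 / r x) with hud
  have hR := (isBigO_leadingRatio_sub_one hq0 hq1 hκ).comp_tendsto hu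
  have hε : Tendsto (fun u : ℝ => Real.log u ^ 2 / u) atTop (nhds 0) := by
    simpa using Real.tendsto_pow_log_div_mul_add_atTop 1 0 2 one_ne_zero
  have hM : ∀ᶠ x in atTop, logMain q κ x = saddleMain q κ (r x) * leadingRatio q κ (u x) := by
    filter_upwards [hr, hu.eventually_gt_atTop 1] with x h1 h2
    exact logMain_eq hq0 hq1 hκ h1 h2
  have hSM : (fun x => saddleMain q κ (r x)) =O[atTop] logMain q κ := by
    refine IsBigO.of_bound 2 ?_
    have h1 : Tendsto (fun x => leadingRatio q κ (u x) - 1) atTop (nhds 0) :=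
      hR.trans_tendsto (hε.comp hu)
    filter_upwards [hM, h1.eventually_const_le (by norm_num : (-(1 / 2) : ℝ) < 0)] with x h2 h3
    rw [h2, norm_mul, Real.norm_of_nonneg (r := leadingRatio q κ (u x)) (by linarith)]
    nlinarith [norm_nonneg (saddleMain q κ (r x))]
  have h1 : (fun x => poissonGF p x - saddleMain q κ (r x)) =O[atTop]
      fun x => saddleMain q κ (r x) * (Real.log (u x) ^ 2 / u x) := by
    refine h.trans ((isBigO_refl _ _).mul (IsBigO.of_bound 1 ?_))
    filter_upwards [hu.eventually_gt_atTop 0,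
      (Real.tendsto_log_atTop.comp hu).eventually_ge_atTop 1] with x h1 h2
    simp only [Function.comp] at h2
    rw [Real.norm_of_nonneg (by positivity), Real.norm_of_nonneg (by positivity), one_mul,
      inv_eq_one_div]
    gcongr
    nlinarith
  have h2 : (fun x => saddleMain q κ (r x) - logMain q κ x) =O[atTop]
      fun x => saddleMain q κ (r x) * (Real.log (u x) ^ 2 / u x) := by
    refine ((isBigO_refl (fun x => saddleMain q κ (r x)) _).mul hR.neg_left).congr' ?_ ?_
    · filter_upwards [hM] with x hx
      rw [hx]; simp only [Function.comp]; ring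
    · exact Eventually.of_forall fun x => rfl
  have h3 : (fun x => Real.log (u x) ^ 2 / u x) =O[atTop]
      fun x => Real.log (Real.log x) ^ 2 / Real.log x := by
    -- The 4 comes from log log x ≥ (log u)/2, valid once log u ≥ -2 log log κ, and the other factor
    -- from log x ≤ (log κ + 1)u.
    refine IsBigO.of_bound (4 * (Real.log κ + 1)) ?_
    filter_upwards [hr, hu.eventually_gt_atTop 1, (Real.tendsto_log_atTop.comp
      hu).eventually_ge_atTop (max 0 (-(2 * Real.log (Real.log κ))))] with x h1 h2 h3
    simp only [Function.comp, max_le_iff] at h3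
    have h4 := log_eq_of_isSaddle hq0 hq1 hκ h1 h2
    change _ = u x * Real.log κ + Real.log (u x) at h4
    have h0 : 0 < u x := by linarith
    have h5 : Real.log (u x) ≤ u x := (Real.log_le_sub_one_of_pos h0).trans (by linarith)
    have h6 : u x * Real.log κ ≤ Real.log x := by linarith [h3.1]
    have h7 : 0 < Real.log x := lt_of_lt_of_le (by positivity) h6
    have h8 := Real.log_le_log (by positivity) h6
    rw [Real.log_mul h0.ne' hL.ne'] at h8
    have h9 : Real.log (u x) / 2 ≤ Real.log (Real.log x) := by linarith [h3.2]
    have h10 : Real.log (u x) ^ 2 ≤ 4 * Real.log (Real.log x) ^ 2 := by nlinarith [h3.1]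
    rw [Real.norm_of_nonneg (by positivity), Real.norm_of_nonneg (by positivity),
      div_le_iff₀ h0]
    have h11 : Real.log x ≤ (Real.log κ + 1) * u x := by linarith
    calc _ ≤ 4 * Real.log (Real.log x) ^ 2 * (Real.log x / Real.log x) := by
          rw [div_self h7.ne', mul_one]; exact h10
      _ ≤ 4 * Real.log (Real.log x) ^ 2 * ((Real.log κ + 1) * u x / Real.log x) := by gcongr
      _ = _ := by ring
  exact ((h1.add h2).congr_left fun x => by ring).trans (hSM.mul h3)

end LeadingTerm

/-! ### The theorem -/

theorem mainTheorem2 (p q κ : ℝ) (hp0 : 0 < p) (hp1 : p < 1) (hq : q = 1 - p) (hκ : κ = 1 / q) :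
    -- the Poisson generating function solves the `q`-differential equation
    (poissonGF p 0 = 0 ∧
      ∀ x : ℝ, HasDerivAt (poissonGF p) (poissonGF p (q * x) + Real.exp (-x)) x) ∧
    -- the saddle-point equation determines `r`
    (∀ x : ℝ, 0 < x → ∃! r : ℝ, IsSaddle κ x r) ∧
    -- the full asymptotic expansion
    (∃ φ : ℕ → ℝ → ℝ,
      (∀ j : ℕ, 1 ≤ j →
        Function.Periodic (φ j) 1 ∧
        (∃ C : ℝ, ∀ u : ℝ, |φ j u| ≤ C) ∧
        -- `φ_j(u)` is a polynomial in `{u}` and in the `Q^k F^{(k)}(Q) / F(Q)`, `1 ≤ k ≤ 2j`,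
        -- where `Q = q^{-{u}}`
        (∃ P : MvPolynomial (Fin (2 * j + 1)) ℝ, ∀ u : ℝ,
          φ j u = MvPolynomial.eval
            (fun k : Fin (2 * j + 1) =>
              if (k : ℕ) = 0 then Int.fract u
              else (q ^ (-Int.fract u)) ^ (k : ℕ) *
                iteratedDeriv (k : ℕ) (thetaF q) (q ^ (-Int.fract u)) /
                  thetaF q (q ^ (-Int.fract u))) P)) ∧
      (∀ u : ℝ, φ 1 u =
        -(1 / 12 - Int.fract u * (1 - Int.fract u) / 2
          + (1 - Int.fract u) * q ^ (-Int.fract u) * deriv (thetaF q) (q ^ (-Int.fract u)) /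
              thetaF q (q ^ (-Int.fract u))
          + q ^ (-2 * Int.fract u) * iteratedDeriv 2 (thetaF q) (q ^ (-Int.fract u)) /
              (2 * thetaF q (q ^ (-Int.fract u))))) ∧
      ∀ r : ℝ → ℝ, (∀ᶠ x in atTop, IsSaddle κ x (r x)) →
        ∀ J : ℕ,
          (fun x : ℝ => poissonGF p x - saddleMain q κ (r x) *
              (1 + ∑ j ∈ Finset.Icc 1 J,
                φ j (Real.logb κ (1 / r x)) * (Real.logb κ (1 / r x) ^ j)⁻¹))
            =O[atTop] fun x : ℝ => saddleMain q κ (r x) *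
              (Real.logb κ (1 / r x) ^ (J + 1))⁻¹) ∧
    -- the leading term in terms of `log x`
    ((fun x : ℝ => poissonGF p x - logMain q κ x)
      =O[atTop] fun x : ℝ => logMain q κ x * (Real.log (Real.log x) ^ 2 / Real.log x)) := by
  have hq0 : 0 < q := by linarith
  have hq1 : q < 1 := by linarith
  -- Part (iv) does not mention r; a choice of solutions is fixed so that the expansion with J = 0
  -- can be applied.
  have hr : ∀ᶠ x in atTop, IsSaddle κ x (Classical.epsilon (IsSaddle κ x)) := by
    filter_upwards [eventually_gt_atTop 0] with x hx
    exact Classical.epsilon_spec (existsUnique_isSaddle hq0 hq1 hκ hx).exists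
  obtain ⟨c, hc, hc0, h00, h01, h11, h21⟩ := exists_diffNorm_expansion
  refine ⟨⟨poissonGF_zero p, fun x => ?_⟩, fun x hx => existsUnique_isSaddle hq0 hq1 hκ hx,
    ⟨saddleCoeff q c, fun j _ => ⟨saddleCoeff_periodic q c j, saddleCoeff_bounded c hq0 hq1 j,
      saddleCoeff_mvPolynomial c hq0 hq1 j⟩, saddleCoeff_one hq0 hq1 h01 h11 h21,
      fun r hr J => poissonGF_expansion hp0 hp1 hq hκ hc hc0 h00 hr J⟩,
    poissonGF_sub_logMain_isBigO hq0 hq1 hκ hr ?_⟩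
  · rw [hq]
    exact hasDerivAt_poissonGF hp0.le hp1.le x
  · simpa using poissonGF_expansion hp0 hp1 hq hκ hc hc0 h00 hr 0
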